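/- Let $d\ge 1$, let $K\subset\mathbb R^d$ be a bounded convex set with non-empty interior, and let $X_1,X_2,\dots,X_n$ be independent and uniformly distributed on $K$. For a scale $r\ge 0$ and a vector $\rho=(p_1,p_2,\dots)$ with $0\le p_i\le 1$, let $R(n,r,\rho)$ be the random simplicial complex on the vertices $X_1,\dots,X_n$ obtained as follows: every set $\sigma$ of $i+1\ge 2$ vertices is, independently of everything else, retained with probability $p_i$, and a set of vertices spans a simplex of $R(n,r,\rho)$ if and only if its points are pairwise at distance at most $r$ and all of its subsets with at least two elements (itself included) are retained. Here $r=r(n)$ and $p_i=p_i(n)$ may depend on $n$. Let $H_k$ denote the simplicial homology of $R(n,r,\rho)$ with coefficients in a fixed nonzero commutative ring (for instance $\mathbb Z$ or a field). "A.a.s." means with probability tending to $1$ as $n\to\infty$. Fix $k\ge 1$ and put $$q(n)=(1-p_{k+1})\prod_{i=1}^{k}p_i^{\binom{k+2}{i+1}}\;n^{k+2}\,r^{d(k+1)} .$$ 1. $H_k=0$ a.a.s. in either of the following two cases: (a) $q(n)\to 0$, that is, $r^{d(k+1)}=o\Big(\big((1-p_{k+1})\prod_{i=1}^{k}p_i^{\binom{k+2}{i+1}}n^{k+2}\big)^{-1}\Big)$,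 and moreover $nr^d=o\Big((1-p_{k+1})\prod_{i=1}^{k}p_i^{\binom{k+1}{i}}\Big)$; (b) $r=\omega\big((\log n/n)^{1/d}\big)$ and each of $p_1(n),\dots,p_{k+1}(n)$ is bounded away from zero. 2. Suppose $d\ge 2$. If $q(n)\to\infty$, that is, $r^{d(k+1)}=\omega\Big(\big((1-p_{k+1})\prod_{i=1}^{k}p_i^{\binom{k+2}{i+1}}n^{k+2}\big)^{-1}\Big)$, and $r=o\big((\log n/n)^{1/d}\big)$, and $p_i(n)\to 1$ for every $1\le i\le k$, then $H_k\ne 0$ a.a.s. (The reciprocal is read as $+\infty$ when the quantity inverted is $0$.) -/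

import Mathlib

open Filter Topology MeasureTheory ProbabilityTheory Asymptotics

set_option maxSynthPendingDepth 3

namespace SoftRips

universe u w

/-! ### Simplicial homology of an abstract simplicial complex -/

section Homology

variable {V : Type u} [LinearOrder V]

/-- The `k`-dimensional faces of `X`: faces with `k + 1` vertices. -/
def Simplex (X : AbstractSimplicialComplex V) (k : ℕ) : Type u :=
  {s : Finset V // s ∈ X.faces ∧ s.card = k + 1}

/-- The codimension-one face of a `(k+1)`-simplex obtained by removing the vertex `v`. -/
def Simplex.face {X : AbstractSimplicialComplex V} {k : ℕ} (s : Simplex X (k + 1)) (v : s.1) :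
    Simplex X k :=
  ⟨s.1.erase v.1, by
    have hc : (s.1.erase v.1).card = k + 1 := by
      rw [Finset.card_erase_of_mem v.2, s.2.2]; rfl
    refine ⟨(X.isRelLowerSet_faces s.2.1).2 (Finset.erase_subset _ _) ?_, hc⟩
    exact Finset.card_pos.mp (by omega)⟩

/-- The position (starting from `0`) of the vertex `v` in the increasing list of vertices of `s`. -/
def position (s : Finset V) (v : V) : ℕ := (s.filter (· < v)).card

/-- The simplicial boundary `∂ : C_{k+1}(X; A) → C_k(X; A)`,
`∂[v₀ < ⋯ < v_{k+1}] = ∑ⱼ (-1)ʲ [v₀, …, v̂ⱼ, …, v_{k+1}]`, where `C_k(X; A)` is the free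
`A`-module on the `k`-simplices of `X`. -/
noncomputable def boundary (A : Type w) [CommRing A] (X : AbstractSimplicialComplex V) (k : ℕ) :
    (Simplex X (k + 1) →₀ A) →ₗ[A] (Simplex X k →₀ A) :=
  Finsupp.linearCombination A fun s : Simplex X (k + 1) =>
    ∑ v : s.1, Finsupp.single (s.face v) ((-1 : A) ^ position s.1 v.1)

/-- The boundary of a boundary is zero. -/
theorem boundary_boundary (A : Type w) [CommRing A] (X : AbstractSimplicialComplex V) (k : ℕ) :
    boundary A X k ∘ₗ boundary A X (k + 1) = 0 := by
  refine Finsupp.lhom_ext' fun s => LinearMap.ext_ring ?_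
  simp only [boundary, LinearMap.comp_apply, Finsupp.lsingle_apply,
    Finsupp.linearCombination_single, one_smul, map_sum, LinearMap.zero_apply, Finset.smul_sum]
  rw [Finset.sum_sigma' (Finset.univ : Finset s.1) (fun v => (Finset.univ : Finset (s.face v).1))]
  refine Finset.sum_involution
    (fun z _ => ⟨⟨z.2.1, Finset.mem_of_mem_erase z.2.2⟩, ⟨z.1.1, Finset.mem_erase.2
      ⟨(Finset.ne_of_mem_erase z.2.2).symm, z.1.2⟩⟩⟩) ?_ ?_ ?_ ?_
  · rintro ⟨⟨v, hv⟩, ⟨w, hw⟩⟩ -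
    have hw' : w ∈ s.1.erase v := hw
    have hne := Finset.ne_of_mem_erase hw'
    have hws := Finset.mem_of_mem_erase hw'
    have hf : (s.face ⟨v, hv⟩).face ⟨w, hw⟩ = (s.face ⟨w, hws⟩).face
        ⟨v, Finset.mem_erase.2 ⟨hne.symm, hv⟩⟩ := Subtype.ext (Finset.erase_right_comm)
    simp only [hf, Finsupp.smul_single, ← Finsupp.single_add]
    have key : ∀ a b : V, a ∈ s.1 → b ∈ s.1 → a < b →
        position (s.1.erase b) a = position s.1 a ∧
        position s.1 b = position (s.1.erase a) b + 1 := by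
      intro a b ha hb hab
      constructor
      · unfold position
        congr 1
        ext x
        simp only [Finset.mem_filter, Finset.mem_erase]
        constructor
        · tauto
        · rintro ⟨h1, h2⟩
          exact ⟨⟨(h2.trans hab).ne, h1⟩, h2⟩
      · unfold position
        rw [Finset.filter_erase, Finset.card_erase_add_one]
        simp [ha, hab]
    have hz : ((-1 : A) ^ position s.1 v • (-1 : A) ^ position (s.face ⟨v, hv⟩).1 w +
        (-1 : A) ^ position s.1 w • (-1 : A) ^ position (s.face ⟨w, hws⟩).1 v) = 0 := by
      simp only [Simplex.face, smul_eq_mul]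
      rcases lt_or_gt_of_ne hne with h | h
      · obtain ⟨h1, h2⟩ := key w v hws hv h
        rw [h1, h2, pow_succ]; ring
      · obtain ⟨h1, h2⟩ := key v w hv hws h
        rw [h1, h2, pow_succ]; ring
    rw [hz, Finsupp.single_zero]
  · rintro ⟨⟨v, hv⟩, ⟨w, hw⟩⟩ - - h
    have hw' : w ∈ s.1.erase v := hw
    have := congrArg (fun z => z.1.1) h
    exact Finset.ne_of_mem_erase hw' this
  · intros; simp
  · rintro ⟨⟨v, hv⟩, ⟨w, hw⟩⟩ -; rfl

/-- The `k`-cycles of `X`; every `0`-chain is a cycle. -/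
noncomputable def cycles (A : Type w) [CommRing A] (X : AbstractSimplicialComplex V) :
    (k : ℕ) → Submodule A (Simplex X k →₀ A)
  | 0 => ⊤
  | k + 1 => LinearMap.ker (boundary A X k)

/-- The simplicial homology `H_k(X; A)`: cycles modulo boundaries. -/
abbrev Homology (A : Type w) [CommRing A] (X : AbstractSimplicialComplex V) (k : ℕ) :
    Type (max u w) :=
  cycles A X k ⧸ (LinearMap.range (boundary A X k)).submoduleOf (cycles A X k)

end Homology

/-! ### The soft random Vietoris–Rips complex -/

section Model

variable {d : ℕ}

/-- The soft Vietoris–Rips complex at scale `r` on the points `x 0, …, x (n-1)`, where `coin s`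
records whether the simplex `s` (with at least two vertices) is retained. A set of vertices spans
a simplex iff its points are at pairwise distance at most `r` (that is, the closed balls of radius
`r / 2` around them meet pairwise) and all of its faces with at least two vertices, itself
included, are retained. -/
def softRips {n : ℕ} (r : ℝ) (x : Fin n → EuclideanSpace ℝ (Fin d))
    (coin : Finset (Fin n) → Bool) : AbstractSimplicialComplex (Fin n) where
  faces := {s | s.Nonempty ∧ (s : Set (Fin n)).Pairwise (fun i j => dist (x i) (x j) ≤ r) ∧
    ∀ t ⊆ s, 2 ≤ t.card → coin t = true}
  isRelLowerSet_faces := fun _ hs => ⟨hs.1, fun _ hts ht =>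
    ⟨ht, hs.2.1.mono (Finset.coe_subset.mpr hts), fun u hu => hs.2.2 u (hu.trans hts)⟩⟩
  singleton_mem := fun v => ⟨Finset.singleton_nonempty v, by simp, fun t ht h2 => by
    have := Finset.card_le_card ht
    simp at this
    omega⟩

/-- The joint law of the `n` points and of the coins: the points are independent and uniform on
`K`, the coins are independent of each other and of the points, and the coin of a set of `i + 1`
vertices (an `i`-simplex) is `true` with probability `ρ i`. (The coins of sets with at most one
vertex are never used.) -/
noncomputable def law (K : Set (EuclideanSpace ℝ (Fin d))) (ρ : ℕ → unitInterval) (n : ℕ) :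
    Measure ((Fin n → EuclideanSpace ℝ (Fin d)) × (Finset (Fin n) → Bool)) :=
  (Measure.pi fun _ : Fin n => (volume[|K] : Measure (EuclideanSpace ℝ (Fin d)))).prod
    (Measure.pi fun s : Finset (Fin n) => bernoulliMeasure true false (ρ (s.card - 1)))

/-- The property `E` holds asymptotically almost surely for `R(n, r n, p n)`. -/
def AAS (K : Set (EuclideanSpace ℝ (Fin d))) (r : ℕ → ℝ) (p : ℕ → ℕ → unitInterval)
    (E : ∀ n : ℕ, AbstractSimplicialComplex (Fin n) → Prop) : Prop :=
  Tendsto (fun n => law K (p n) n {ω | E n (softRips (r n) ω.1 ω.2)}) atTop (𝓝 1)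

end Model

end SoftRips

set_option linter.unusedSectionVars false

namespace SoftRips

universe u w

/-! ### Cone operators and the inductive chain homotopy -/

section ChainAlgebra

variable {V : Type u} [LinearOrder V] (A : Type w) [CommRing A]

/-! Sparse vanishing (case 1a) is a first-moment argument resting on `exists_bd_eq_of_no_hollow`. In
a cycle, every facet of a supporting simplex `s` is shared with another supporting simplex, obtained
by exchanging one vertex. If at most one outside vertex is adjacent to `s`, all these exchanges use
the same vertex `a`, so every facet of `s ∪ {a}` occurs in the cycle; if hollow simplices are
absent, `s ∪ {a}` is a face, and subtracting its boundary shrinks the support. Thus nonzero homology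
needs a hollow simplex or a `k`-simplex with two further vertices nearby. The expected number of the
former is `O(q)`. For the latter the additional vertex costs a factor `n r^d`, which the second
hypothesis of (1a) turns into the missing coin weight, giving `O(q)` again.

Dense vanishing (case 1b) contracts cycles (`exists_bd_eq_of_rich`). Suppose that near every point
of `K` there is a vertex coning off any prescribed boundedly large set of vertices, as far as the
coins are concerned. Choose inductively for each simplex an apex near its barycentre, pulled
slightly towards a fixed point `c` of `K`. The gap between `r` and the distance from a vertex to the
barycentre leaves room for this, and the resulting homotopy moves the cycle onto the apices, which
are closer to `c` by a fixed amount. After finitely many rounds everything lies in a ball of radius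
`r / 2` and can be coned off. The coning property fails for a fixed set and a fixed small ball with
probability at most `exp (-γ n min(r, 1)^d)`, which beats the polynomially many choices once `n r^d`
dominates `log n`.

Nonvanishing (part 2) exhibits an isolated pattern carrying a cycle with a maximal face; such a
cycle is no boundary. With `x = n r^d`, the expected number of isolated copies of a pattern on `m +
1` points is at least of order `n x^m exp (-C x)` times its coin weight. If `x ≤ 1`, hollow
simplices serve, their expected number being at least a constant times `q`. If `x ≥ 1`,
cross-polytopes on `2k + 2` points serve: their weight tends to `1` and `exp (-C x)` exceeds `n ^
(-1/2)` since `x = o(log n)`. Cells around a separated net make the occurrences nearly independent,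
so a second-moment bound concludes. -/

theorem position_insert {s : Finset V} {x : V} (hx : x ∉ s) (v : V) :
    position (insert x s) v = position s v + if x < v then 1 else 0 := by
  unfold position
  rw [Finset.filter_insert]
  split_ifs with h
  · rw [Finset.card_insert_of_notMem (by simp [hx])]
  · rfl

theorem position_erase_add {s : Finset V} {v : V} (hv : v ∈ s) (x : V) :
    position (s.erase v) x + (if v < x then 1 else 0) = position s x := by
  rw [← position_insert (Finset.notMem_erase v s), Finset.insert_erase hv]

/-- The augmented simplicial boundary on the free module spanned by all finite sets. -/
noncomputable def bd : (Finset V →₀ A) →ₗ[A] (Finset V →₀ A) :=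
  Finsupp.linearCombination A fun s : Finset V =>
    ∑ v ∈ s, Finsupp.single (s.erase v) ((-1 : A) ^ position s v)

/-- The cone operator with apex `x`; it kills the simplices that contain `x`. -/
noncomputable def cone (x : V) : (Finset V →₀ A) →ₗ[A] (Finset V →₀ A) :=
  Finsupp.linearCombination A fun s : Finset V =>
    if x ∈ s then 0 else Finsupp.single (insert x s) ((-1 : A) ^ position s x)

variable {A}

theorem bd_single (s : Finset V) (a : A) :
    bd A (Finsupp.single s a) =
      ∑ v ∈ s, Finsupp.single (s.erase v) (a * (-1 : A) ^ position s v) := by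
  simp [bd, Finsupp.linearCombination_single, Finset.smul_sum]

theorem cone_single_of_mem {x : V} {s : Finset V} (hx : x ∈ s) (a : A) :
    cone A x (Finsupp.single s a) = 0 := by
  simp [cone, Finsupp.linearCombination_single, hx]

theorem cone_single_of_notMem {x : V} {s : Finset V} (hx : x ∉ s) (a : A) :
    cone A x (Finsupp.single s a) =
      Finsupp.single (insert x s) (a * (-1 : A) ^ position s x) := by
  simp [cone, Finsupp.linearCombination_single, hx]

/-- The identity `∂x + x∂ = id`. If `x ∈ s`, only the facet opposite `x` survives coning. Otherwise
the terms for each `v ∈ s` cancel: exactly one of "inserting `x` shifts `v`" and "removing `v`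
shifts `x`" occurs, so the two signs are opposite. Keeping the empty simplex makes the identity hold
in every degree. -/
theorem bd_cone_single (x : V) (s : Finset V) :
    bd A (cone A x (Finsupp.single s 1)) + cone A x (bd A (Finsupp.single s 1)) =
      Finsupp.single s 1 := by
  by_cases hx : x ∈ s
  · rw [cone_single_of_mem hx, map_zero, zero_add, bd_single, map_sum,
      Finset.sum_eq_single_of_mem x hx]
    · rw [cone_single_of_notMem (Finset.notMem_erase x s), Finset.insert_erase hx]
      have h := position_erase_add hx x
      simp only [lt_irrefl, if_false, add_zero] at h
      rw [h, one_mul, ← mul_pow]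
      simp
    · intro v _ hvx
      exact cone_single_of_mem (Finset.mem_erase.2 ⟨hvx.symm, hx⟩) _
  · rw [cone_single_of_notMem hx, bd_single, bd_single, map_sum, Finset.sum_insert hx,
      Finset.erase_insert hx]
    have h0 := position_insert hx x
    simp only [lt_irrefl, if_false, add_zero] at h0
    rw [h0, one_mul, ← mul_pow, add_assoc, ← Finset.sum_add_distrib, Finset.sum_eq_zero]
    · simp
    · intro v hv
      have hvx : v ≠ x := fun h => hx (h ▸ hv)
      rw [cone_single_of_notMem (fun h => hx (Finset.mem_of_mem_erase h)),
        Finset.erase_insert_of_ne hvx.symm, ← Finsupp.single_add]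
      have h1 := position_insert hx v
      have h2 := position_erase_add hv x
      rw [h1, ← h2]
      rw [Finsupp.single_eq_zero]
      rcases lt_or_gt_of_ne hvx with h | h
      · rw [if_pos h, if_neg h.not_gt]
        ring
      · rw [if_pos h, if_neg h.not_gt]
        ring

theorem bd_cone (x : V) (c : Finset V →₀ A) :
    bd A (cone A x c) + cone A x (bd A c) = c := by
  have : bd A ∘ₗ cone A x + cone A x ∘ₗ bd A = LinearMap.id := by
    refine Finsupp.lhom_ext' fun s => LinearMap.ext_ring ?_
    simpa using bd_cone_single x s
  simpa using LinearMap.congr_fun this c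

/-- Every nonempty simplex is, up to sign, a cone over a smaller one. Comparing `bd_cone` for `c`,
after applying `∂`, with `bd_cone` for `∂c` reduces the claim to the smaller simplex. -/
theorem bd_bd (c : Finset V →₀ A) : bd A (bd A c) = 0 := by
  have : bd A ∘ₗ bd A = (0 : (Finset V →₀ A) →ₗ[A] (Finset V →₀ A)) := by
    refine Finsupp.lhom_ext' fun s => LinearMap.ext_ring ?_
    simp only [LinearMap.comp_apply, Finsupp.lsingle_apply, LinearMap.zero_apply]
    induction s using Finset.induction_on with
    | empty => simp [bd_single]
    | insert x s hx ih =>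
      have h := bd_cone (A := A) x (Finsupp.single s ((-1 : A) ^ position s x))
      rw [cone_single_of_notMem hx, ← mul_pow] at h
      simp only [mul_neg, mul_one, neg_neg, one_pow] at h
      have h2 := congrArg (bd A) h
      rw [map_add] at h2
      have h3 := bd_cone (A := A) x (bd A (Finsupp.single s ((-1 : A) ^ position s x)))
      have h4 : bd A (bd A (Finsupp.single s ((-1 : A) ^ position s x))) = 0 := by
        rw [← mul_one ((-1 : A) ^ position s x), ← smul_eq_mul, ← Finsupp.smul_single,
          map_smul, map_smul, ih, smul_zero]
      rw [h4, map_zero, add_zero] at h3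
      rw [h3] at h2
      simpa using h2
  simpa using LinearMap.congr_fun this c

/-- The chain homotopy obtained by coning inductively over the faces, starting from the chain
`c₀` on the empty simplex: `D ∅ = c₀` and `D s = x_s * (s - D ∂s)`. -/
noncomputable def homotopy (x : Finset V → V) (c₀ : Finset V →₀ A) (s : Finset V) :
    Finset V →₀ A :=
  if s = ∅ then c₀ else
    cone A (x s) (Finsupp.single s 1 -
      ∑ v ∈ s.attach, (-1 : A) ^ position s v.1 • homotopy x c₀ (s.erase v.1))
termination_by s.card
decreasing_by exact Finset.card_erase_lt_of_mem v.2

/-- The chain map obtained by coning inductively over the faces. -/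
noncomputable def retract (x : Finset V → V) (c₀ : Finset V →₀ A) (s : Finset V) :
    Finset V →₀ A :=
  if s = ∅ then c₀ else
    cone A (x s) (∑ v ∈ s.attach, (-1 : A) ^ position s v.1 • retract x c₀ (s.erase v.1))
termination_by s.card
decreasing_by exact Finset.card_erase_lt_of_mem v.2

variable (x : Finset V → V) (c₀ : Finset V →₀ A)

theorem linearCombination_bd_single (D : Finset V → Finset V →₀ A) (s : Finset V) :
    Finsupp.linearCombination A D (bd A (Finsupp.single s 1)) =
      ∑ v ∈ s, (-1 : A) ^ position s v • D (s.erase v) := by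
  simp [bd_single, map_sum, Finsupp.linearCombination_single]

theorem homotopy_empty : homotopy x c₀ ∅ = c₀ := by
  rw [homotopy, if_pos rfl]

theorem retract_empty : retract x c₀ ∅ = c₀ := by
  rw [retract, if_pos rfl]

theorem homotopy_of_nonempty {s : Finset V} (hs : s.Nonempty) :
    homotopy x c₀ s = cone A (x s) (Finsupp.single s 1 -
      Finsupp.linearCombination A (homotopy x c₀) (bd A (Finsupp.single s 1))) := by
  rw [homotopy, if_neg hs.ne_empty, linearCombination_bd_single,
    Finset.sum_attach s (fun v => (-1 : A) ^ position s v • homotopy x c₀ (s.erase v))]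

theorem retract_of_nonempty {s : Finset V} (hs : s.Nonempty) :
    retract x c₀ s = cone A (x s)
      (Finsupp.linearCombination A (retract x c₀) (bd A (Finsupp.single s 1))) := by
  rw [retract, if_neg hs.ne_empty, linearCombination_bd_single,
    Finset.sum_attach s (fun v => (-1 : A) ^ position s v • retract x c₀ (s.erase v))]

/-- With `D` the homotopy and `R` the retraction, this is `∂D + D∂ + R = id`. By induction on the
facets, `s - D∂s` has boundary `R∂s`, and `bd_cone` finishes. The chain `c₀` selects the use: `c₀ =
0` pushes a cycle onto the apices, while for a single vertex `c₀` the chain `∅ - ∂c₀` vanishes, so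
`R = 0` and cycles become boundaries. -/
theorem bd_homotopy_single (s : Finset V) :
    bd A (homotopy x c₀ s) +
        Finsupp.linearCombination A (homotopy x c₀) (bd A (Finsupp.single s 1)) +
        retract x (Finsupp.single ∅ 1 - bd A c₀) s = Finsupp.single s 1 := by
  induction s using Finset.strongInduction with
  | H s ih =>
    rcases s.eq_empty_or_nonempty with rfl | hs
    · simp [homotopy_empty, retract_empty, bd_single]
    · set D := Finsupp.linearCombination A (homotopy x c₀) with hD
      set R := Finsupp.linearCombination A (retract x (Finsupp.single ∅ 1 - bd A c₀)) with hR
      have key : bd A (D (bd A (Finsupp.single s 1))) + R (bd A (Finsupp.single s 1)) =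
          bd A (Finsupp.single s 1) := by
        have h1 : ∀ v ∈ s, bd A (D (Finsupp.single (s.erase v) 1)) +
            D (bd A (Finsupp.single (s.erase v) 1)) + R (Finsupp.single (s.erase v) 1) =
            Finsupp.single (s.erase v) 1 := by
          intro v hv
          have := ih _ (Finset.erase_ssubset hv)
          simpa [hD, hR, Finsupp.linearCombination_single] using this
        have h2 : bd A (D (bd A (Finsupp.single s 1))) + D (bd A (bd A (Finsupp.single s 1))) +
            R (bd A (Finsupp.single s 1)) = bd A (Finsupp.single s 1) := by
          have h3 : bd A (Finsupp.single s (1 : A)) =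
              ∑ v ∈ s, (-1 : A) ^ position s v • Finsupp.single (s.erase v) 1 := by
            simp [bd_single]
          rw [h3]
          simp only [map_sum, map_smul]
          rw [← Finset.sum_add_distrib, ← Finset.sum_add_distrib]
          refine Finset.sum_congr rfl fun v hv => ?_
          rw [← smul_add, ← smul_add, h1 v hv]
        rwa [bd_bd, map_zero, add_zero] at h2
      rw [homotopy_of_nonempty x c₀ hs, retract_of_nonempty x _ hs, ← hD, ← hR]
      have h4 := bd_cone (A := A) (x s) (Finsupp.single s 1 - D (bd A (Finsupp.single s 1)))
      have h5 : bd A (Finsupp.single s 1 - D (bd A (Finsupp.single s 1))) =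
          R (bd A (Finsupp.single s 1)) := by
        rw [map_sub, sub_eq_iff_eq_add, add_comm, key]
      rw [h5] at h4
      rw [add_right_comm, h4]
      abel

theorem bd_homotopy (c : Finset V →₀ A) :
    bd A (Finsupp.linearCombination A (homotopy x c₀) c) +
        Finsupp.linearCombination A (homotopy x c₀) (bd A c) +
        Finsupp.linearCombination A (retract x (Finsupp.single ∅ 1 - bd A c₀)) c = c := by
  have : bd A ∘ₗ Finsupp.linearCombination A (homotopy x c₀) +
      Finsupp.linearCombination A (homotopy x c₀) ∘ₗ bd A +
      Finsupp.linearCombination A (retract x (Finsupp.single ∅ 1 - bd A c₀)) =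
      LinearMap.id := by
    refine Finsupp.lhom_ext' fun s => LinearMap.ext_ring ?_
    simpa [Finsupp.linearCombination_single] using bd_homotopy_single x c₀ s
  simpa using LinearMap.congr_fun this c

end ChainAlgebra

/-! ### Homology read off in the free module on finite sets -/

section Bridge

variable {V : Type u} [LinearOrder V] (A : Type w) [CommRing A]

/-- The chains spanned by the faces of `X` with `j` vertices. -/
noncomputable def chains (X : AbstractSimplicialComplex V) (j : ℕ) :
    Submodule A (Finset V →₀ A) :=
  Finsupp.supported A A {s | s ∈ X.faces ∧ s.card = j}

/-- The inclusion of the `k`-chains of `X` into the free module on all finite sets. -/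
noncomputable def emb (X : AbstractSimplicialComplex V) (k : ℕ) :
    (Simplex X k →₀ A) →ₗ[A] (Finset V →₀ A) :=
  Finsupp.lmapDomain A A fun s => s.1

variable {A}

theorem linearCombination_mem {ι M : Type*} [AddCommGroup M] [Module A M] (D : ι → M)
    {c : ι →₀ A} {N : Submodule A M} (h : ∀ s ∈ c.support, D s ∈ N) :
    Finsupp.linearCombination A D c ∈ N := by
  rw [Finsupp.linearCombination_apply]
  exact Submodule.sum_mem _ fun s hs => N.smul_mem _ (h s hs)

theorem emb_injective (X : AbstractSimplicialComplex V) (k : ℕ) :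
    Function.Injective (emb A X k) :=
  Finsupp.mapDomain_injective Subtype.val_injective

theorem emb_boundary (X : AbstractSimplicialComplex V) (k : ℕ) (c : Simplex X (k + 1) →₀ A) :
    emb A X k (boundary A X k c) = bd A (emb A X (k + 1) c) := by
  have : emb A X k ∘ₗ boundary A X k = bd A ∘ₗ emb A X (k + 1) := by
    refine Finsupp.lhom_ext' fun s => LinearMap.ext_ring ?_
    simp only [emb, boundary, LinearMap.comp_apply, Finsupp.lsingle_apply,
      Finsupp.linearCombination_single, one_smul, map_sum, Finsupp.lmapDomain_apply,
      Finsupp.mapDomain_single, bd_single, one_mul]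
    exact Finset.sum_coe_sort s.1
      (fun v => Finsupp.single (s.1.erase v) ((-1 : A) ^ position s.1 v))
  exact LinearMap.congr_fun this c

theorem emb_mem_chains (X : AbstractSimplicialComplex V) (k : ℕ) (c : Simplex X k →₀ A) :
    emb A X k c ∈ chains A X (k + 1) := by
  induction c using Finsupp.induction_linear with
  | zero => simp
  | add f g hf hg => rw [map_add]; exact add_mem hf hg
  | single s a =>
    simp only [emb, Finsupp.lmapDomain_apply, Finsupp.mapDomain_single]
    exact Finsupp.single_mem_supported A a s.2

theorem exists_emb_eq {X : AbstractSimplicialComplex V} {k : ℕ} {c : Finset V →₀ A}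
    (hc : c ∈ chains A X (k + 1)) : ∃ b, emb A X k b = c := by
  refine ⟨c.comapDomain (fun s : Simplex X k => s.1) Subtype.val_injective.injOn, ?_⟩
  exact Finsupp.mapDomain_comapDomain _ Subtype.val_injective _ fun s hs =>
    ⟨⟨s, (Finsupp.mem_supported A c).1 hc hs⟩, rfl⟩

/-- Chains are now indexed by the number of vertices, one more than the dimension. Only positive
degrees are covered, since `bd` is augmented and in degree `0` would compute reduced homology. -/
theorem subsingleton_homology_iff (X : AbstractSimplicialComplex V) (k : ℕ) :
    Subsingleton (Homology A X (k + 1)) ↔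
      ∀ z ∈ chains A X (k + 2), bd A z = 0 → ∃ w ∈ chains A X (k + 3), bd A w = z := by
  rw [Submodule.Quotient.subsingleton_iff, Submodule.eq_top_iff']
  constructor
  · intro h z hz hbd
    obtain ⟨b, rfl⟩ := exists_emb_eq hz
    have hb : b ∈ cycles A X (k + 1) := by
      refine LinearMap.mem_ker.2 (emb_injective (A := A) X k ?_)
      rw [emb_boundary, hbd, map_zero]
    obtain ⟨w, hw⟩ := h ⟨b, hb⟩
    refine ⟨emb A X (k + 2) w, emb_mem_chains X _ w, ?_⟩
    rw [← emb_boundary, hw]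
    rfl
  · rintro h ⟨b, hb⟩
    have hb' : boundary A X k b = 0 := hb
    obtain ⟨w, hw, hwb⟩ := h (emb A X (k + 1) b) (emb_mem_chains X _ b) (by
      rw [← emb_boundary, hb', map_zero])
    obtain ⟨c, rfl⟩ := exists_emb_eq hw
    refine ⟨c, emb_injective (A := A) X (k + 1) ?_⟩
    rw [emb_boundary, hwb]
    rfl

theorem bd_mem_chains {X : AbstractSimplicialComplex V} {j : ℕ} {c : Finset V →₀ A}
    (hc : c ∈ chains A X (j + 2)) : bd A c ∈ chains A X (j + 1) := by
  obtain ⟨b, rfl⟩ := exists_emb_eq hc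
  rw [← emb_boundary]
  exact emb_mem_chains X _ _

theorem bd_apply (c : Finset V →₀ A) (t : Finset V) :
    bd A c t = c.sum fun s a => ∑ v ∈ s, if s.erase v = t then a * (-1 : A) ^ position s v else 0 := by
  classical
  conv_lhs => rw [← c.sum_single]
  rw [Finsupp.sum, map_sum, Finsupp.finsetSum_apply, Finsupp.sum]
  refine Finset.sum_congr rfl fun s _ => ?_
  rw [bd_single, Finsupp.finsetSum_apply]
  refine Finset.sum_congr rfl fun v _ => ?_
  rw [Finsupp.single_apply]

/-- A simplex in the support of a cycle shares each of its facets with another simplex of the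
support. -/
theorem exists_adjacent_of_bd_eq_zero {z : Finset V →₀ A} (hz : bd A z = 0) {s : Finset V}
    (hs : s ∈ z.support) {v : V} (hv : v ∈ s) :
    ∃ a, a ∉ s ∧ insert a (s.erase v) ∈ z.support := by
  -- Were `s` the only supporting simplex over this facet, the coefficient of `∂z` there would be `±
  -- z s ≠ 0`.
  by_contra! hcon
  have h := congrArg (fun c => c (s.erase v)) hz
  simp only [Finsupp.coe_zero, Pi.zero_apply] at h
  rw [bd_apply, Finsupp.sum, Finset.sum_eq_single_of_mem s hs,
    Finset.sum_eq_single_of_mem v hv, if_pos rfl] at h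
  · have h2 : z s * (-1) ^ position s v * (-1) ^ position s v = 0 := by rw [h, zero_mul]
    rw [mul_assoc, ← mul_pow] at h2
    simp only [mul_neg, mul_one, neg_neg, one_pow] at h2
    exact (Finsupp.mem_support_iff.1 hs) h2
  · intro u hu huv
    refine if_neg fun he => huv ?_
    by_contra hne
    exact Finset.notMem_erase u s (he ▸ Finset.mem_erase.2 ⟨hne, hu⟩)
  · intro t ht hts
    refine Finset.sum_eq_zero fun u hu => if_neg fun he => ?_
    have hins : insert u (s.erase v) = t := by rw [← he, Finset.insert_erase hu]
    by_cases hus : u ∈ s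
    · have : u = v := by
        by_contra hne
        have h3 : u ∈ t.erase u := he ▸ Finset.mem_erase.2 ⟨hne, hus⟩
        exact Finset.notMem_erase u t h3
      rw [this, Finset.insert_erase hv] at hins
      exact hts hins.symm
    · exact hcon u hus (hins ▸ ht)

theorem bd_single_apply_erase {s : Finset V} {v : V} (hv : v ∈ s) (a : A) :
    bd A (Finsupp.single s a) (s.erase v) = a * (-1 : A) ^ position s v := by
  rw [bd_apply, Finsupp.sum_single_index (by simp), Finset.sum_eq_single_of_mem v hv, if_pos rfl]
  intro u hu huv
  refine if_neg fun he => huv ?_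
  by_contra hne
  exact Finset.notMem_erase u s (he ▸ Finset.mem_erase.2 ⟨hne, hu⟩)

theorem bd_single_apply_of_ne {s t : Finset V} (h : ∀ v ∈ s, s.erase v ≠ t) (a : A) :
    bd A (Finsupp.single s a) t = 0 := by
  rw [bd_apply, Finsupp.sum_single_index (by simp)]
  exact Finset.sum_eq_zero fun v hv => if_neg (h v hv)

/-- A cycle whose support contains a maximal face is not a boundary. -/
theorem ne_bd_of_maximal {X : AbstractSimplicialComplex V} {j : ℕ} {z w : Finset V →₀ A}
    {f : Finset V} (hw : w ∈ chains A X (j + 1)) (hf : f ∈ z.support)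
    (hmax : ∀ a ∉ f, insert a f ∉ X.faces) : bd A w ≠ z := by
  rintro rfl
  refine (Finsupp.mem_support_iff.1 hf) ?_
  rw [bd_apply]
  refine Finset.sum_eq_zero fun s hs => Finset.sum_eq_zero fun v hv => if_neg fun he => ?_
  refine hmax v (he ▸ Finset.notMem_erase v s) ?_
  rw [← he, Finset.insert_erase hv]
  exact ((Finsupp.mem_supported A w).1 hw hs).1

end Bridge

/-! ### Two deterministic criteria for vanishing homology -/

section Vanishing

variable {V : Type u} [LinearOrder V] {A : Type w} [CommRing A]

/-- If `X` has no hollow simplex with `k + 3` vertices and no `(k + 1)`-simplex has two distinct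
neighbours, then `X` has no homology in degree `k + 1`. -/
theorem exists_bd_eq_of_no_hollow {X : AbstractSimplicialComplex V} {k : ℕ}
    (h1 : ∀ s : Finset V, s.card = k + 3 → (∀ v ∈ s, s.erase v ∈ X.faces) → s ∈ X.faces)
    (h2 : ∀ s ∈ X.faces, s.card = k + 2 → ∀ a b, a ∉ s → b ∉ s →
      (∃ u ∈ s, {u, a} ∈ X.faces) → (∃ u ∈ s, {u, b} ∈ X.faces) → a = b)
    (z : Finset V →₀ A) (hz : z ∈ chains A X (k + 2)) (hbd : bd A z = 0) :
    ∃ w ∈ chains A X (k + 3), bd A w = z := by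
  induction hn : z.support.card using Nat.strong_induction_on generalizing z with
  | _ n ih =>
  by_cases hz0 : z = 0
  · exact ⟨0, zero_mem _, by rw [map_zero, hz0]⟩
  obtain ⟨s, hs⟩ := Finsupp.support_nonempty_iff.2 hz0
  have hsX := (Finsupp.mem_supported A z).1 hz
  have hpair : ∀ t : Finset V, ∀ a, a ∈ t → t ∈ X.faces → ∀ u ∈ t, {u, a} ∈ X.faces := by
    intro t a ha ht u hu
    exact (X.isRelLowerSet_faces ht).2 (by simp [Finset.insert_subset_iff, ha, hu]) (by simp)
  have hc : s.card = k + 2 := (hsX hs).2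
  have hother : ∀ v ∈ s, ∃ u ∈ s, u ≠ v := by
    intro v hv
    have : 1 < s.card := by omega
    exact Finset.exists_mem_ne this v
  -- neighbours of a simplex obtained by exchanging a vertex
  have hadj : ∀ t : Finset V, ∀ v ∈ t, ∀ a, (∃ u ∈ t, u ≠ v) →
      insert a (t.erase v) ∈ X.faces → ∃ u ∈ t, {u, a} ∈ X.faces := by
    rintro t v hv a ⟨u, hu, huv⟩ ht
    exact ⟨u, hu, hpair _ a (Finset.mem_insert_self _ _) ht u
      (Finset.mem_insert_of_mem (Finset.mem_erase.2 ⟨huv, hu⟩))⟩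
  obtain ⟨v₀, hv₀⟩ : s.Nonempty := Finset.card_pos.1 (by omega)
  obtain ⟨a, has, ha⟩ := exists_adjacent_of_bd_eq_zero hbd hs hv₀
  -- The vertex exchanged for `v` is adjacent to `s`, hence equals `a` whatever `v` is.
  have hswap : ∀ v ∈ s, insert a (s.erase v) ∈ z.support := by
    intro v hv
    obtain ⟨b, hbs, hb⟩ := exists_adjacent_of_bd_eq_zero hbd hs hv
    have : a = b := h2 s (hsX hs).1 hc a b has hbs
      (hadj s v₀ hv₀ a (hother _ hv₀) (hsX ha).1) (hadj s v hv b (hother _ hv) (hsX hb).1)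
    rwa [this]
  set t := insert a s with ht
  have hat : t.erase a = s := Finset.erase_insert has
  have htv : ∀ v ∈ s, t.erase v = insert a (s.erase v) := fun v hv =>
    Finset.erase_insert_of_ne fun h => has (h ▸ hv)
  have hfaces : ∀ v ∈ t, t.erase v ∈ z.support := by
    intro v hv
    rcases Finset.mem_insert.1 hv with rfl | hv
    · rwa [hat]
    · rw [htv v hv]; exact hswap v hv
  have htc : t.card = k + 3 := by rw [ht, Finset.card_insert_of_notMem has, hc]
  have htX : t ∈ X.faces := h1 t htc fun v hv => (hsX (hfaces v hv)).1
  -- The coefficient is chosen so that `∂w₀` and `z` agree at `s`.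
  set w₀ : Finset V →₀ A := Finsupp.single t (z s * (-1) ^ position t a) with hw₀
  have hw₀X : w₀ ∈ chains A X (k + 3) := Finsupp.single_mem_supported A _ ⟨htX, htc⟩
  set z' := z - bd A w₀ with hz'
  have hz'X : z' ∈ chains A X (k + 2) := sub_mem hz (bd_mem_chains hw₀X)
  have hz'bd : bd A z' = 0 := by rw [hz', map_sub, hbd, bd_bd, sub_zero]
  have hz's : z' s = 0 := by
    have := bd_single_apply_erase (A := A) (Finset.mem_insert_self a s)
      (z s * (-1) ^ position t a)
    rw [← ht, hat, mul_assoc, ← mul_pow] at this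
    rw [hz', Finsupp.sub_apply, hw₀, this]
    simp
  have hz'X' := (Finsupp.mem_supported A z').1 hz'X
  have hz'v : ∀ v ∈ s, z' (t.erase v) = 0 := by
    intro v hv
    by_contra hne
    have hmem : t.erase v ∈ z'.support := Finsupp.mem_support_iff.2 hne
    have hav : a ∈ t.erase v := by rw [htv v hv]; exact Finset.mem_insert_self _ _
    obtain ⟨b, hb, hb'⟩ := exists_adjacent_of_bd_eq_zero hz'bd hmem hav
    have he : (t.erase v).erase a = s.erase v := by
      rw [Finset.erase_right_comm, hat]
    rw [he] at hb'
    have hbv : b ≠ v := by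
      rintro rfl
      rw [Finset.insert_erase hv] at hb'
      exact (Finsupp.mem_support_iff.1 hb') hz's
    have hba : b ≠ a := by rintro rfl; exact hb hav
    have hbs : b ∉ s := fun h => hb (Finset.mem_erase.2 ⟨hbv, Finset.mem_insert_of_mem h⟩)
    refine hba (h2 s (hsX hs).1 hc b a hbs has
      (hadj s v hv b (hother _ hv) (hz'X' hb').1)
      (hadj s v hv a (hother _ hv) (hsX (hswap v hv)).1))
  -- The facets of `t` all lie in the support of `z` already, so subtracting `∂w₀` adds no simplex,
  -- while it removes `s`.
  have hsub : z'.support ⊂ z.support := by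
    refine (Finset.ssubset_iff_of_subset ?_).2 ⟨s, hs, by simp [hz's]⟩
    intro x hx
    by_contra hxz
    have hxf : ∀ v ∈ t, t.erase v ≠ x := by
      rintro v hv rfl
      exact hxz (hfaces v hv)
    have h3 : z' x = 0 := by
      rw [hz', Finsupp.sub_apply, bd_single_apply_of_ne hxf, Finsupp.notMem_support_iff.1 hxz,
        sub_zero]
    exact (Finsupp.mem_support_iff.1 hx) h3
  obtain ⟨w, hw, hwz⟩ := ih _ (hn ▸ Finset.card_lt_card hsub) z' hz'X hz'bd rfl
  exact ⟨w + w₀, add_mem hw hw₀X, by rw [map_add, hwz, hz', sub_add_cancel]⟩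

/-- The vertices of `s` together with the apices of the admissible subsets of `s`. -/
def carrier (x : Finset V → V) (P : Finset V → Prop) (s : Finset V) : Set V :=
  {v | v ∈ s ∨ ∃ t ⊆ s, P t ∧ v = x t}

/-- The vertices of `s` together with the apices of the admissible proper subsets of `s`. -/
def properCarrier (x : Finset V → V) (P : Finset V → Prop) (s : Finset V) : Set V :=
  {v | v ∈ s ∨ ∃ t ⊂ s, P t ∧ v = x t}

/-- Each coning step in `D s` adjoins the apex of some `t ⊆ s` to a face built from `t` and the
apices of its proper subsets, so only such insertions have to be faces. The predicate `P` decides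
whether the apex of `∅` may occur: it does for `c₀ = {x ∅}`, not for `c₀ = 0`. -/
theorem homotopy_mem {X : AbstractSimplicialComplex V} {x : Finset V → V} {P : Finset V → Prop}
    (hP : ∀ s : Finset V, s.Nonempty → P s) {c₀ : Finset V →₀ A} {N : ℕ}
    (h₀ : c₀ ∈ Finsupp.supported A A {t | t ∈ X.faces ∧ t.card = 1 ∧ ↑t ⊆ carrier x P ∅})
    (s : Finset V) (hs : s ∈ X.faces) (hsN : s.card ≤ N)
    (hx : ∀ t ⊆ s, t.Nonempty → ∀ f ∈ X.faces, f.card ≤ N → ↑f ⊆ properCarrier x P t →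
      insert (x t) f ∈ X.faces) :
    homotopy x c₀ s ∈ Finsupp.supported A A
      {t | t ∈ X.faces ∧ t.card = s.card + 1 ∧ ↑t ⊆ carrier x P s} := by
  induction s using Finset.strongInduction with
  | H s ih =>
    have hne : s.Nonempty := (X.isRelLowerSet_faces hs).1
    rw [homotopy_of_nonempty x c₀ hne]
    have hinner : Finsupp.single s 1 -
        Finsupp.linearCombination A (homotopy x c₀) (bd A (Finsupp.single s 1)) ∈
        Finsupp.supported A A
          {t | t ∈ X.faces ∧ t.card = s.card ∧ ↑t ⊆ properCarrier x P s} := by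
      refine sub_mem (Finsupp.single_mem_supported A _ ⟨hs, rfl, fun v hv => Or.inl hv⟩) ?_
      rw [linearCombination_bd_single]
      refine Submodule.sum_mem _ fun v hv => Submodule.smul_mem _ _ ?_
      have hcard := Finset.card_erase_add_one hv
      have hsub := Finset.erase_ssubset hv
      have hcar : carrier x P (s.erase v) ⊆ properCarrier x P s := by
        rintro u (hu | ⟨t, ht, hPt, rfl⟩)
        · exact Or.inl (Finset.mem_of_mem_erase hu)
        · exact Or.inr ⟨t, ht.trans_ssubset hsub, hPt, rfl⟩
      rcases (s.erase v).eq_empty_or_nonempty with he | he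
      · rw [he, homotopy_empty]
        refine Finsupp.supported_mono ?_ h₀
        rintro t ⟨ht1, ht2, ht3⟩
        refine ⟨ht1, ?_, ht3.trans (he ▸ hcar)⟩
        rw [ht2, ← hcard, he, Finset.card_empty]
      · have := ih _ hsub ((X.isRelLowerSet_faces hs).2 hsub.1 he) (by omega)
          (fun t ht => hx t (ht.trans hsub.1))
        refine Finsupp.supported_mono ?_ this
        rintro t ⟨ht1, ht2, ht3⟩
        exact ⟨ht1, by omega, ht3.trans hcar⟩
    rw [cone]
    refine linearCombination_mem _ fun f hf => ?_
    obtain ⟨hfX, hfc, hfs⟩ := (Finsupp.mem_supported A _).1 hinner hf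
    split_ifs with hxf
    · exact zero_mem _
    · refine Finsupp.single_mem_supported A _ ⟨hx s subset_rfl hne f hfX (by omega) hfs, ?_, ?_⟩
      · rw [Finset.card_insert_of_notMem hxf, hfc]
      · intro v hv
        rcases Finset.mem_insert.1 (Finset.mem_coe.1 hv) with rfl | hv
        · exact Or.inr ⟨s, subset_rfl, hP s hne, rfl⟩
        · rcases hfs hv with h | ⟨t, ht, hPt, rfl⟩
          · exact Or.inl h
          · exact Or.inr ⟨t, ht.1, hPt, rfl⟩

/-- Only the vertices are tracked: in the application the retracted chain equals `z - ∂w`, so its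
simplices are faces for free. -/
theorem retract_mem (x : Finset V → V) (s : Finset V) :
    retract x (Finsupp.single ∅ (1 : A)) s ∈ Finsupp.supported A A
      {f | ∀ v ∈ f, ∃ t ⊆ s, t.Nonempty ∧ v = x t} := by
  induction s using Finset.strongInduction with
  | H s ih =>
    rcases s.eq_empty_or_nonempty with rfl | hne
    · rw [retract_empty]
      exact Finsupp.single_mem_supported A _ (by simp)
    · rw [retract_of_nonempty x _ hne, cone]
      refine linearCombination_mem _ fun f hf => ?_
      have hinner : Finsupp.linearCombination A (retract x (Finsupp.single ∅ (1 : A)))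
          (bd A (Finsupp.single s 1)) ∈ Finsupp.supported A A
          {f | ∀ v ∈ f, ∃ t ⊆ s, t.Nonempty ∧ v = x t} := by
        rw [linearCombination_bd_single]
        refine Submodule.sum_mem _ fun v hv => Submodule.smul_mem _ _ ?_
        refine Finsupp.supported_mono ?_ (ih _ (Finset.erase_ssubset hv))
        intro f hf u hu
        obtain ⟨t, ht, h⟩ := hf u hu
        exact ⟨t, ht.trans (Finset.erase_subset _ _), h⟩
      have hf' := (Finsupp.mem_supported A _).1 hinner hf
      split_ifs with hxf
      · exact zero_mem _
      · refine Finsupp.single_mem_supported A _ fun v hv => ?_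
        rcases Finset.mem_insert.1 hv with rfl | hv
        · exact ⟨s, subset_rfl, hne, rfl⟩
        · exact hf' v hv

theorem retract_zero (x : Finset V → V) (s : Finset V) :
    retract x (0 : Finset V →₀ A) s = 0 := by
  induction s using Finset.strongInduction with
  | H s ih =>
    rcases s.eq_empty_or_nonempty with rfl | hne
    · rw [retract_empty]
    · rw [retract_of_nonempty x _ hne, linearCombination_bd_single, Finset.sum_eq_zero, map_zero]
      intro v hv
      rw [ih _ (Finset.erase_ssubset hv), smul_zero]

/-- A cycle all of whose simplices can be coned off is homologous to a cycle whose vertices are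
apices. -/
theorem exists_homologous {X : AbstractSimplicialComplex V} {x : Finset V → V} {k : ℕ}
    {z : Finset V →₀ A} (hz : z ∈ chains A X (k + 1)) (hbd : bd A z = 0)
    (hx : ∀ s ∈ z.support, ∀ t ⊆ s, t.Nonempty → ∀ f ∈ X.faces, f.card ≤ k + 1 →
      ↑f ⊆ properCarrier x Finset.Nonempty t → insert (x t) f ∈ X.faces) :
    ∃ w ∈ chains A X (k + 2), ∀ f ∈ (z - bd A w).support, ∀ v ∈ f,
      ∃ s ∈ z.support, ∃ t ⊆ s, t.Nonempty ∧ v = x t := by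
  have hzX := (Finsupp.mem_supported A z).1 hz
  refine ⟨Finsupp.linearCombination A (homotopy x 0) z, linearCombination_mem _ fun s hs => ?_, ?_⟩
  · refine Finsupp.supported_mono ?_ (homotopy_mem (P := Finset.Nonempty) (fun _ h => h) (N := k + 1)
      (zero_mem _) s (hzX hs).1 (hzX hs).2.le (hx s hs))
    rintro t ⟨h1, h2, -⟩
    exact ⟨h1, by rw [h2, (hzX hs).2]⟩
  · have h := bd_homotopy x (0 : Finset V →₀ A) z
    rw [hbd, map_zero, add_zero, map_zero, sub_zero] at h
    have h' : z - bd A (Finsupp.linearCombination A (homotopy x 0) z) =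
        Finsupp.linearCombination A (retract x (Finsupp.single ∅ 1)) z := by
      rw [sub_eq_iff_eq_add, add_comm]; exact h.symm
    rw [h']
    have hmem : Finsupp.linearCombination A (retract x (Finsupp.single ∅ 1)) z ∈
        Finsupp.supported A A {f : Finset V | ∀ v ∈ f,
          ∃ s ∈ z.support, ∃ t ⊆ s, t.Nonempty ∧ v = x t} := by
      refine linearCombination_mem _ fun s hs => Finsupp.supported_mono ?_ (retract_mem x s)
      intro f hf v hv
      exact ⟨s, hs, hf v hv⟩
    exact (Finsupp.mem_supported A _).1 hmem

/-- A cycle all of whose simplices can be coned off together with a common vertex is a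
boundary. -/
theorem exists_bd_eq_of_cone {X : AbstractSimplicialComplex V} {x : Finset V → V} {k : ℕ}
    {z : Finset V →₀ A} (hz : z ∈ chains A X (k + 1)) (hbd : bd A z = 0)
    (hx : ∀ s ∈ z.support, ∀ t ⊆ s, t.Nonempty → ∀ f ∈ X.faces, f.card ≤ k + 1 →
      ↑f ⊆ properCarrier x (fun _ => True) t → insert (x t) f ∈ X.faces) :
    ∃ w ∈ chains A X (k + 2), bd A w = z := by
  have hzX := (Finsupp.mem_supported A z).1 hz
  refine ⟨Finsupp.linearCombination A (homotopy x (Finsupp.single {x ∅} 1)) z,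
    linearCombination_mem _ fun s hs => ?_, ?_⟩
  · refine Finsupp.supported_mono ?_ (homotopy_mem (P := fun _ => True) (fun _ _ => trivial) (N := k + 1)
      (Finsupp.single_mem_supported A _ ⟨X.singleton_mem _, by simp, ?_⟩)
      s (hzX hs).1 (hzX hs).2.le (hx s hs))
    · rintro t ⟨h1, h2, -⟩
      exact ⟨h1, by rw [h2, (hzX hs).2]⟩
    · intro v hv
      exact Or.inr ⟨∅, subset_rfl, trivial, by simpa using hv⟩
  · have h := bd_homotopy x (Finsupp.single {x ∅} (1 : A)) z
    -- The augmented boundary of a vertex is `∅`, hence the retraction starts from `0` and vanishes.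
    have h0 : Finsupp.single ∅ 1 - bd A (Finsupp.single {x ∅} (1 : A)) = 0 := by
      have : ({v ∈ ({x ∅} : Finset V) | v < x ∅}) = ∅ := by
        simp [Finset.filter_singleton]
      simp [bd_single, position, this]
    rw [hbd, map_zero, add_zero, h0] at h
    have h1 : Finsupp.linearCombination A (retract x (0 : Finset V →₀ A)) z = 0 := by
      rw [Finsupp.linearCombination_apply]
      exact Finset.sum_eq_zero fun s _ => by simp only [retract_zero, smul_zero]
    rwa [h1, add_zero] at h

end Vanishing

/-! ### Contracting cycles in a complex rich in cone points -/

section Dense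

/-- The apices chosen recursively: the apex of `s` is picked in terms of the vertices of `s` and of
the apices of the proper subsets of `s`. -/
noncomputable def apex {V E : Type*} [DecidableEq V] (pick : Finset V → E → V)
    (g : Finset V → E) (s : Finset V) : V :=
  pick (s ∪ s.ssubsets.attach.image fun t => apex pick g t.1) (g s)
termination_by s.card
decreasing_by exact Finset.card_lt_card (Finset.mem_ssubsets.1 t.2)

/-- The vertices of `s` and the apices of its proper subsets. -/
noncomputable def apexSet {V E : Type*} [DecidableEq V] (pick : Finset V → E → V)
    (g : Finset V → E) (s : Finset V) : Finset V :=
  s ∪ s.ssubsets.image (apex pick g)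

theorem apex_eq {V E : Type*} [DecidableEq V] (pick : Finset V → E → V) (g : Finset V → E)
    (s : Finset V) : apex pick g s = pick (apexSet pick g s) (g s) := by
  rw [apex, apexSet]
  congr 2
  ext v
  simp

/-- Besides the vertices there are at most `2 ^ N` apices. A bound independent of `n` keeps the
later union bound polynomial. -/
theorem card_apexSet_le {V E : Type*} [DecidableEq V] (pick : Finset V → E → V)
    (g : Finset V → E) {s : Finset V} {N : ℕ} (hs : s.card ≤ N) :
    (apexSet pick g s).card ≤ N + 2 ^ N := by
  refine (Finset.card_union_le _ _).trans (add_le_add hs (Finset.card_image_le.trans ?_))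
  refine (Finset.card_le_card (Finset.erase_subset _ _)).trans ?_
  rw [Finset.card_powerset]
  exact Nat.pow_le_pow_right (by norm_num) hs

theorem properCarrier_subset_apexSet {V E : Type*} [LinearOrder V] (pick : Finset V → E → V)
    (g : Finset V → E) (P : Finset V → Prop) (s : Finset V) :
    properCarrier (apex pick g) P s ⊆ apexSet pick g s := by
  rintro v (hv | ⟨t, ht, -, rfl⟩)
  · exact Finset.mem_union_left _ hv
  · exact Finset.mem_union_right _ (Finset.mem_image_of_mem _ (Finset.mem_ssubsets.2 ht))

variable {d n : ℕ} {r : ℝ} {pt : Fin n → EuclideanSpace ℝ (Fin d)}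
  {coin : Finset (Fin n) → Bool}

theorem insert_mem_softRips {s : Finset (Fin n)} (hs : s ∈ (softRips r pt coin).faces)
    {v : Fin n} (hdist : ∀ w ∈ s, dist (pt v) (pt w) ≤ r)
    (hcoin : ∀ t ⊆ s, t.Nonempty → coin (insert v t) = true) :
    insert v s ∈ (softRips r pt coin).faces := by
  refine ⟨Finset.insert_nonempty _ _, ?_, ?_⟩
  · rw [Finset.coe_insert, Set.pairwise_insert]
    exact ⟨hs.2.1, fun w hw _ => ⟨hdist w hw, dist_comm (pt v) (pt w) ▸ hdist w hw⟩⟩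
  · intro t ht h2
    by_cases hvt : v ∈ t
    · have := hcoin (t.erase v) (Finset.subset_insert_iff.1 ht) (by
        rw [← Finset.card_pos, Finset.card_erase_of_mem hvt]; omega)
      rwa [Finset.insert_erase hvt] at this
    · exact hs.2.2 t ((Finset.subset_insert_iff_of_notMem hvt).1 ht) h2

/-- The barycentre of the points of `s`. -/
noncomputable def bary (pt : Fin n → EuclideanSpace ℝ (Fin d)) (s : Finset (Fin n)) :
    EuclideanSpace ℝ (Fin d) :=
  s.centerMass (fun _ => (1 : ℝ)) pt

theorem bary_mem {C : Set (EuclideanSpace ℝ (Fin d))} (hC : Convex ℝ C) {s : Finset (Fin n)}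
    (hs : s.Nonempty) (h : ∀ i ∈ s, pt i ∈ C) : bary pt s ∈ C :=
  hC.centerMass_mem (fun _ _ => zero_le_one) (by simp [hs]) h

/-- In the average of `pt j - pt i` over `j ∈ s` the term `j = i` is zero, which saves `r / s.card`.
This slack pays for the apex errors and for the pull towards the centre. -/
theorem dist_bary_le {s : Finset (Fin n)} {m : ℕ} (hm : s.card ≤ m + 1) (hr : 0 ≤ r)
    (hs : ∀ i ∈ s, ∀ j ∈ s, dist (pt i) (pt j) ≤ r) {i : Fin n} (hi : i ∈ s) :
    dist (pt i) (bary pt s) ≤ r - r / (m + 1) := by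
  have hpos : 0 < (s.card : ℝ) := by exact_mod_cast Finset.card_pos.2 ⟨i, hi⟩
  have h1 : (s.card : ℝ) • (bary pt s - pt i) = ∑ j ∈ s, (pt j - pt i) := by
    simp only [bary, Finset.centerMass, Finset.sum_const, nsmul_eq_mul, mul_one, one_smul]
    rw [smul_sub, smul_smul, mul_inv_cancel₀ hpos.ne', one_smul, Finset.sum_sub_distrib,
      Finset.sum_const, Nat.cast_smul_eq_nsmul]
  have h2 : (s.card : ℝ) * dist (pt i) (bary pt s) ≤ (s.card - 1) * r := by
    rw [dist_comm, dist_eq_norm, ← Real.norm_of_nonneg hpos.le, ← norm_smul, h1,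
      ← Finset.add_sum_erase s _ hi, sub_self, zero_add]
    refine (norm_sum_le_of_le (f := fun j => pt j - pt i) (n := fun _ => r) _ fun j hj => ?_).trans ?_
    · rw [← dist_eq_norm]; exact hs j (Finset.mem_of_mem_erase hj) i hi
    · rw [Finset.sum_const, nsmul_eq_mul, Finset.card_erase_of_mem hi,
        Nat.cast_sub (Finset.card_pos.2 ⟨i, hi⟩), Nat.cast_one, Real.norm_of_nonneg hpos.le]
  have hm' : (s.card : ℝ) ≤ m + 1 := by exact_mod_cast hm
  have h3 : dist (pt i) (bary pt s) ≤ r - r / s.card := by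
    rw [← mul_le_mul_iff_right₀ hpos]
    refine h2.trans (le_of_eq ?_)
    field_simp
  refine h3.trans ?_
  gcongr

/-- If every bounded set of vertices can be coned off from a vertex near any prescribed point of
the convex set `K`, then the homology vanishes. -/
theorem exists_bd_eq_of_rich {A : Type w} [CommRing A] {K : Set (EuclideanSpace ℝ (Fin d))}
    (hK : Convex ℝ K) {c : EuclideanSpace ℝ (Fin d)} (hc : c ∈ K) (hpt : ∀ i, pt i ∈ K)
    (hr : 0 < r) {k : ℕ}
    (hrich : ∀ S : Finset (Fin n), S.card ≤ (k + 2) + 2 ^ (k + 2) → ∀ y ∈ K,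
      ∃ v, dist (pt v) y ≤ r / (4 * (k + 2)) ∧
        ∀ t ⊆ S, t.Nonempty → t.card ≤ k + 2 → coin (insert v t) = true)
    (z : Finset (Fin n) →₀ A) (hz : z ∈ chains A (softRips r pt coin) (k + 2))
    (hbd : bd A z = 0) :
    ∃ w ∈ chains A (softRips r pt coin) (k + 3), bd A w = z := by
  classical
  set X := softRips r pt coin with hX
  -- A quarter of the barycentric slack `r / (k + 2)`: an apex misses its target by `δ`, and targets
  -- are pulled by at most `2δ`.
  set δ := r / (4 * (k + 2) : ℝ) with hδ
  have hk : (0 : ℝ) < k + 2 := by positivity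
  have hδ0 : 0 < δ := by positivity
  have hδ' : r / (k + 2) = 4 * δ := by rw [hδ]; field_simp
  have hδr : 8 * δ ≤ r := by
    rw [hδ, ← mul_div_assoc, div_le_iff₀ (by positivity)]
    have : (0 : ℝ) ≤ k := by positivity
    nlinarith
  -- `pick` realises the hypothesis
  have hpick : ∀ (S : Finset (Fin n)) (y : EuclideanSpace ℝ (Fin d)), ∃ v,
      S.card ≤ (k + 2) + 2 ^ (k + 2) → y ∈ K → dist (pt v) y ≤ δ ∧
        ∀ t ⊆ S, t.Nonempty → t.card ≤ k + 2 → coin (insert v t) = true := by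
    intro S y
    obtain ⟨v₀, -⟩ := hrich ∅ (by simp) c hc
    by_cases hS : S.card ≤ (k + 2) + 2 ^ (k + 2)
    · by_cases hy : y ∈ K
      · obtain ⟨v, hv⟩ := hrich S hS y hy
        exact ⟨v, fun _ _ => hv⟩
      · exact ⟨v₀, fun _ h => absurd h hy⟩
    · exact ⟨v₀, fun h => absurd h hS⟩
  choose pick hpick using hpick
  have hapex : ∀ (g : Finset (Fin n) → EuclideanSpace ℝ (Fin d)) (s : Finset (Fin n)),
      s.card ≤ k + 2 → g s ∈ K → dist (pt (apex pick g s)) (g s) ≤ δ := by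
    intro g s hs hg
    rw [apex_eq]
    exact (hpick _ _ (card_apexSet_le pick g hs) hg).1
  have hcone : ∀ (g : Finset (Fin n) → EuclideanSpace ℝ (Fin d)) (P : Finset (Fin n) → Prop)
      (s : Finset (Fin n)), s.card ≤ k + 2 → g s ∈ K → ∀ f ∈ X.faces, f.card ≤ k + 2 →
      ↑f ⊆ properCarrier (apex pick g) P s →
      (∀ w ∈ f, dist (pt (apex pick g s)) (pt w) ≤ r) → insert (apex pick g s) f ∈ X.faces := by
    intro g P s hs hg f hf hfc hfs hdist
    refine insert_mem_softRips hf hdist fun t ht hne => ?_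
    rw [apex_eq]
    refine (hpick _ _ (card_apexSet_le pick g hs) hg).2 t ?_ hne
      ((Finset.card_le_card ht).trans hfc)
    intro v hv
    exact properCarrier_subset_apexSet pick g P s (hfs (ht hv))
  -- induction on the size of the region that contains the cycle
  have main : ∀ j : ℕ, ∀ z ∈ chains A X (k + 2), bd A z = 0 →
      (∀ s ∈ z.support, ∀ v ∈ s, dist (pt v) c ≤ r / 2 + j * δ) →
      ∃ w ∈ chains A X (k + 3), bd A w = z := by
    intro j
    induction j with
    | zero =>
      intro z hz hbd hR
      have hzX := (Finsupp.mem_supported A z).1 hz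
      -- Now all apices, including that of `∅`, lie within `δ` of `c`, and all vertices of the cycle
      -- within `r / 2`.
      refine exists_bd_eq_of_cone (x := apex pick fun _ => c) hz hbd ?_
      intro s hs t hts _ f hf hfc hft
      have htc : t.card ≤ k + 2 := (Finset.card_le_card hts).trans (hzX hs).2.le
      refine hcone _ _ t htc hc f hf hfc hft fun w hw => ?_
      have h1 := hapex (fun _ => c) t htc hc
      rcases hft hw with hwt | ⟨u, hu, -, rfl⟩
      · have h2 := hR s hs w (hts hwt)
        have h3 := dist_triangle_right (pt (apex pick (fun _ => c) t)) (pt w) c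
        simp only [Nat.cast_zero, zero_mul, add_zero] at h2
        linarith
      · have h2 := hapex (fun _ => c) u ((Finset.card_le_card hu.1).trans htc) hc
        have h3 := dist_triangle_right (pt (apex pick (fun _ => c) t))
          (pt (apex pick (fun _ => c) u)) c
        linarith
    | succ j ih =>
      intro z hz hbd hR
      have hzX := (Finsupp.mem_supported A z).1 hz
      set R := r / 2 + ((j + 1 : ℕ) : ℝ) * δ with hRdef
      have hR0 : r / 2 ≤ R := by rw [hRdef]; have : 0 ≤ ((j + 1 : ℕ) : ℝ) * δ := by positivity
                                 linarith
      have hRpos : 0 < R := by linarith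
      -- A barycentre at distance `R` from `c` is pulled in by exactly `2δ`; after the apex error
      -- `δ` the radius has dropped by at least `δ`.
      set τ := 2 * δ / R with hτ
      have hτ0 : 0 ≤ τ := by positivity
      have hτ1 : τ ≤ 1 := by rw [hτ, div_le_one hRpos]; linarith
      have hτR : τ * R = 2 * δ := by rw [hτ]; field_simp
      set g : Finset (Fin n) → EuclideanSpace ℝ (Fin d) :=
        fun s => (1 - τ) • bary pt s + τ • c with hg
      have hgK : ∀ t : Finset (Fin n), t.Nonempty → g t ∈ K := fun t ht =>
        hK (bary_mem hK ht fun i _ => hpt i) hc (by linarith) hτ0 (by ring)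
      have hgc : ∀ t : Finset (Fin n), dist (g t) c = (1 - τ) * dist (bary pt t) c := by
        intro t
        have : g t - c = (1 - τ) • (bary pt t - c) := by
          simp only [hg]; module
        rw [dist_eq_norm, this, norm_smul, Real.norm_of_nonneg (by linarith), dist_eq_norm]
      have hgb : ∀ t : Finset (Fin n), dist (bary pt t) (g t) = τ * dist (bary pt t) c := by
        intro t
        have : bary pt t - g t = τ • (bary pt t - c) := by
          simp only [hg]; module
        rw [dist_eq_norm, this, norm_smul, Real.norm_of_nonneg hτ0, dist_eq_norm]
      have hgg : ∀ t u : Finset (Fin n), dist (g t) (g u) = (1 - τ) * dist (bary pt t) (bary pt u) := by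
        intro t u
        have : g t - g u = (1 - τ) • (bary pt t - bary pt u) := by
          simp only [hg]; module
        rw [dist_eq_norm, this, norm_smul, Real.norm_of_nonneg (by linarith), dist_eq_norm]
      have hbR : ∀ s ∈ z.support, ∀ t ⊆ s, t.Nonempty → dist (bary pt t) c ≤ R := by
        intro s hs t hts ht
        have := bary_mem (pt := pt) (convex_closedBall c R) ht fun i hi =>
          Metric.mem_closedBall.2 (hR s hs i (hts hi))
        simpa using this
      have hvb : ∀ s ∈ z.support, ∀ t ⊆ s, ∀ i ∈ t, dist (pt i) (bary pt t) ≤ r - 4 * δ := by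
        intro s hs t hts i hi
        have htc : t.card ≤ (k + 1) + 1 := (Finset.card_le_card hts).trans (hzX hs).2.le
        have := dist_bary_le htc hr.le (fun i hi j hj => by
          rcases eq_or_ne i j with rfl | hij
          · simpa using hr.le
          · exact (hzX hs).1.2.1 (hts hi) (hts hj) hij) hi
        rw [← hδ']
        push_cast at this
        rwa [add_assoc, one_add_one_eq_two] at this
      obtain ⟨w, hw, hwz⟩ := exists_homologous (x := apex pick g) hz hbd (by
        intro s hs t hts htne f hf hfc hft
        have htc : t.card ≤ k + 2 := (Finset.card_le_card hts).trans (hzX hs).2.le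
        refine hcone _ _ t htc (hgK t htne) f hf hfc hft fun w hw => ?_
        have h1 := hapex g t htc (hgK t htne)
        rcases hft hw with hwt | ⟨u, hu, hune, rfl⟩
        · have h2 := hvb s hs t hts w hwt
          have h3 : dist (bary pt t) (g t) ≤ 2 * δ := by
            rw [hgb, ← hτR]
            exact mul_le_mul_of_nonneg_left (hbR s hs t hts htne) hτ0
          have h4 := dist_triangle4 (pt (apex pick g t)) (g t) (bary pt t) (pt w)
          rw [dist_comm (g t), dist_comm (bary pt t) (pt w)] at h4
          linarith
        · have h2 := hapex g u ((Finset.card_le_card hu.1).trans htc) (hgK u hune)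
          -- For `u ⊂ t` the barycentre of `u` lies in the convex ball about that of `t` containing
          -- all of `t`, and the pull towards `c` contracts distances.
          have h3 : dist (g t) (g u) ≤ r - 4 * δ := by
            have h5 : dist (bary pt t) (bary pt u) ≤ r - 4 * δ := by
              have := bary_mem (pt := pt) (convex_closedBall (bary pt t) (r - 4 * δ)) hune
                fun i hi => Metric.mem_closedBall.2 (hvb s hs t hts i (hu.1 hi))
              rw [dist_comm]
              simpa using this
            rw [hgg]
            refine (mul_le_of_le_one_left dist_nonneg (by linarith)).trans h5
          have h4 := dist_triangle4 (pt (apex pick g t)) (g t) (g u) (pt (apex pick g u))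
          rw [dist_comm (g u)] at h4
          linarith)
      obtain ⟨w', hw', hwz'⟩ := ih (z - bd A w) (sub_mem hz (bd_mem_chains hw))
        (by rw [map_sub, hbd, bd_bd, sub_zero]) (by
          intro f hf v hv
          obtain ⟨s, hs, t, hts, htne, rfl⟩ := hwz f hf v hv
          have htc : t.card ≤ k + 2 := (Finset.card_le_card hts).trans (hzX hs).2.le
          have h1 := hapex g t htc (hgK t htne)
          have h2 : dist (g t) c ≤ R - 2 * δ := by
            rw [hgc, ← hτR]
            have := mul_le_mul_of_nonneg_left (hbR s hs t hts htne) (sub_nonneg.2 hτ1)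
            linarith
          have h3 := dist_triangle (pt (apex pick g t)) (g t) c
          have h4 : R = r / 2 + j * δ + δ := by rw [hRdef]; push_cast; ring
          linarith)
      exact ⟨w' + w, add_mem hw' hw, by rw [map_add, hwz', sub_add_cancel]⟩
  -- A starting index whose ball contains every vertex.
  obtain ⟨j, hj⟩ := exists_nat_ge ((∑ i, dist (pt i) c) / δ)
  refine main j z hz hbd fun s _ v _ => ?_
  have h1 : dist (pt v) c ≤ ∑ i, dist (pt i) c :=
    Finset.single_le_sum (f := fun i => dist (pt i) c) (fun _ _ => dist_nonneg)
      (Finset.mem_univ v)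
  rw [div_le_iff₀ hδ0] at hj
  linarith

end Dense

/-! ### Probabilities of independent constraints on points and coins -/

section Law

variable {d : ℕ} {K : Set (EuclideanSpace ℝ (Fin d))}

theorem isProbabilityMeasure_cond (hbdd : Bornology.IsBounded K) (hint : (interior K).Nonempty) :
    IsProbabilityMeasure (volume[|K] : Measure (EuclideanSpace ℝ (Fin d))) := by
  refine cond_isProbabilityMeasure_of_finite ?_ hbdd.measure_lt_top.ne
  exact (Measure.measure_pos_of_nonempty_interior _ hint).ne'

instance isProbabilityMeasure_law (ρ : ℕ → unitInterval) (n : ℕ)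
    [IsProbabilityMeasure (volume[|K] : Measure (EuclideanSpace ℝ (Fin d)))] :
    IsProbabilityMeasure (law K ρ n) := by
  unfold law
  infer_instance

/-- A family of independent constraints on the points and on the coins. -/
def box {n : ℕ} (P : Fin n → Set (EuclideanSpace ℝ (Fin d))) (C : Finset (Fin n) → Set Bool) :
    Set ((Fin n → EuclideanSpace ℝ (Fin d)) × (Finset (Fin n) → Bool)) :=
  {ω | (∀ i, ω.1 i ∈ P i) ∧ ∀ s, ω.2 s ∈ C s}

/-- The product formula needs no measurability, so it applies to arbitrary sets. -/
theorem law_real_prod [IsProbabilityMeasure (volume[|K] : Measure (EuclideanSpace ℝ (Fin d)))]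
    (ρ : ℕ → unitInterval) (n : ℕ) (P : Set (Fin n → EuclideanSpace ℝ (Fin d)))
    (C : Set (Finset (Fin n) → Bool)) :
    (law K ρ n).real (P ×ˢ C) =
      (Measure.pi fun _ : Fin n => (volume[|K] : Measure (EuclideanSpace ℝ (Fin d)))).real P *
      (Measure.pi fun s : Finset (Fin n) =>
        bernoulliMeasure true false (ρ (s.card - 1))).real C := by
  rw [law, measureReal_def, Measure.prod_prod, ENNReal.toReal_mul]
  rfl

theorem pi_real_pi {ι : Type*} [Fintype ι] {α : ι → Type*} [∀ i, MeasurableSpace (α i)]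
    (μ : ∀ i, Measure (α i)) [∀ i, IsProbabilityMeasure (μ i)] (P : ∀ i, Set (α i)) :
    (Measure.pi μ).real {x | ∀ i, x i ∈ P i} = ∏ i, (μ i).real (P i) := by
  have : {x | ∀ i, x i ∈ P i} = Set.univ.pi P := by ext; simp
  rw [this, measureReal_def, Measure.pi_pi, ENNReal.toReal_prod]
  rfl

theorem law_real_box [IsProbabilityMeasure (volume[|K] : Measure (EuclideanSpace ℝ (Fin d)))]
    (ρ : ℕ → unitInterval) {n : ℕ} (P : Fin n → Set (EuclideanSpace ℝ (Fin d)))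
    (C : Finset (Fin n) → Set Bool) :
    (law K ρ n).real (box P C) = (∏ i, (volume[|K] : Measure _).real (P i)) *
      ∏ s : Finset (Fin n), (bernoulliMeasure true false (ρ (s.card - 1))).real (C s) := by
  have : box P C = {x | ∀ i, x i ∈ P i} ×ˢ {c | ∀ s, c s ∈ C s} := rfl
  rw [this, law_real_prod, pi_real_pi, pi_real_pi]

/-- The values allowed for the coin of a set of cardinality `c`: the coins of the sets with
`2, …, N` elements have to be `true`, and, if `h` is set, those of the sets with `N + 1` elements
have to be `false`. -/
def allowed (N : ℕ) (h : Bool) (c : ℕ) : Set Bool :=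
  {b | (2 ≤ c ∧ c ≤ N → b = true) ∧ (h = true ∧ c = N + 1 → b = false)}

/-- The probability that all coins of the subsets of a set with `m` elements are allowed. -/
noncomputable def coinWeight (ρ : ℕ → unitInterval) (N : ℕ) (h : Bool) (m : ℕ) : ℝ :=
  ∏ c ∈ Finset.range (m + 1),
    (bernoulliMeasure true false (ρ (c - 1))).real (allowed N h c) ^ m.choose c

theorem bernoulli_real_univ (q : unitInterval) :
    (bernoulliMeasure true false q).real Set.univ = 1 := by
  simp

theorem bernoulli_real_true (q : unitInterval) :
    (bernoulliMeasure true false q).real {true} = q := by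
  classical
  rw [bernoulliMeasure_real_apply _ (MeasurableSet.of_discrete)]
  simp

theorem bernoulli_real_false (q : unitInterval) :
    (bernoulliMeasure true false q).real {false} = 1 - q := by
  classical
  rw [bernoulliMeasure_real_apply _ (MeasurableSet.of_discrete)]
  simp

theorem allowed_eq_true {N c : ℕ} (h : Bool) (h1 : 2 ≤ c) (h2 : c ≤ N) :
    allowed N h c = {true} := by
  ext b
  simp only [allowed, Set.mem_ofPred_eq, Set.mem_singleton_iff]
  constructor
  · exact fun h => h.1 ⟨h1, h2⟩
  · intro h
    exact ⟨fun _ => h, fun h' => by omega⟩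

theorem allowed_eq_false (N : ℕ) : allowed N true (N + 1) = {false} := by
  ext b
  simp only [allowed, Set.mem_ofPred_eq, Set.mem_singleton_iff]
  constructor
  · exact fun h => h.2 (by simp)
  · intro h
    exact ⟨fun h' => by omega, fun _ => h⟩

theorem allowed_eq_univ {N c : ℕ} {h : Bool} (h1 : ¬ (2 ≤ c ∧ c ≤ N))
    (h2 : ¬ (h = true ∧ c = N + 1)) : allowed N h c = Set.univ :=
  Set.eq_univ_of_forall fun _ => ⟨fun h => absurd h h1, fun h => absurd h h2⟩

theorem coinWeight_nonneg (ρ : ℕ → unitInterval) (N : ℕ) (h : Bool) (m : ℕ) :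
    0 ≤ coinWeight ρ N h m :=
  Finset.prod_nonneg fun _ _ => pow_nonneg measureReal_nonneg _

theorem coinWeight_eq_prod_powerset {n : ℕ} (ρ : ℕ → unitInterval) (N : ℕ) (h : Bool)
    (R : Finset (Fin n)) :
    ∏ s ∈ R.powerset, (bernoulliMeasure true false (ρ (s.card - 1))).real (allowed N h s.card) =
      coinWeight ρ N h R.card :=
  Finset.sum_powerset_apply_card (α := Additive ℝ)
    (fun c => Additive.ofMul ((bernoulliMeasure true false (ρ (c - 1))).real (allowed N h c)))

/-- The weight of the coins in terms of the retention probabilities. -/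
theorem coinWeight_eq (ρ : ℕ → unitInterval) (k m : ℕ) (h : Bool) (hm : k + 1 ≤ m)
    (hm' : h = true → k + 2 ≤ m) :
    coinWeight ρ (k + 1) h m = (∏ i ∈ Finset.Icc 1 k, (ρ i : ℝ) ^ m.choose (i + 1)) *
      (if h = true then (1 - (ρ (k + 1) : ℝ)) ^ m.choose (k + 2) else 1) := by
  set f : ℕ → ℝ := fun c =>
    (bernoulliMeasure true false (ρ (c - 1))).real (allowed (k + 1) h c) ^ m.choose c with hf
  have h1 : ∏ i ∈ Finset.Icc 1 k, (ρ i : ℝ) ^ m.choose (i + 1) =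
      ∏ c ∈ Finset.Icc 2 (k + 1), f c := by
    have : Finset.Icc 2 (k + 1) = (Finset.Icc 1 k).image (· + 1) := by
      rw [Finset.image_add_right_Icc]
    rw [this, Finset.prod_image (by intro a _ b _ hab; simpa using hab)]
    refine Finset.prod_congr rfl fun i hi => ?_
    obtain ⟨hi1, hi2⟩ := Finset.mem_Icc.1 hi
    simp only [hf]
    rw [allowed_eq_true h (by omega) (by omega), bernoulli_real_true, Nat.add_sub_cancel]
  have hone : ∀ c, ¬ (2 ≤ c ∧ c ≤ k + 1) → ¬ (h = true ∧ c = k + 1 + 1) → f c = 1 := by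
    intro c hc1 hc2
    simp only [hf]
    rw [allowed_eq_univ hc1 hc2, bernoulli_real_univ, one_pow]
  rw [h1, coinWeight]
  split_ifs with hh
  · have h2 : (1 - (ρ (k + 1) : ℝ)) ^ m.choose (k + 2) = f (k + 2) := by
      simp only [hf]
      subst hh
      rw [show k + 2 = k + 1 + 1 from rfl, allowed_eq_false, bernoulli_real_false,
        Nat.add_sub_cancel]
    rw [h2, mul_comm, ← Finset.prod_insert (by simp)]
    symm
    refine Finset.prod_subset ?_ ?_
    · intro c hc
      simp only [Finset.mem_insert, Finset.mem_Icc] at hc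
      have := hm' hh
      rw [Finset.mem_range]; omega
    · intro c _ hc
      simp only [Finset.mem_insert, Finset.mem_Icc, not_or] at hc
      exact hone c hc.2 (fun h' => hc.1 h'.2)
  · rw [mul_one]
    symm
    refine Finset.prod_subset ?_ ?_
    · intro c hc
      rw [Finset.mem_Icc] at hc
      rw [Finset.mem_range]; omega
    · intro c _ hc
      rw [Finset.mem_Icc] at hc
      exact hone c hc (fun h' => hh h'.1)

/-- The probability that the points satisfy independent constraints and that all coins of the
subsets of `R` are allowed. -/
theorem law_real_box_allowed
    [IsProbabilityMeasure (volume[|K] : Measure (EuclideanSpace ℝ (Fin d)))]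
    (ρ : ℕ → unitInterval) {n : ℕ} (P : Fin n → Set (EuclideanSpace ℝ (Fin d))) (N : ℕ) (h : Bool)
    (R : Finset (Fin n)) :
    (law K ρ n).real (box P fun s => if s ⊆ R then allowed N h s.card else Set.univ) =
      (∏ i, (volume[|K] : Measure _).real (P i)) * coinWeight ρ N h R.card := by
  rw [law_real_box, ← coinWeight_eq_prod_powerset]
  congr 1
  rw [← Finset.prod_subset (Finset.subset_univ R.powerset)]
  · refine Finset.prod_congr rfl fun s hs => ?_
    rw [if_pos (Finset.mem_powerset.1 hs)]
  · intro s _ hs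
    rw [if_neg (by simpa using hs), bernoulli_real_univ]

/-- Disjoint `R` and `R'` share only the empty subset, whose coin is unconstrained, so the two
families of coins contribute independent factors. -/
theorem law_real_box_allowed_two
    [IsProbabilityMeasure (volume[|K] : Measure (EuclideanSpace ℝ (Fin d)))]
    (ρ : ℕ → unitInterval) {n : ℕ} (P : Fin n → Set (EuclideanSpace ℝ (Fin d))) (N : ℕ) (h : Bool)
    {R R' : Finset (Fin n)} (hR : Disjoint R R') :
    (law K ρ n).real (box P fun s => if s ⊆ R ∨ s ⊆ R' then allowed N h s.card else Set.univ) =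
      (∏ i, (volume[|K] : Measure _).real (P i)) *
        (coinWeight ρ N h R.card * coinWeight ρ N h R'.card) := by
  rw [law_real_box, ← coinWeight_eq_prod_powerset, ← coinWeight_eq_prod_powerset]
  congr 1
  rw [← Finset.prod_union_inter]
  have hinter : R.powerset ∩ R'.powerset = {∅} := by
    ext s
    simp only [Finset.mem_inter, Finset.mem_powerset, Finset.mem_singleton]
    rw [← Finset.subset_inter_iff, Finset.disjoint_iff_inter_eq_empty.1 hR, Finset.subset_empty]
  rw [hinter, Finset.prod_singleton, Finset.card_empty,
    allowed_eq_univ (by omega) (by omega), bernoulli_real_univ, mul_one,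
    ← Finset.prod_subset (Finset.subset_univ (R.powerset ∪ R'.powerset))]
  · refine Finset.prod_congr rfl fun s hs => ?_
    rw [if_pos (by simpa using hs)]
  · intro s _ hs
    rw [if_neg (by simpa using hs), bernoulli_real_univ]

/-- A convex set need not be Borel, but it is null-measurable, which suffices for the restricted
measure. -/
theorem ae_mem_cond (hconv : Convex ℝ K) :
    ∀ᵐ x ∂(volume[|K] : Measure (EuclideanSpace ℝ (Fin d))), x ∈ K := by
  have h := ae_restrict_mem₀ (hconv.nullMeasurableSet (μ := volume))
  exact Measure.ae_smul_measure h _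

/-- Almost surely all points lie in `K`. -/
theorem law_real_exists_notMem (hconv : Convex ℝ K)
    [IsProbabilityMeasure (volume[|K] : Measure (EuclideanSpace ℝ (Fin d)))]
    (ρ : ℕ → unitInterval) (n : ℕ) : (law K ρ n).real {ω | ∃ i, ω.1 i ∉ K} = 0 := by
  have h1 : {ω : (Fin n → EuclideanSpace ℝ (Fin d)) × (Finset (Fin n) → Bool) | ∃ i, ω.1 i ∉ K} =
      {x | ∃ i, x i ∉ K} ×ˢ Set.univ := by
    ext ω; simp
  rw [h1, law_real_prod, measureReal_def]
  have h2 : ∀ᵐ x ∂(Measure.pi fun _ : Fin n => (volume[|K] : Measure (EuclideanSpace ℝ (Fin d)))),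
      ∀ i, x i ∈ K :=
    Filter.eventually_all.2 fun i =>
      (Measure.tendsto_eval_ae_ae (i := i)).eventually (ae_mem_cond hconv)
  have h3 : (Measure.pi fun _ : Fin n => (volume[|K] : Measure (EuclideanSpace ℝ (Fin d))))
      {x | ∃ i, x i ∉ K} = 0 := by
    have := ae_iff.1 h2
    simpa using this
  rw [h3, ENNReal.toReal_zero, zero_mul]

/-- A property holds asymptotically almost surely if the probability of its failure tends
to `0`. -/
theorem aas_of_tendsto [IsProbabilityMeasure (volume[|K] : Measure (EuclideanSpace ℝ (Fin d)))]
    {r : ℕ → ℝ} {p : ℕ → ℕ → unitInterval} {E : ∀ n : ℕ, AbstractSimplicialComplex (Fin n) → Prop}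
    {ε : ℕ → ℝ} (hε : Tendsto ε atTop (𝓝 0))
    (h : ∀ᶠ n in atTop, (law K (p n) n).real {ω | ¬ E n (softRips (r n) ω.1 ω.2)} ≤ ε n) :
    AAS K r p E := by
  unfold AAS
  rw [← ENNReal.tendsto_toReal_iff (fun n => measure_ne_top _ _) ENNReal.one_ne_top,
    ENNReal.toReal_one]
  refine tendsto_of_tendsto_of_tendsto_of_le_of_le' (g := fun n => 1 - ε n) (h := fun _ => 1)
    (by simpa using hε.const_sub 1) tendsto_const_nhds ?_ (Eventually.of_forall fun n => ?_)
  · filter_upwards [h] with n hn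
    -- Subadditivity alone is used, so the event need not be measurable.
    have h1 : (1 : ℝ) ≤ (law K (p n) n).real {ω | E n (softRips (r n) ω.1 ω.2)} +
        (law K (p n) n).real {ω | ¬ E n (softRips (r n) ω.1 ω.2)} := by
      rw [← probReal_univ (μ := law K (p n) n)]
      refine (measureReal_mono ?_).trans (measureReal_union_le _ _)
      intro ω _
      exact em _
    rw [measureReal_def] at h1
    linarith
  · exact measureReal_le_one

end Law

/-! ### Packing, nets and ball masses in a convex body -/

section Geometry

variable {d : ℕ}

/-- The volume of the unit ball. -/
noncomputable def unitVol (d : ℕ) : ℝ :=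
  (volume : Measure (EuclideanSpace ℝ (Fin d))).real (Metric.ball 0 1)

theorem unitVol_pos : 0 < unitVol d :=
  ENNReal.toReal_pos (Metric.measure_ball_pos _ _ one_pos).ne' measure_ball_lt_top.ne

theorem volume_real_ball (x : EuclideanSpace ℝ (Fin d)) {s : ℝ} (hs : 0 < s) :
    volume.real (Metric.ball x s) = s ^ d * unitVol d := by
  rw [measureReal_def, Measure.addHaar_ball_of_pos volume x hs, ENNReal.toReal_mul,
    ENNReal.toReal_ofReal (by positivity), finrank_euclideanSpace_fin]
  rfl

theorem volume_real_closedBall (x : EuclideanSpace ℝ (Fin d)) {s : ℝ} (hs : 0 < s) :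
    volume.real (Metric.closedBall x s) = s ^ d * unitVol d := by
  rw [measureReal_def, Measure.addHaar_closedBall volume x hs.le, ENNReal.toReal_mul,
    ENNReal.toReal_ofReal (by positivity), finrank_euclideanSpace_fin]
  rfl

/-- Packing: balls of radius `δ / 2` about the points are disjoint and contained in the ball of
radius `L + 1`. -/
theorem card_mul_le_of_separated {S : Set (EuclideanSpace ℝ (Fin d))} {L δ : ℝ} (hL : 0 ≤ L)
    (hS : S ⊆ Metric.closedBall 0 L) (hδ : 0 < δ) (hδ1 : δ ≤ 1)
    {T : Finset (EuclideanSpace ℝ (Fin d))} (hT : ↑T ⊆ S)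
    (hsep : (T : Set (EuclideanSpace ℝ (Fin d))).Pairwise fun x y => δ < dist x y) :
    T.card * δ ^ d ≤ (2 * (L + 1)) ^ d := by
  have hδ2 : 0 < δ / 2 := by positivity
  have h1 : volume.real (⋃ x ∈ T, Metric.ball x (δ / 2)) =
      ∑ x ∈ T, volume.real (Metric.ball x (δ / 2)) := by
    refine measureReal_biUnion_finset ?_ (fun _ _ => Metric.isOpen_ball.measurableSet)
      (fun _ _ => measure_ball_lt_top.ne)
    intro x hx y hy hxy
    refine Metric.ball_disjoint_ball ?_
    have := hsep hx hy hxy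
    linarith
  have h2 : volume.real (⋃ x ∈ T, Metric.ball x (δ / 2)) ≤
      volume.real (Metric.closedBall (0 : EuclideanSpace ℝ (Fin d)) (L + 1)) := by
    refine measureReal_mono ?_ measure_closedBall_lt_top.ne
    refine Set.iUnion₂_subset fun x hx => ?_
    have hxL := Metric.mem_closedBall.1 (hS (hT hx))
    intro y hy
    rw [Metric.mem_ball] at hy
    rw [Metric.mem_closedBall]
    have := dist_triangle y x 0
    linarith
  rw [h1, volume_real_closedBall _ (by positivity),
    Finset.sum_congr rfl fun x _ => volume_real_ball x hδ2, Finset.sum_const, nsmul_eq_mul,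
    ← mul_assoc, mul_le_mul_iff_left₀ unitVol_pos, div_pow, ← mul_div_assoc,
    div_le_iff₀ (by positivity)] at h2
  rwa [mul_pow, mul_comm (2 ^ d)]

/-- Bounded sets have finite nets with separated points. -/
theorem exists_net {S : Set (EuclideanSpace ℝ (Fin d))} (hS : Bornology.IsBounded S) :
    ∃ C : ℝ, 0 < C ∧ ∀ δ : ℝ, 0 < δ → δ ≤ 1 → ∃ T : Finset (EuclideanSpace ℝ (Fin d)), ↑T ⊆ S ∧
      ((T : Set (EuclideanSpace ℝ (Fin d))).Pairwise fun x y => δ < dist x y) ∧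
      (∀ y ∈ S, ∃ w ∈ T, dist y w ≤ δ) ∧ T.card * δ ^ d ≤ C := by
  classical
  obtain ⟨L₀, hL₀⟩ := hS.subset_closedBall 0
  set L := max L₀ 0 with hL
  have hSL : S ⊆ Metric.closedBall 0 L :=
    hL₀.trans (Metric.closedBall_subset_closedBall (le_max_left _ _))
  have hL0 : 0 ≤ L := le_max_right _ _
  refine ⟨(2 * (L + 1)) ^ d, by positivity, fun δ hδ hδ1 => ?_⟩
  -- Packing bounds the sizes of separated subsets; one of largest size is a net, as an uncovered
  -- point could be added to it.
  set 𝒩 : Set ℕ := {m | ∃ T : Finset (EuclideanSpace ℝ (Fin d)), ↑T ⊆ S ∧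
    ((T : Set (EuclideanSpace ℝ (Fin d))).Pairwise fun x y => δ < dist x y) ∧ T.card = m} with h𝒩
  have hne : 𝒩.Nonempty := ⟨0, ∅, by simp, by simp, by simp⟩
  have hbd : BddAbove 𝒩 := by
    obtain ⟨B, hB⟩ := exists_nat_ge ((2 * (L + 1)) ^ d / δ ^ d)
    refine ⟨B, ?_⟩
    rintro m ⟨T, hT, hsep, rfl⟩
    have := card_mul_le_of_separated hL0 hSL hδ hδ1 hT hsep
    rw [← le_div_iff₀ (by positivity)] at this
    exact_mod_cast this.trans hB
  obtain ⟨T, hT, hsep, hTm⟩ := Nat.sSup_mem hne hbd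
  refine ⟨T, hT, hsep, fun y hy => ?_, card_mul_le_of_separated hL0 hSL hδ hδ1 hT hsep⟩
  by_contra! hcon
  have hyT : y ∉ T := fun h => by
    have := hcon y h
    rw [dist_self] at this
    linarith
  have hmem : T.card + 1 ∈ 𝒩 := by
    refine ⟨insert y T, ?_, ?_, Finset.card_insert_of_notMem hyT⟩
    · rw [Finset.coe_insert]
      exact Set.insert_subset hy hT
    · rw [Finset.coe_insert, Set.pairwise_insert]
      exact ⟨hsep, fun w hw _ => ⟨hcon w hw, dist_comm y w ▸ hcon w hw⟩⟩
  have := le_csSup hbd hmem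
  omega

/-- Covering: the closed `δ`-balls about the net exhaust `S`. -/
theorem le_card_of_net {S : Set (EuclideanSpace ℝ (Fin d))} {δ : ℝ} (hδ : 0 < δ)
    {T : Finset (EuclideanSpace ℝ (Fin d))} (hT : ∀ y ∈ S, ∃ w ∈ T, dist y w ≤ δ) :
    volume.real S ≤ T.card * δ ^ d * unitVol d := by
  calc volume.real S ≤ volume.real (⋃ x ∈ T, Metric.closedBall x δ) := by
        refine measureReal_mono (fun y hy => ?_) ?_
        · obtain ⟨w, hw, h⟩ := hT y hy
          exact Set.mem_iUnion₂.2 ⟨w, hw, h⟩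
        · exact ((measure_biUnion_lt_top T.finite_toSet
            (fun x _ => measure_closedBall_lt_top))).ne
    _ ≤ ∑ x ∈ T, volume.real (Metric.closedBall x δ) := measureReal_biUnion_finset_le _ _
    _ = T.card * δ ^ d * unitVol d := by
        rw [Finset.sum_congr rfl fun x _ => volume_real_closedBall x hδ, Finset.sum_const,
          nsmul_eq_mul, mul_assoc]

variable {K : Set (EuclideanSpace ℝ (Fin d))}

theorem volume_real_pos (hbdd : Bornology.IsBounded K) (hint : (interior K).Nonempty) :
    0 < (volume.real K) :=
  ENNReal.toReal_pos (Measure.measure_pos_of_nonempty_interior _ hint).ne' hbdd.measure_lt_top.ne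

theorem cond_real_apply {P : Set (EuclideanSpace ℝ (Fin d))} (hP : MeasurableSet P) :
    (volume[|K] : Measure _).real P = volume.real (K ∩ P) / volume.real K := by
  rw [measureReal_def, cond_apply' hP, ENNReal.toReal_mul, ENNReal.toReal_inv, div_eq_inv_mul]
  rfl

theorem cond_real_le {P : Set (EuclideanSpace ℝ (Fin d))}
    (hP : MeasurableSet P) (hP' : volume P ≠ ⊤) :
    (volume[|K] : Measure _).real P ≤ volume.real P / volume.real K := by
  rw [cond_real_apply hP]
  gcongr
  exact Set.inter_subset_right

theorem cond_real_eq {P : Set (EuclideanSpace ℝ (Fin d))} (hP : MeasurableSet P) (hPK : P ⊆ K) :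
    (volume[|K] : Measure _).real P = volume.real P / volume.real K := by
  rw [cond_real_apply hP, Set.inter_eq_right.2 hPK]

/-- The mass of a ball is at most proportional to the power of its radius. -/
theorem exists_cond_closedBall_le (hbdd : Bornology.IsBounded K) (hint : (interior K).Nonempty) :
    ∃ C : ℝ, 0 < C ∧ ∀ y, ∀ s : ℝ, 0 < s →
      (volume[|K] : Measure _).real (Metric.closedBall y s) ≤ C * s ^ d := by
  have hK := volume_real_pos hbdd hint
  refine ⟨unitVol d / volume.real K, div_pos unitVol_pos hK, fun y s hs => ?_⟩
  refine (cond_real_le Metric.isClosed_closedBall.measurableSet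
    measure_closedBall_lt_top.ne).trans (le_of_eq ?_)
  rw [volume_real_closedBall y hs]
  ring

/-- The mass of a ball centred in a convex body is at least proportional to the power of its
radius. -/
theorem exists_le_cond_closedBall (hconv : Convex ℝ K) (hbdd : Bornology.IsBounded K)
    (hint : (interior K).Nonempty) :
    ∃ c : ℝ, 0 < c ∧ ∀ y ∈ K, ∀ δ : ℝ, 0 < δ → δ ≤ 1 →
      c * δ ^ d ≤ (volume[|K] : Measure _).real (Metric.closedBall y δ) := by
  have hK := volume_real_pos hbdd hint
  obtain ⟨c₀, hc₀⟩ := hint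
  obtain ⟨ρ, hρ, hball⟩ := Metric.isOpen_iff.1 isOpen_interior c₀ hc₀
  replace hball := hball.trans interior_subset
  obtain ⟨L₀, hL₀⟩ := hbdd.subset_closedBall c₀
  set L := max L₀ 1 with hL
  have hKL : K ⊆ Metric.closedBall c₀ L :=
    hL₀.trans (Metric.closedBall_subset_closedBall (le_max_left _ _))
  have hL1 : 1 ≤ L := le_max_right _ _
  have hLρ : 0 < L + ρ := by linarith
  refine ⟨(ρ / (L + ρ)) ^ d * unitVol d / volume.real K,
    div_pos (mul_pos (pow_pos (div_pos hρ hLρ) _) unitVol_pos) hK, fun y hy δ hδ hδ1 => ?_⟩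
  -- The homothety of ratio `s` about `y` keeps the inner ball in `K` by convexity; this `s` puts
  -- its image within `δ` of `y`.
  set s := δ / (L + ρ) with hs
  have hs0 : 0 < s := div_pos hδ hLρ
  have hs1 : s ≤ 1 := by rw [hs, div_le_one hLρ]; linarith
  have hsδ : s * (L + ρ) = δ := by rw [hs]; field_simp
  have hsub : Metric.ball (y + s • (c₀ - y)) (s * ρ) ⊆ K ∩ Metric.closedBall y δ := by
    intro u hu
    rw [Metric.mem_ball, dist_eq_norm] at hu
    constructor
    · have hq : c₀ + s⁻¹ • (u - (y + s • (c₀ - y))) ∈ K := by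
        refine hball ?_
        rw [Metric.mem_ball, dist_eq_norm, add_sub_cancel_left, norm_smul, norm_inv,
          Real.norm_of_nonneg hs0.le, inv_mul_lt_iff₀ hs0]
        exact hu
      have := hconv hy hq (sub_nonneg.2 hs1) hs0.le (by ring)
      convert this using 1
      rw [smul_add, smul_smul, mul_inv_cancel₀ hs0.ne', one_smul]
      module
    · rw [Metric.mem_closedBall, dist_eq_norm, ← hsδ]
      have h1 : u - y = (u - (y + s • (c₀ - y))) + s • (c₀ - y) := by module
      have h2 : ‖c₀ - y‖ ≤ L := by
        rw [← dist_eq_norm, dist_comm]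
        exact hKL hy
      calc ‖u - y‖ ≤ ‖u - (y + s • (c₀ - y))‖ + ‖s • (c₀ - y)‖ := by
            conv_lhs => rw [h1]
            exact norm_add_le _ _
        _ ≤ s * ρ + s * L := by
            rw [norm_smul, Real.norm_of_nonneg hs0.le]
            gcongr
        _ = s * (L + ρ) := by ring
  rw [cond_real_apply Metric.isClosed_closedBall.measurableSet]
  have h3 : volume.real (Metric.ball (y + s • (c₀ - y)) (s * ρ)) ≤
      volume.real (K ∩ Metric.closedBall y δ) :=
    measureReal_mono hsub ((measure_mono Set.inter_subset_right).trans_lt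
      measure_closedBall_lt_top).ne
  rw [volume_real_ball _ (mul_pos hs0 hρ)] at h3
  calc (ρ / (L + ρ)) ^ d * unitVol d / volume.real K * δ ^ d
      = (s * ρ) ^ d * unitVol d / volume.real K := by
        have h4 : s * ρ = ρ / (L + ρ) * δ := by rw [hs]; ring
        rw [h4, mul_pow]
        ring
    _ ≤ _ := by gcongr

end Geometry

/-! ### Clusters of points and the obstructions to vanishing -/

section Sparse

variable {d : ℕ} {K : Set (EuclideanSpace ℝ (Fin d))}

/-- The event that the points indexed by `f` are close to each other and that the coins of all
subsets of `R` are allowed. -/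
def clusterEvent {n : ℕ} {ι : Type*} (r : ℝ) (N : ℕ) (h : Bool) (f : ι → Fin n) (i₀ : ι)
    (R : Finset (Fin n)) :
    Set ((Fin n → EuclideanSpace ℝ (Fin d)) × (Finset (Fin n) → Bool)) :=
  {ω | (∀ i, dist (ω.1 (f i)) (ω.1 (f i₀)) ≤ 2 * r) ∧ ∀ s ⊆ R, ω.2 s ∈ allowed N h s.card}

/-- At a scale `s > r`, some net point is within `s` of the reference point, hence within `3s` of
all `m + 1` points. Summing `O(s^(d (m + 1)))` over the `O(s^(-d))` net points leaves `s^(d m)`.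
Working with `s > r` and letting `s` decrease to `r` covers `r = 0`, where no net is available. -/
theorem exists_law_clusterEvent_le (hconv : Convex ℝ K) (hbdd : Bornology.IsBounded K)
    (hint : (interior K).Nonempty) (m : ℕ) :
    ∃ C : ℝ, 0 < C ∧ ∀ (ι : Type) [Fintype ι] (_ : Fintype.card ι = m + 1) (ρ : ℕ → unitInterval)
      (n : ℕ) (r : ℝ) (_ : 0 ≤ r) (_ : r < 1) (N : ℕ) (h : Bool) (f : ι ↪ Fin n) (i₀ : ι)
      (R : Finset (Fin n)),
      (law K ρ n).real (clusterEvent r N h f i₀ R) ≤ C * r ^ (d * m) * coinWeight ρ N h R.card := by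
  have := isProbabilityMeasure_cond hbdd hint
  obtain ⟨C₁, hC₁, hnet⟩ := exists_net hbdd
  obtain ⟨C₂, hC₂, hball⟩ := exists_cond_closedBall_le hbdd hint
  refine ⟨C₁ * (C₂ * 3 ^ d) ^ (m + 1), by positivity, ?_⟩
  intro ι _ hι ρ n r hr hr1 N h f i₀ R
  -- it suffices to prove the bound for all slightly larger scales
  suffices hs : ∀ s : ℝ, r < s → s < 1 → (law K ρ n).real (clusterEvent r N h f i₀ R) ≤
      C₁ * (C₂ * 3 ^ d) ^ (m + 1) * s ^ (d * m) * coinWeight ρ N h R.card by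
    have hcont : Tendsto (fun s : ℝ =>
        C₁ * (C₂ * 3 ^ d) ^ (m + 1) * s ^ (d * m) * coinWeight ρ N h R.card) (𝓝[>] r)
        (𝓝 (C₁ * (C₂ * 3 ^ d) ^ (m + 1) * r ^ (d * m) * coinWeight ρ N h R.card)) := by
      refine Tendsto.mono_left (Continuous.tendsto ?_ r) nhdsWithin_le_nhds
      fun_prop
    refine ge_of_tendsto hcont ?_
    filter_upwards [Ioo_mem_nhdsGT hr1] with s hs'
    exact hs s hs'.1 hs'.2
  intro s hrs hs1
  have hs0 : 0 < s := hr.trans_lt hrs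
  obtain ⟨T, -, -, hcov, hcard⟩ := hnet s hs0 hs1.le
  set P : EuclideanSpace ℝ (Fin d) → Fin n → Set (EuclideanSpace ℝ (Fin d)) := fun w v =>
    if v ∈ Finset.univ.map f then Metric.closedBall w (3 * s) else Set.univ with hP
  have hsub : clusterEvent r N h f i₀ R ⊆ {ω | ∃ i, ω.1 i ∉ K} ∪ ⋃ w ∈ T,
      box (P w) (fun t => if t ⊆ R then allowed N h t.card else Set.univ) := by
    intro ω hω
    by_cases hωK : ∃ i, ω.1 i ∉ K
    · exact Or.inl hωK
    · push Not at hωK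
      obtain ⟨w, hw, hw'⟩ := hcov _ (hωK (f i₀))
      refine Or.inr (Set.mem_iUnion₂.2 ⟨w, hw, fun v => ?_, fun t => ?_⟩)
      · simp only [hP]
        split_ifs with hv
        · obtain ⟨i, -, rfl⟩ := Finset.mem_map.1 hv
          have h1 := hω.1 i
          have h2 := dist_triangle (ω.1 (f i)) (ω.1 (f i₀)) w
          rw [Metric.mem_closedBall]
          linarith
        · trivial
      · dsimp only
        split_ifs with ht
        · exact hω.2 t ht
        · trivial
  have hbox : ∀ w, (law K ρ n).real
      (box (P w) (fun t => if t ⊆ R then allowed N h t.card else Set.univ)) ≤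
      (C₂ * (3 * s) ^ d) ^ (m + 1) * coinWeight ρ N h R.card := by
    intro w
    rw [law_real_box_allowed]
    refine mul_le_mul_of_nonneg_right ?_ (coinWeight_nonneg _ _ _ _)
    rw [← Finset.prod_subset (Finset.subset_univ (Finset.univ.map f))
      (fun v _ hv => by simp only [hP]; rw [if_neg hv, probReal_univ]), ← hι, ← Finset.card_univ,
      ← Finset.card_map f]
    refine (Finset.prod_le_prod (fun _ _ => measureReal_nonneg) fun v hv => ?_).trans
      (Finset.prod_const _).le
    simp only [hP]
    rw [if_pos hv]
    exact hball w _ (by positivity)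
  calc (law K ρ n).real (clusterEvent r N h f i₀ R)
      ≤ (law K ρ n).real {ω | ∃ i, ω.1 i ∉ K} + (law K ρ n).real (⋃ w ∈ T,
          box (P w) (fun t => if t ⊆ R then allowed N h t.card else Set.univ)) :=
        (measureReal_mono hsub).trans (measureReal_union_le _ _)
    _ ≤ 0 + ∑ w ∈ T, (C₂ * (3 * s) ^ d) ^ (m + 1) * coinWeight ρ N h R.card := by
        rw [law_real_exists_notMem hconv]
        gcongr
        exact (measureReal_biUnion_finset_le _ _).trans (Finset.sum_le_sum fun w _ => hbox w)
    _ = T.card * s ^ d * ((C₂ * 3 ^ d) ^ (m + 1) * s ^ (d * m) * coinWeight ρ N h R.card) := by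
        rw [zero_add, Finset.sum_const, nsmul_eq_mul, mul_pow 3 s d, ← mul_assoc C₂, mul_pow,
          ← pow_mul, Nat.mul_succ, pow_add]
        ring
    _ ≤ C₁ * ((C₂ * 3 ^ d) ^ (m + 1) * s ^ (d * m) * coinWeight ρ N h R.card) := by
        have := coinWeight_nonneg ρ N h R.card
        gcongr
    _ = _ := by ring

theorem card_embedding_le (ι : Type) [Fintype ι] (n : ℕ) :
    (Fintype.card (ι ↪ Fin n) : ℝ) ≤ (n : ℝ) ^ Fintype.card ι := by
  rw [Fintype.card_embedding_eq, Fintype.card_fin]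
  exact_mod_cast Nat.descFactorial_le_pow _ _

theorem exists_embedding_of_card {V : Type*} {s : Finset V} {m : ℕ} (hs : s.card = m) :
    ∃ f : Fin m ↪ V, Finset.univ.map f = s := by
  classical
  refine ⟨(s.equivFinOfCardEq hs).symm.toEmbedding.trans (Function.Embedding.subtype _), ?_⟩
  ext v
  simp only [Finset.mem_map, Finset.mem_univ, true_and]
  constructor
  · rintro ⟨i, rfl⟩
    exact ((s.equivFinOfCardEq hs).symm i).2
  · intro hv
    exact ⟨s.equivFinOfCardEq hs ⟨v, hv⟩, by simp⟩

/-- If the homology does not vanish, there is a hollow simplex or a simplex with two further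
vertices nearby. -/
theorem not_subsingleton_homology_subset {A : Type*} [CommRing A] {n k : ℕ} {r : ℝ} (hr : 0 ≤ r)
    (hk : 1 ≤ k) :
    {ω : (Fin n → EuclideanSpace ℝ (Fin d)) × (Finset (Fin n) → Bool) |
      ¬ Subsingleton (Homology A (softRips r ω.1 ω.2) k)} ⊆
    (⋃ f : Fin (k + 2) ↪ Fin n, clusterEvent r (k + 1) true f 0 (Finset.univ.map f)) ∪
    ⋃ f : Option (Option (Fin (k + 1))) ↪ Fin n, clusterEvent r (k + 1) false f (some (some 0))
      (Finset.univ.map ((Function.Embedding.some.trans Function.Embedding.some).trans f)) := by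
  obtain ⟨j, rfl⟩ : ∃ j, k = j + 1 := ⟨k - 1, by omega⟩
  rintro ⟨x, coin⟩ hω
  by_contra hcon
  rw [Set.mem_union, not_or] at hcon
  obtain ⟨hno1, hno2⟩ := hcon
  refine hω ((subsingleton_homology_iff _ _).2 (exists_bd_eq_of_no_hollow ?_ ?_))
  · intro s hs hfaces
    obtain ⟨f, hf⟩ := exists_embedding_of_card hs
    -- Every proper subset lies in a facet. Pairs are proper since `s` has at least three vertices,
    -- so the facets determine all distances.
    have hmiss : ∀ t ⊆ s, t.card < j + 3 → ∃ v ∈ s, t ⊆ s.erase v := by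
      intro t ht htc
      obtain ⟨v, hv, hvt⟩ := Finset.exists_mem_notMem_of_card_lt_card (hs ▸ htc)
      exact ⟨v, hv, fun u hu => Finset.mem_erase.2 ⟨fun h => hvt (h ▸ hu), ht hu⟩⟩
    have hdist : ∀ u ∈ s, ∀ v ∈ s, u ≠ v → dist (x u) (x v) ≤ r := by
      intro u hu v hv huv
      obtain ⟨w, hw, hsub⟩ := hmiss {u, v} (by simp [Finset.insert_subset_iff, hu, hv])
        (Finset.card_le_two.trans_lt (by omega))
      exact (hfaces w hw).2.1 (hsub (by simp)) (hsub (by simp)) huv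
    have hcoin : ∀ t ⊆ s, 2 ≤ t.card → t.card ≤ j + 2 → coin t = true := by
      intro t ht h2 htc
      obtain ⟨w, hw, hsub⟩ := hmiss t ht (by omega)
      exact (hfaces w hw).2.2 t hsub h2
    refine ⟨Finset.card_pos.1 (by omega), fun u hu v hv huv => hdist u hu v hv huv,
      fun t ht h2 => ?_⟩
    by_cases htc : t.card ≤ j + 2
    · exact hcoin t ht h2 htc
    · have hts : t = s := Finset.eq_of_subset_of_card_le ht (by omega)
      by_contra hne
      refine hno1 (Set.mem_iUnion.2 ⟨f, fun i => ?_, fun u hu => ⟨fun h => ?_, fun h => ?_⟩⟩)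
      · rcases eq_or_ne (f i) (f 0) with h | h
        · simp [h, hr]
        · refine (hdist _ ?_ _ ?_ h).trans (by linarith) <;> rw [← hf] <;> simp
      · exact hcoin u (hf ▸ hu) h.1 h.2
      · have hus : u = s := Finset.eq_of_subset_of_card_le (hf ▸ hu) (by omega)
        rw [hus, ← hts]
        simpa using hne
  · intro s hsX hs a b ha hb hua hvb
    obtain ⟨u, hu, hua⟩ := hua
    obtain ⟨v, hv, hvb⟩ := hvb
    by_contra hab
    obtain ⟨f, hf⟩ := exists_embedding_of_card hs
    have hfs : ∀ i, f i ∈ s := fun i => by rw [← hf]; simp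
    have hsd : ∀ u ∈ s, ∀ v ∈ s, dist (x u) (x v) ≤ r := by
      intro u hu v hv
      rcases eq_or_ne u v with rfl | h
      · simpa using hr
      · exact hsX.2.1 hu hv h
    -- An outside vertex need only be adjacent to one vertex of `s`; this explains the radius `2 *
    -- r` of clusters.
    have hnear : ∀ u ∈ s, ∀ c, c ∉ s → {u, c} ∈ (softRips r x coin).faces →
        ∀ w ∈ s, dist (x c) (x w) ≤ 2 * r := by
      intro u hu c hc huc w hw
      have h1 : dist (x u) (x c) ≤ r :=
        huc.2.1 (by simp) (by simp) fun h => hc (h ▸ hu)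
      have h2 := hsd u hu w hw
      have h3 := dist_triangle_left (x c) (x w) (x u)
      linarith
    -- The two `none` slots hold the additional vertices `a` and `b`; the coins recorded by the
    -- event are those of `s` only.
    have hinj : Function.Injective fun o : Option (Option (Fin (j + 1 + 1))) =>
        match o with
        | none => a
        | some none => b
        | some (some i) => f i := by
      rintro (_ | _ | i) (_ | _ | i') h
      · rfl
      · exact absurd h hab
      · exact absurd ((show a = f i' from h) ▸ hfs i') ha
      · exact absurd h.symm hab
      · rfl
      · exact absurd ((show b = f i' from h) ▸ hfs i') hb
      · exact absurd ((show f i = a from h) ▸ hfs i) ha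
      · exact absurd ((show f i = b from h) ▸ hfs i) hb
      · rw [f.injective h]
    refine hno2 (Set.mem_iUnion.2 ⟨⟨_, hinj⟩, ?_, fun t ht => ⟨fun h => ?_, fun h => ?_⟩⟩)
    · rintro (_ | _ | i)
      · exact hnear u hu a ha hua _ (hfs 0)
      · exact hnear v hv b hb hvb _ (hfs 0)
      · exact (hsd _ (hfs i) _ (hfs 0)).trans (by linarith)
    · refine hsX.2.2 t (fun w hw => ?_) h.1
      obtain ⟨i, -, rfl⟩ := Finset.mem_map.1 (ht hw)
      exact hfs i
    · exact absurd h.1 (by simp)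

end Sparse

/-! ### First-moment bound below the threshold -/

section SparseLimit

variable {d : ℕ} {K : Set (EuclideanSpace ℝ (Fin d))}

theorem measureReal_iUnion_embedding_le {Ω : Type*} [MeasurableSpace Ω] (μ : Measure Ω)
    {ι : Type} [Fintype ι] {n : ℕ} {E : (ι ↪ Fin n) → Set Ω} {b : ℝ} (hb : 0 ≤ b)
    (h : ∀ f, μ.real (E f) ≤ b) : μ.real (⋃ f, E f) ≤ (n : ℝ) ^ Fintype.card ι * b := by
  classical
  calc μ.real (⋃ f, E f) ≤ ∑ f, μ.real (E f) := measureReal_iUnion_fintype_le _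
    _ ≤ Fintype.card (ι ↪ Fin n) • b := Finset.sum_le_card_nsmul _ _ _ fun f _ => h f
    _ ≤ (n : ℝ) ^ Fintype.card ι * b := by
        rw [nsmul_eq_mul]
        exact mul_le_mul_of_nonneg_right (card_embedding_le ι n) hb

/-- Below the threshold the homology vanishes asymptotically almost surely. -/
theorem aas_subsingleton_of_sparse {A : Type*} [CommRing A] (hconv : Convex ℝ K)
    (hbdd : Bornology.IsBounded K) (hint : (interior K).Nonempty) {k : ℕ} (hk : 1 ≤ k)
    {p : ℕ → ℕ → unitInterval} {r : ℕ → ℝ} (hr : ∀ n, 0 ≤ r n)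
    (h1 : (fun n : ℕ => (n : ℝ) * r n ^ d) =o[atTop] (fun n : ℕ =>
      (1 - (p n (k + 1) : ℝ)) * ∏ i ∈ Finset.Icc 1 k, (p n i : ℝ) ^ (k + 1).choose i))
    (h2 : Tendsto (fun n : ℕ => (1 - (p n (k + 1) : ℝ)) *
      (∏ i ∈ Finset.Icc 1 k, (p n i : ℝ) ^ (k + 2).choose (i + 1)) *
      (n : ℝ) ^ (k + 2) * r n ^ (d * (k + 1))) atTop (𝓝 0)) :
    AAS K r p (fun _ X => Subsingleton (Homology A X k)) := by
  have := isProbabilityMeasure_cond hbdd hint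
  obtain ⟨C₁, hC₁, hcl₁⟩ := exists_law_clusterEvent_le hconv hbdd hint (k + 1)
  obtain ⟨C₂, hC₂, hcl₂⟩ := exists_law_clusterEvent_le hconv hbdd hint (k + 2)
  set q : ℕ → ℝ := fun n => (1 - (p n (k + 1) : ℝ)) *
      (∏ i ∈ Finset.Icc 1 k, (p n i : ℝ) ^ (k + 2).choose (i + 1)) *
      (n : ℝ) ^ (k + 2) * r n ^ (d * (k + 1)) with hq
  refine aas_of_tendsto (ε := fun n => (C₁ + C₂) * q n) (by simpa using h2.const_mul (C₁ + C₂)) ?_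
  filter_upwards [h1.bound one_pos, eventually_ge_atTop 2] with n hn hn2
  have hrn := hr n
  have hn0 : (0 : ℝ) < n := by positivity
  have hn2' : (2 : ℝ) ≤ n := by exact_mod_cast hn2
  have hp0 : ∀ i, (0 : ℝ) ≤ p n i := fun i => (p n i).2.1
  have hp1 : ∀ i, (p n i : ℝ) ≤ 1 := fun i => (p n i).2.2
  set B := ∏ i ∈ Finset.Icc 1 k, (p n i : ℝ) ^ (k + 1).choose i with hB
  have hB0 : 0 ≤ B := Finset.prod_nonneg fun i _ => pow_nonneg (hp0 i) _
  have hB1 : B ≤ 1 := Finset.prod_le_one (fun i _ => pow_nonneg (hp0 i) _)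
    fun i _ => pow_le_one₀ (hp0 i) (hp1 i)
  have hbound : (n : ℝ) * r n ^ d ≤ (1 - (p n (k + 1) : ℝ)) * B := by
    rw [one_mul, Real.norm_of_nonneg (by positivity), Real.norm_of_nonneg
      (mul_nonneg (sub_nonneg.2 (hp1 _)) hB0)] at hn
    exact hn
  -- Otherwise `n r^d ≥ 2`, against a bound that is at most `1`.
  have hr1 : r n < 1 := by
    by_contra! h
    have h3 : 1 ≤ r n ^ d := one_le_pow₀ h
    have h4 : (1 - (p n (k + 1) : ℝ)) * B ≤ 1 * 1 :=
      mul_le_mul (by linarith [hp0 (k + 1)]) hB1 hB0 zero_le_one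
    nlinarith
  set W := ∏ i ∈ Finset.Icc 1 k, (p n i : ℝ) ^ (k + 1).choose (i + 1) with hW
  have hW0 : 0 ≤ W := Finset.prod_nonneg fun i _ => pow_nonneg (hp0 i) _
  have hw₁ : coinWeight (p n) (k + 1) true (k + 2) =
      (∏ i ∈ Finset.Icc 1 k, (p n i : ℝ) ^ (k + 2).choose (i + 1)) * (1 - (p n (k + 1) : ℝ)) := by
    rw [coinWeight_eq _ _ _ _ (by omega) (by simp)]
    simp
  have hw₂ : coinWeight (p n) (k + 1) false (k + 1) = W := by
    rw [coinWeight_eq _ _ _ _ (by omega) (by simp)]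
    simp [hW]
  -- Pascal's rule in the exponents.
  have hBW : B * W = ∏ i ∈ Finset.Icc 1 k, (p n i : ℝ) ^ (k + 2).choose (i + 1) := by
    rw [hB, hW, ← Finset.prod_mul_distrib]
    refine Finset.prod_congr rfl fun i _ => ?_
    rw [← pow_add]
    rfl
  have hcard₂ : Fintype.card (Option (Option (Fin (k + 1)))) = k + 3 := by simp
  calc (law K (p n) n).real {ω | ¬ Subsingleton (Homology A (softRips (r n) ω.1 ω.2) k)}
      ≤ (law K (p n) n).real (⋃ f : Fin (k + 2) ↪ Fin n,
          clusterEvent (r n) (k + 1) true f 0 (Finset.univ.map f)) +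
        (law K (p n) n).real (⋃ f : Option (Option (Fin (k + 1))) ↪ Fin n,
          clusterEvent (r n) (k + 1) false f (some (some 0)) (Finset.univ.map
            ((Function.Embedding.some.trans Function.Embedding.some).trans f))) :=
        (measureReal_mono (not_subsingleton_homology_subset hrn hk)).trans
          (measureReal_union_le _ _)
    _ ≤ (n : ℝ) ^ (k + 2) * (C₁ * r n ^ (d * (k + 1)) * coinWeight (p n) (k + 1) true (k + 2)) +
        (n : ℝ) ^ (k + 3) *
          (C₂ * r n ^ (d * (k + 2)) * coinWeight (p n) (k + 1) false (k + 1)) := by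
        refine add_le_add ?_ ?_
        · have h := measureReal_iUnion_embedding_le (law K (p n) n) (ι := Fin (k + 2)) (n := n)
            (E := fun f => clusterEvent (r n) (k + 1) true f 0 (Finset.univ.map f))
            (b := C₁ * r n ^ (d * (k + 1)) * coinWeight (p n) (k + 1) true (k + 2))
            (mul_nonneg (by positivity) (coinWeight_nonneg _ _ _ _)) (fun f => by
              have := hcl₁ _ (by simp) (p n) n (r n) hrn hr1 (k + 1) true f 0 (Finset.univ.map f)
              rwa [Finset.card_map, Finset.card_univ, Fintype.card_fin] at this)
          rwa [Fintype.card_fin] at h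
        · have h := measureReal_iUnion_embedding_le (law K (p n) n)
            (ι := Option (Option (Fin (k + 1)))) (n := n)
            (E := fun f => clusterEvent (r n) (k + 1) false f (some (some 0)) (Finset.univ.map
              ((Function.Embedding.some.trans Function.Embedding.some).trans f)))
            (b := C₂ * r n ^ (d * (k + 2)) * coinWeight (p n) (k + 1) false (k + 1))
            (mul_nonneg (by positivity) (coinWeight_nonneg _ _ _ _)) (fun f => by
              have := hcl₂ _ hcard₂ (p n) n (r n) hrn hr1 (k + 1) false f (some (some 0))
                (Finset.univ.map ((Function.Embedding.some.trans Function.Embedding.some).trans f))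
              rwa [Finset.card_map, Finset.card_univ, Fintype.card_fin] at this)
          rwa [hcard₂] at h
    _ ≤ C₁ * q n + C₂ * q n := by
        rw [hw₁, hw₂]
        refine add_le_add (le_of_eq ?_) ?_
        · simp only [hq]; ring
        -- The factor `n r^d` of the additional vertex is traded for `(1 - p_{k+1}) B`, and `B * W`
        -- is the coin product occurring in `q`.
        · have h5 : (n : ℝ) ^ (k + 3) * (C₂ * r n ^ (d * (k + 2)) * W) =
              C₂ * (n ^ (k + 2) * r n ^ (d * (k + 1)) * W) * (n * r n ^ d) := by
            rw [show d * (k + 2) = d * (k + 1) + d by ring, pow_add, pow_succ]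
            ring
          rw [h5]
          refine (mul_le_mul_of_nonneg_left hbound (by positivity)).trans (le_of_eq ?_)
          simp only [hq]
          rw [← hBW]
          ring
    _ = (C₁ + C₂) * q n := by ring

end SparseLimit

/-! ### Probability that no vertex cones off a given set -/

section Rich

/-- Events that depend on disjoint sets of coordinates fail independently of each other. -/
theorem pi_real_forall_not_forall {ι κ : Type*} [DecidableEq ι] [Fintype κ] [DecidableEq κ]
    (μ : κ → Measure Bool) [∀ s, IsProbabilityMeasure (μ s)] (C : κ → Set Bool)
    (J : ι → Finset κ) (W : Finset ι) (hJ : (W : Set ι).PairwiseDisjoint J) :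
    (Measure.pi μ).real {x | ∀ v ∈ W, ¬ ∀ s ∈ J v, x s ∈ C s} =
      ∏ v ∈ W, (1 - ∏ s ∈ J v, (μ s).real (C s)) := by
  induction W using Finset.induction_on with
  | empty => simp
  | insert a W ha ih =>
    have hind : iIndepFun (fun (s : κ) (x : κ → Bool) => x s) (Measure.pi μ) :=
      iIndepFun_pi (X := fun _ b => b) (fun _ => aemeasurable_id)
    have hdisj : Disjoint (J a) (W.biUnion J) := by
      rw [Finset.disjoint_biUnion_right]
      intro v hv
      exact hJ (by simp) (by simp [hv]) fun h => ha (h ▸ hv)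
    have h1 := hind.indepFun_finset _ _ hdisj (fun s => measurable_pi_apply s)
    have h2 := h1.measure_inter_preimage_eq_mul {y | ¬ ∀ s : J a, y s ∈ C s}
      {y | ∀ v, ∀ hv : v ∈ W, ¬ ∀ s, ∀ hs : s ∈ J v,
        y ⟨s, Finset.mem_biUnion.2 ⟨v, hv, hs⟩⟩ ∈ C s}
      MeasurableSet.of_discrete MeasurableSet.of_discrete
    have hsplit : {x : κ → Bool | ∀ v ∈ insert a W, ¬ ∀ s ∈ J v, x s ∈ C s} =
        {x | ¬ ∀ s ∈ J a, x s ∈ C s} ∩ {x | ∀ v ∈ W, ¬ ∀ s ∈ J v, x s ∈ C s} := by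
      ext x
      simp only [Finset.forall_mem_insert]
      rfl
    have hA : (fun (x : κ → Bool) (s : J a) => x s) ⁻¹' {y | ¬ ∀ s : J a, y s ∈ C s} =
        {x | ¬ ∀ s ∈ J a, x s ∈ C s} := by
      ext x
      simp
    have hB : (fun (x : κ → Bool) (s : W.biUnion J) => x s) ⁻¹' {y | ∀ v, ∀ hv : v ∈ W,
        ¬ ∀ s, ∀ hs : s ∈ J v, y ⟨s, Finset.mem_biUnion.2 ⟨v, hv, hs⟩⟩ ∈ C s} =
        {x | ∀ v ∈ W, ¬ ∀ s ∈ J v, x s ∈ C s} := by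
      ext x
      rfl
    rw [hA, hB] at h2
    rw [hsplit, measureReal_def, h2, ENNReal.toReal_mul, ← measureReal_def, ← measureReal_def,
      ih (hJ.subset (by simp)), Finset.prod_insert ha]
    congr 1
    have hcompl : {x : κ → Bool | ¬ ∀ s ∈ J a, x s ∈ C s} = {x | ∀ s ∈ J a, x s ∈ C s}ᶜ := rfl
    rw [hcompl, probReal_compl_eq_one_sub MeasurableSet.of_discrete]
    congr 1
    have hbox : {x : κ → Bool | ∀ s ∈ J a, x s ∈ C s} =
        {x | ∀ s, x s ∈ if s ∈ J a then C s else Set.univ} := by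
      ext x
      refine forall_congr' fun s => ?_
      split_ifs with h <;> simp [h]
    rw [hbox, pi_real_pi, ← Finset.prod_subset (Finset.subset_univ (J a))]
    · exact Finset.prod_congr rfl fun s hs => by rw [if_pos hs]
    · intro s _ hs
      rw [if_neg hs, probReal_univ]

variable {d : ℕ} {K : Set (EuclideanSpace ℝ (Fin d))}

/-- The event that no vertex outside `S` lies in `B` and cones off the subsets of `S` with at most
`N` elements. -/
def failEvent {n : ℕ} (B : Set (EuclideanSpace ℝ (Fin d))) (S : Finset (Fin n)) (N : ℕ) :
    Set ((Fin n → EuclideanSpace ℝ (Fin d)) × (Finset (Fin n) → Bool)) :=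
  {ω | ∀ v ∉ S, ¬ (ω.1 v ∈ B ∧
    ∀ t ⊆ S, t.Nonempty → t.card ≤ N → ω.2 (insert v t) = true)}

/-- The sets whose coins decide whether `v` cones off the subsets of `S` with at most `N`
elements. -/
def coneSets {n : ℕ} (S : Finset (Fin n)) (N : ℕ) (v : Fin n) : Finset (Finset (Fin n)) :=
  {t ∈ S.powerset | t.Nonempty ∧ t.card ≤ N}.image (insert v)

/-- Split according to the set `W` of outside vertices lying in `B`. The coins deciding whether
different `v ∈ W` cone off `S` are disjoint, and each `v` succeeds with probability at least `c ^ 2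
^ S.card`, as at most `2 ^ S.card` coins are involved. The binomial theorem sums over `W`. -/
theorem law_real_failEvent_le
    [IsProbabilityMeasure (volume[|K] : Measure (EuclideanSpace ℝ (Fin d)))]
    {ρ : ℕ → unitInterval} {n N : ℕ} {B : Set (EuclideanSpace ℝ (Fin d))} (hB : MeasurableSet B)
    (S : Finset (Fin n)) {c : ℝ} (hc0 : 0 ≤ c) (hc1 : c ≤ 1)
    (hc : ∀ i ∈ Finset.Icc 1 N, c ≤ (ρ i : ℝ)) :
    (law K ρ n).real (failEvent B S N) ≤
      (1 - (volume[|K] : Measure _).real B * c ^ 2 ^ S.card) ^ (n - S.card) := by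
  classical
  set a := (volume[|K] : Measure _).real B with ha
  have ha0 : 0 ≤ a := measureReal_nonneg
  have ha1 : a ≤ 1 := measureReal_le_one
  set π := c ^ 2 ^ S.card with hπ
  set Q : Finset (Fin n) → Set (Fin n → EuclideanSpace ℝ (Fin d)) := fun W =>
    {x | ∀ v, x v ∈ if v ∈ S then Set.univ else if v ∈ W then B else Bᶜ} with hQ
  set R : Finset (Fin n) → Set (Finset (Fin n) → Bool) := fun W =>
    {x | ∀ v ∈ W, ¬ ∀ s ∈ coneSets S N v, x s ∈ ({true} : Set Bool)} with hR
  have hsub : failEvent B S N ⊆ ⋃ W ∈ Sᶜ.powerset, Q W ×ˢ R W := by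
    rintro ⟨x, coin⟩ hω
    refine Set.mem_iUnion₂.2 ⟨{v ∈ Sᶜ | x v ∈ B},
      Finset.mem_powerset.2 (Finset.filter_subset _ _), fun v => ?_, fun v hv hall => ?_⟩
    · split_ifs with h1 h2
      · trivial
      · exact (Finset.mem_filter.1 h2).2
      · exact fun h3 => h2 (Finset.mem_filter.2 ⟨Finset.mem_compl.2 h1, h3⟩)
    · obtain ⟨hvS, hvB⟩ := Finset.mem_filter.1 hv
      refine hω v (Finset.mem_compl.1 hvS) ⟨hvB, fun t ht hne htN => ?_⟩
      exact hall _ (Finset.mem_image_of_mem _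
        (Finset.mem_filter.2 ⟨Finset.mem_powerset.2 ht, hne, htN⟩))
  have hprod : ∀ W ∈ Sᶜ.powerset, (law K ρ n).real (Q W ×ˢ R W) ≤
      (a * (1 - π)) ^ W.card * (1 - a) ^ (Sᶜ.card - W.card) := by
    intro W hW
    have hWS := Finset.mem_powerset.1 hW
    rw [law_real_prod, pi_real_pi, pi_real_forall_not_forall]
    · have h1 : ∏ v, (volume[|K] : Measure _).real
          (if v ∈ S then Set.univ else if v ∈ W then B else Bᶜ) =
          a ^ W.card * (1 - a) ^ (Sᶜ.card - W.card) := by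
        rw [← Finset.prod_subset (Finset.subset_univ Sᶜ) (fun v _ hv => by
            rw [if_pos (by simpa using hv), probReal_univ]),
          ← Finset.prod_sdiff hWS, mul_comm, ← Finset.card_sdiff_of_subset hWS]
        congr 1
        · refine (Finset.prod_congr rfl fun v hv => ?_).trans (Finset.prod_const _)
          rw [if_neg (Finset.mem_compl.1 (hWS hv)), if_pos hv]
        · refine (Finset.prod_congr rfl fun v hv => ?_).trans (Finset.prod_const _)
          obtain ⟨h2, h3⟩ := Finset.mem_sdiff.1 hv
          rw [if_neg (Finset.mem_compl.1 h2), if_neg h3, probReal_compl_eq_one_sub hB]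
      rw [h1, mul_pow, mul_right_comm]
      refine mul_le_mul_of_nonneg_right (mul_le_mul_of_nonneg_left ?_ (by positivity))
        (pow_nonneg (sub_nonneg.2 ha1) _)
      have hpos : ∀ v ∈ W, π ≤ ∏ s ∈ coneSets S N v,
          (bernoulliMeasure true false (ρ (s.card - 1))).real {true} := by
        intro v hv
        have hvS := Finset.mem_compl.1 (hWS hv)
        have hcard : (coneSets S N v).card ≤ 2 ^ S.card :=
          Finset.card_image_le.trans ((Finset.card_filter_le _ _).trans
            (Finset.card_powerset S).le)
        calc π ≤ c ^ (coneSets S N v).card := pow_le_pow_of_le_one hc0 hc1 hcard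
          _ = ∏ s ∈ coneSets S N v, c := (Finset.prod_const _).symm
          _ ≤ _ := by
            refine Finset.prod_le_prod (fun _ _ => hc0) fun s hs => ?_
            obtain ⟨t, ht, rfl⟩ := Finset.mem_image.1 hs
            obtain ⟨ht1, ht2, ht3⟩ := Finset.mem_filter.1 ht
            rw [bernoulli_real_true, Finset.card_insert_of_notMem
              (fun h => hvS (Finset.mem_powerset.1 ht1 h)), Nat.add_sub_cancel]
            exact hc _ (Finset.mem_Icc.2 ⟨Finset.card_pos.2 ht2, ht3⟩)
      refine (Finset.prod_le_prod (fun v _ => sub_nonneg.2 ?_) fun v hv =>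
        sub_le_sub_left (hpos v hv) 1).trans (Finset.prod_const _).le
      exact Finset.prod_le_one (fun _ _ => measureReal_nonneg) fun _ _ => measureReal_le_one
    -- A set `insert v t` with `t ⊆ S` and `v ∉ S` determines `v`.
    · intro v hv w hw hvw
      refine Finset.disjoint_left.2 fun s hs hs' => ?_
      obtain ⟨t, ht, rfl⟩ := Finset.mem_image.1 hs
      obtain ⟨t', ht', he⟩ := Finset.mem_image.1 hs'
      have hv' : v ∈ insert w t' := he ▸ Finset.mem_insert_self v t
      rcases Finset.mem_insert.1 hv' with h | h
      · exact hvw h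
      · exact Finset.mem_compl.1 (hWS hv) (Finset.mem_powerset.1 (Finset.mem_filter.1 ht').1 h)
  calc (law K ρ n).real (failEvent B S N)
      ≤ ∑ W ∈ Sᶜ.powerset, (law K ρ n).real (Q W ×ˢ R W) :=
        (measureReal_mono hsub (measure_ne_top _ _)).trans (measureReal_biUnion_finset_le _ _)
    _ ≤ ∑ W ∈ Sᶜ.powerset, (a * (1 - π)) ^ W.card * (1 - a) ^ (Sᶜ.card - W.card) :=
        Finset.sum_le_sum hprod
    _ = (1 - a * π) ^ (n - S.card) := by
        rw [Finset.sum_pow_mul_eq_add_pow, Finset.card_compl, Fintype.card_fin]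
        congr 1
        ring

end Rich

/-! ### Union bound above the connectivity threshold -/

section DenseLimit

variable {d : ℕ} {K : Set (EuclideanSpace ℝ (Fin d))}

/-- A set to be coned off is padded to exactly `M` vertices, and the target point is replaced by a
net point. The ball and the net each cost `δ`, whence the assumption on `2 * δ`. -/
theorem not_subsingleton_homology_subset_failEvent {A : Type*} [CommRing A] (hconv : Convex ℝ K)
    (hne : K.Nonempty) {n k M : ℕ} {r δ : ℝ} (hr : 0 < r) (hk : 1 ≤ k)
    (hM : M = (k + 1) + 2 ^ (k + 1)) (hn : M ≤ n) (hδ : 2 * δ ≤ r / (4 * (k + 1)))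
    {T : Finset (EuclideanSpace ℝ (Fin d))} (hT : ∀ y ∈ K, ∃ w ∈ T, dist y w ≤ δ) :
    {ω : (Fin n → EuclideanSpace ℝ (Fin d)) × (Finset (Fin n) → Bool) |
      ¬ Subsingleton (Homology A (softRips r ω.1 ω.2) k)} ⊆
    {ω | ∃ i, ω.1 i ∉ K} ∪ ⋃ f : Fin M ↪ Fin n, ⋃ w ∈ T,
      failEvent (Metric.closedBall w δ) (Finset.univ.map f) (k + 1) := by
  obtain ⟨j, rfl⟩ : ∃ j, k = j + 1 := ⟨k - 1, by omega⟩
  rintro ⟨x, coin⟩ hω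
  by_contra hcon
  rw [Set.mem_union, not_or] at hcon
  obtain ⟨hK, hno⟩ := hcon
  have hK' : ∀ i, x i ∈ K := by
    intro i
    by_contra h
    exact hK ⟨i, h⟩
  obtain ⟨c, hc⟩ := hne
  refine hω ((subsingleton_homology_iff _ _).2 (exists_bd_eq_of_rich hconv hc hK' hr ?_))
  intro S hS y hy
  obtain ⟨S', hSS', hS'⟩ := Finset.exists_superset_card_eq (hS.trans hM.ge)
    (by rwa [Fintype.card_fin])
  obtain ⟨f, hf⟩ := exists_embedding_of_card hS'
  obtain ⟨w, hw, hyw⟩ := hT y hy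
  by_contra hcon
  refine hno (Set.mem_iUnion.2 ⟨f, Set.mem_iUnion₂.2 ⟨w, hw, fun v _ hv => hcon ⟨v, ?_, ?_⟩⟩⟩)
  · have h1 : dist (x v) w ≤ δ := hv.1
    have h2 := dist_triangle_right (x v) y w
    have h3 : r / (4 * ((j : ℝ) + 2)) = r / (4 * (((j + 1 : ℕ) : ℝ) + 1)) := by
      push_cast
      ring
    rw [h3]
    linarith
  · intro t ht hne htc
    exact hv.2 t ((ht.trans hSS').trans hf.ge) hne htc

theorem log_div_le_of_isLittleO (hd : 1 ≤ d) {r : ℕ → ℝ} (hr : ∀ n, 0 ≤ r n)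
    (h : (fun n : ℕ => (Real.log n / n) ^ (1 / (d : ℝ))) =o[atTop] r) {a : ℝ} (ha : 1 ≤ a) :
    ∀ᶠ n : ℕ in atTop, a * (Real.log n / n) ≤ r n ^ d := by
  have ha0 : 0 < a := by linarith
  filter_upwards [h.bound (inv_pos.2 ha0), eventually_ge_atTop 1] with n hn hn1
  have hlog : 0 ≤ Real.log n / n :=
    div_nonneg (Real.log_nonneg (by exact_mod_cast hn1)) (Nat.cast_nonneg _)
  rw [Real.norm_of_nonneg (Real.rpow_nonneg hlog _), Real.norm_of_nonneg (hr n)] at hn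
  have h1 := pow_le_pow_left₀ (Real.rpow_nonneg hlog _) hn d
  rw [← Real.rpow_natCast, ← Real.rpow_mul hlog, one_div,
    inv_mul_cancel₀ (by positivity), Real.rpow_one, mul_pow] at h1
  have h2 : (a⁻¹) ^ d ≤ a⁻¹ := pow_le_of_le_one (inv_nonneg.2 ha0.le) (inv_le_one_of_one_le₀ ha)
    (by omega)
  have h3 : Real.log n / n ≤ a⁻¹ * r n ^ d :=
    h1.trans (mul_le_mul_of_nonneg_right h2 (pow_nonneg (hr n) _))
  calc a * (Real.log n / n) ≤ a * (a⁻¹ * r n ^ d) := by gcongr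
    _ = r n ^ d := by rw [← mul_assoc, mul_inv_cancel₀ ha0.ne', one_mul]

theorem tendsto_log_div_nat : Tendsto (fun n : ℕ => Real.log n / n) atTop (𝓝 0) := by
  have := (Real.isLittleO_log_id_atTop.tendsto_div_nhds_zero).comp tendsto_natCast_atTop_atTop
  exact this

theorem pow_sub_le_exp {x : ℝ} (hx : x ≤ 1) {n M : ℕ} (hn : 2 * M ≤ n) (hx0 : 0 ≤ x) :
    (1 - x) ^ (n - M) ≤ Real.exp (-(x * (n / 2))) := by
  have h1 : (1 - x) ^ (n - M) ≤ Real.exp (-x) ^ (n - M) :=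
    pow_le_pow_left₀ (sub_nonneg.2 hx) (Real.one_sub_le_exp_neg x) _
  refine h1.trans ?_
  rw [← Real.exp_nat_mul, Real.exp_le_exp, Nat.cast_sub (by omega)]
  have h2 : (2 * M : ℝ) ≤ n := by exact_mod_cast hn
  nlinarith

/-- Above the connectivity threshold the homology vanishes asymptotically almost surely. -/
theorem aas_subsingleton_of_dense {A : Type*} [CommRing A] (hd : 1 ≤ d) (hconv : Convex ℝ K)
    (hbdd : Bornology.IsBounded K) (hint : (interior K).Nonempty) {k : ℕ} (hk : 1 ≤ k)
    {p : ℕ → ℕ → unitInterval} {r : ℕ → ℝ} (hr : ∀ n, 0 ≤ r n)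
    (h1 : (fun n : ℕ => (Real.log n / n) ^ (1 / (d : ℝ))) =o[atTop] r)
    (h2 : ∀ i ∈ Finset.Icc 1 (k + 1), ∃ c : ℝ, 0 < c ∧ ∀ᶠ n in atTop, c ≤ (p n i : ℝ)) :
    AAS K r p (fun _ X => Subsingleton (Homology A X k)) := by
  have := isProbabilityMeasure_cond hbdd hint
  obtain ⟨C₁, hC₁, hnet⟩ := exists_net hbdd
  obtain ⟨c₁, hc₁, hball⟩ := exists_le_cond_closedBall hconv hbdd hint
  -- a uniform lower bound for the retention probabilities
  obtain ⟨c, hc0, hc1, hc⟩ : ∃ c : ℝ, 0 < c ∧ c ≤ 1 ∧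
      ∀ᶠ n in atTop, ∀ i ∈ Finset.Icc 1 (k + 1), c ≤ (p n i : ℝ) := by
    choose! b hb0 hb using h2
    obtain ⟨i₀, hi₀, hmin⟩ := Finset.exists_min_image (Finset.Icc 1 (k + 1)) b ⟨1, by simp⟩
    refine ⟨min (b i₀) 1, lt_min (hb0 i₀ hi₀) one_pos, min_le_right _ _, ?_⟩
    rw [Filter.eventually_all_finset]
    intro i hi
    filter_upwards [hb i hi] with n hn
    exact (min_le_left _ _).trans ((hmin i hi).trans hn)
  set M := (k + 1) + 2 ^ (k + 1) with hM
  set π := c ^ 2 ^ M with hπ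
  have hπ0 : 0 < π := by positivity
  have hπ1 : π ≤ 1 := pow_le_one₀ hc0.le hc1
  -- With this value `2 κ r` is exactly the admissible error `r / (4 (k + 1))`.
  set κ : ℝ := (1 / (8 * (k + 1) : ℝ)) with hκ
  have hκ0 : 0 < κ := by positivity
  have hκ1 : κ ≤ 1 := by
    rw [hκ, div_le_one (by positivity)]
    have : (0 : ℝ) ≤ k := by positivity
    linarith
  -- the exponent in the failure probability
  set γ := c₁ * κ ^ d * π / 2 with hγ
  have hγ0 : 0 < γ := by positivity
  -- Makes the failure probability at most `n ^ (-(M + 2))`; against `n ^ M` vertex choices and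
  -- `O(n)` net points this leaves `O(1 / n)`.
  set a : ℝ := max 1 ((M + 2) / γ) with ha
  have ha1 : 1 ≤ a := le_max_left _ _
  have haγ : (M + 2 : ℝ) ≤ a * γ := by
    rw [← div_le_iff₀ hγ0]; exact le_max_right _ _
  have hlim : Tendsto (fun n : ℕ => C₁ / κ ^ d * (1 / (n : ℝ))) atTop (𝓝 0) := by
    simpa using tendsto_one_div_atTop_nhds_zero_nat.const_mul (C₁ / κ ^ d)
  refine aas_of_tendsto hlim ?_
  have hsmall : ∀ᶠ n : ℕ in atTop, a * (Real.log n / n) ≤ 1 := by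
    have h3 : Tendsto (fun n : ℕ => a * (Real.log n / n)) atTop (𝓝 0) := by
      simpa using tendsto_log_div_nat.const_mul a
    exact h3.eventually_le_const one_pos
  filter_upwards [log_div_le_of_isLittleO hd hr h1 ha1, hsmall, hc, eventually_ge_atTop (2 * M),
    eventually_ge_atTop 3] with n hn1 hn2 hcn hnM hn3
  have hn0 : (0 : ℝ) < n := by positivity
  have hlog1 : 1 ≤ Real.log n := by
    rw [Real.le_log_iff_exp_le hn0]
    exact (Real.exp_one_lt_three.le).trans (by exact_mod_cast hn3)
  -- The net and ball estimates hold for radii at most `1`; truncation preserves the lower bound on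
  -- `s ^ d`, since `a log n / n` is eventually at most `1`.
  set s := min (r n) 1 with hs
  have hrpos : 0 < r n := by
    refine (hr n).lt_of_ne fun h => ?_
    rw [← h, zero_pow (by omega)] at hn1
    have : 0 < a * (Real.log n / n) := by positivity
    linarith
  have hs0 : 0 < s := lt_min hrpos one_pos
  have hsd : a * (Real.log n / n) ≤ s ^ d := by
    rcases min_cases (r n) 1 with ⟨h, -⟩ | ⟨h, -⟩
    · rw [hs, h]; exact hn1
    · rw [hs, h, one_pow]; exact hn2
  have hδ0 : 0 < κ * s := by positivity
  have hδ1 : κ * s ≤ 1 := mul_le_one₀ hκ1 hs0.le (min_le_right _ _)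
  obtain ⟨T, hTK, -, hcov, hcard⟩ := hnet (κ * s) hδ0 hδ1
  have hδr : 2 * (κ * s) ≤ r n / (4 * (k + 1)) := by
    have h4 : s ≤ r n := min_le_left _ _
    have h5 : r n / (4 * (k + 1)) = 2 * (κ * r n) := by rw [hκ]; field_simp; norm_num
    rw [h5]
    gcongr
  have hfail : ∀ f : Fin M ↪ Fin n, (law K (p n) n).real (⋃ w ∈ T,
      failEvent (Metric.closedBall w (κ * s)) (Finset.univ.map f) (k + 1)) ≤
      T.card * Real.exp (-(γ * (s ^ d * n))) := by
    intro f
    have hfc : (Finset.univ.map f).card = M := by simp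
    refine (measureReal_biUnion_finset_le _ _).trans ?_
    rw [← nsmul_eq_mul]
    refine Finset.sum_le_card_nsmul _ _ _ fun w hw => ?_
    refine (law_real_failEvent_le Metric.isClosed_closedBall.measurableSet _ hc0.le hc1 hcn).trans ?_
    rw [hfc, ← hπ]
    set b := (volume[|K] : Measure _).real (Metric.closedBall w (κ * s)) with hb
    have hb1 : b * π ≤ 1 := mul_le_one₀ measureReal_le_one hπ0.le hπ1
    refine (pow_sub_le_exp hb1 hnM (mul_nonneg measureReal_nonneg hπ0.le)).trans ?_
    rw [Real.exp_le_exp, neg_le_neg_iff]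
    have h6 := hball w (hTK hw) (κ * s) hδ0 hδ1
    calc γ * (s ^ d * n) = c₁ * (κ * s) ^ d * π * (n / 2) := by rw [hγ, mul_pow]; ring
      _ ≤ b * π * (n / 2) := by gcongr
  have hexp : Real.exp (-(γ * (s ^ d * n))) ≤ 1 / (n : ℝ) ^ (M + 2) := by
    rw [one_div, Real.exp_neg]
    refine inv_anti₀ (by positivity) ?_
    calc (n : ℝ) ^ (M + 2) = Real.exp ((M + 2 : ℕ) * Real.log n) := by
          rw [Real.exp_nat_mul, Real.exp_log hn0]
      _ ≤ Real.exp (γ * (s ^ d * n)) := by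
          rw [Real.exp_le_exp]
          have h7 : a * Real.log n ≤ s ^ d * n := by
            rw [← mul_div_assoc, div_le_iff₀ hn0] at hsd
            exact hsd
          push_cast
          calc ((M : ℝ) + 2) * Real.log n ≤ a * γ * Real.log n := by gcongr
            _ = γ * (a * Real.log n) := by ring
            _ ≤ γ * (s ^ d * n) := by gcongr
  -- The net has `O(s ^ (-d))` points, and `s ^ d * n ≥ 1`.
  have hTn : (T.card : ℝ) ≤ C₁ / κ ^ d * n := by
    have h8 : 1 ≤ s ^ d * n := by
      rw [← mul_div_assoc, div_le_iff₀ hn0] at hsd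
      nlinarith
    calc (T.card : ℝ) ≤ T.card * (s ^ d * n) := le_mul_of_one_le_right (Nat.cast_nonneg _) h8
      _ = T.card * (κ * s) ^ d / κ ^ d * n := by rw [mul_pow]; field_simp
      _ ≤ C₁ / κ ^ d * n := by gcongr
  calc (law K (p n) n).real {ω | ¬ Subsingleton (Homology A (softRips (r n) ω.1 ω.2) k)}
      ≤ (law K (p n) n).real {ω | ∃ i, ω.1 i ∉ K} +
        (law K (p n) n).real (⋃ f : Fin M ↪ Fin n, ⋃ w ∈ T,
          failEvent (Metric.closedBall w (κ * s)) (Finset.univ.map f) (k + 1)) :=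
        (measureReal_mono (not_subsingleton_homology_subset_failEvent hconv
          (hint.mono interior_subset) hrpos hk hM (by omega) hδr hcov)
          (measure_ne_top _ _)).trans (measureReal_union_le _ _)
    _ ≤ 0 + (n : ℝ) ^ M * (T.card * Real.exp (-(γ * (s ^ d * n)))) := by
        rw [law_real_exists_notMem hconv]
        have := measureReal_iUnion_embedding_le (law K (p n) n) (ι := Fin M) (n := n)
          (by positivity) hfail
        rw [Fintype.card_fin] at this
        gcongr
    _ ≤ (n : ℝ) ^ M * (C₁ / κ ^ d * n * (1 / (n : ℝ) ^ (M + 2))) := by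
        rw [zero_add]
        gcongr
    _ = C₁ / κ ^ d * (1 / (n : ℝ)) := by
        field_simp
        ring

end DenseLimit

/-! ### The cross-polytope cycle -/

section Certificate

variable {V : Type u} [LinearOrder V] {A : Type w} [CommRing A]

theorem cone_mem_supported (x : V) (c : Finset V →₀ A) :
    cone A x c ∈ Finsupp.supported A A {t | ∃ s ∈ c.support, x ∉ s ∧ t = insert x s} := by
  refine linearCombination_mem _ fun s hs => ?_
  split_ifs with h
  · exact zero_mem _
  · exact Finsupp.single_mem_supported A _ ⟨s, hs, h, rfl⟩

theorem cone_apply_insert {x : V} {s : Finset V} (hx : x ∉ s) (c : Finset V →₀ A) :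
    cone A x c (insert x s) = c s * (-1) ^ position s x := by
  induction c using Finsupp.induction_linear with
  | zero => simp
  | add f g hf hg => rw [map_add, Finsupp.add_apply, hf, hg, Finsupp.add_apply, add_mul]
  | single t a =>
    by_cases ht : x ∈ t
    · have hts : t ≠ s := fun h => hx (h ▸ ht)
      rw [cone_single_of_mem ht, Finsupp.single_apply, if_neg hts]
      simp
    · rw [cone_single_of_notMem ht, Finsupp.single_apply, Finsupp.single_apply]
      by_cases hts : t = s
      · subst hts; simp
      · rw [if_neg, if_neg hts, zero_mul]
        intro h
        exact hts (by rw [← Finset.erase_insert ht, h, Finset.erase_insert hx])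

theorem cone_apply_of_notMem {x : V} {t : Finset V} (hx : x ∉ t) (c : Finset V →₀ A) :
    cone A x c t = 0 := by
  by_contra h
  obtain ⟨s, -, -, rfl⟩ := (Finsupp.mem_supported A _).1 (cone_mem_supported x c)
    (Finsupp.mem_support_iff.2 h)
  exact hx (Finset.mem_insert_self _ _)

theorem mul_neg_one_pow_ne_zero {a : A} (ha : a ≠ 0) (m : ℕ) : a * (-1) ^ m ≠ 0 := by
  rcases neg_one_pow_eq_or A m with h | h <;> simp [h, ha]

/-- The fundamental cycle of the cross-polytope. -/
theorem exists_crossPolytope_cycle [Nontrivial A] {κ : Type*} [DecidableEq κ]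
    (f : κ × Bool → V) (hf : Function.Injective f) (I : Finset κ) :
    ∃ z : Finset V →₀ A, bd A z = 0 ∧
      (∀ s ∈ z.support, ∃ ε : κ → Bool, s = I.image fun i => f (i, ε i)) ∧
      I.image (fun i => f (i, true)) ∈ z.support := by
  induction I using Finset.induction_on with
  | empty =>
    refine ⟨Finsupp.single ∅ 1, by simp [bd_single], fun s hs => ⟨fun _ => true, ?_⟩, ?_⟩
    · rw [Finset.image_empty]
      by_contra h
      refine (Finsupp.mem_support_iff.1 hs) ?_
      rw [Finsupp.single_apply, if_neg (Ne.symm h)]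
    · rw [Finset.image_empty, Finsupp.mem_support_iff, Finsupp.single_eq_same]
      exact one_ne_zero
  | insert i I hi ih =>
    obtain ⟨z, hz, hsupp, htop⟩ := ih
    have hnot : ∀ (b : Bool) (ε : κ → Bool), f (i, b) ∉ I.image fun j => f (j, ε j) := by
      intro b ε h
      obtain ⟨j, hj, hij⟩ := Finset.mem_image.1 h
      have := hf hij
      rw [Prod.mk.injEq] at this
      exact hi (this.1 ▸ hj)
    have hcone : ∀ b : Bool, cone A (f (i, b)) z ∈ Finsupp.supported A A
        {s | ∃ ε : κ → Bool, s = (insert i I).image fun i => f (i, ε i)} := by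
      intro b
      refine Finsupp.supported_mono ?_ (cone_mem_supported (f (i, b)) z)
      rintro t ⟨s, hs, -, rfl⟩
      obtain ⟨ε, rfl⟩ := hsupp s hs
      refine ⟨Function.update ε i b, ?_⟩
      rw [Finset.image_insert, Function.update_self]
      congr 1
      refine Finset.image_congr fun j hj => ?_
      have hji : j ≠ i := fun h => hi (h ▸ hj)
      simp only [Function.update_of_ne hji]
    -- Suspension: both cones over the cycle have boundary `z`. The all-`true` simplex occurs only
    -- in the first cone, where its coefficient is `±` that of the previous stage, hence nonzero.
    refine ⟨cone A (f (i, true)) z - cone A (f (i, false)) z, ?_, ?_, ?_⟩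
    · have h1 := bd_cone (A := A) (f (i, true)) z
      have h2 := bd_cone (A := A) (f (i, false)) z
      rw [hz, map_zero, add_zero] at h1 h2
      rw [map_sub, h1, h2, sub_self]
    · exact (Finsupp.mem_supported A _).1 (sub_mem (hcone true) (hcone false))
    · rw [Finset.image_insert, Finsupp.mem_support_iff, Finsupp.sub_apply,
        cone_apply_insert (hnot true fun _ => true), cone_apply_of_notMem, sub_zero]
      · exact mul_neg_one_pow_ne_zero (Finsupp.mem_support_iff.1 htop) _
      · intro h
        rcases Finset.mem_insert.1 h with h | h
        · simpa using hf h
        · exact hnot false (fun _ => true) h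

end Certificate

/-! ### Isolated patterns that carry homology -/

section Cells

variable {d n : ℕ}

/-- The event that the points indexed by `f` are arranged around `c` according to the pattern `u`
at scale `r`, that no other point is near `c`, and that the coins of the subsets of the pattern are
allowed. -/
def cellEvent {ι : Type*} [Fintype ι] (u : ι → EuclideanSpace ℝ (Fin d)) (η r : ℝ) (N : ℕ)
    (h : Bool) (c : EuclideanSpace ℝ (Fin d)) (f : ι ↪ Fin n) :
    Set ((Fin n → EuclideanSpace ℝ (Fin d)) × (Finset (Fin n) → Bool)) :=
  {ω | (∀ i, dist (ω.1 (f i)) (c + r • u i) ≤ η * r) ∧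
    (∀ v ∉ Finset.univ.map f, 3 * r < dist (ω.1 v) c) ∧
    ∀ s ⊆ Finset.univ.map f, ω.2 s ∈ allowed N h s.card}

variable {ι : Type*} [Fintype ι] {u : ι → EuclideanSpace ℝ (Fin d)} {η r : ℝ} {N : ℕ} {h : Bool}
  {c : EuclideanSpace ℝ (Fin d)} {f : ι ↪ Fin n}
  {ω : (Fin n → EuclideanSpace ℝ (Fin d)) × (Finset (Fin n) → Bool)}

theorem abs_dist_sub_le_of_cellEvent (hω : ω ∈ cellEvent u η r N h c f) (hr : 0 ≤ r) (i j : ι) :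
    |dist (ω.1 (f i)) (ω.1 (f j)) - r * dist (u i) (u j)| ≤ 2 * (η * r) := by
  have h1 := hω.1 i
  have h2 := hω.1 j
  have h3 : dist (c + r • u i) (c + r • u j) = r * dist (u i) (u j) := by
    rw [dist_add_left, dist_smul₀, Real.norm_of_nonneg hr]
  have h4 := dist_triangle4 (ω.1 (f i)) (c + r • u i) (c + r • u j) (ω.1 (f j))
  have h5 := dist_triangle4 (c + r • u i) (ω.1 (f i)) (ω.1 (f j)) (c + r • u j)
  rw [h3, dist_comm (c + r • u j)] at h4
  rw [h3, dist_comm (c + r • u i)] at h5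
  rw [abs_le]
  constructor <;> linarith

/-- Isolation: pattern points are within `2r` of `c` and all others farther than `3r`, so no outside
vertex is adjacent to the pattern. -/
theorem mem_of_dist_le_of_cellEvent (hω : ω ∈ cellEvent u η r N h c f) (hr : 0 ≤ r)
    (hη : η ≤ 1) (hu : ∀ i, ‖u i‖ ≤ 1) {v : Fin n} {i : ι} (hv : dist (ω.1 (f i)) (ω.1 v) ≤ r) :
    v ∈ Finset.univ.map f := by
  by_contra hvf
  have h1 := hω.2.1 v hvf
  have h2 := hω.1 i
  have h3 : dist (c + r • u i) c ≤ r := by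
    rw [dist_eq_norm, add_sub_cancel_left, norm_smul, Real.norm_of_nonneg hr]
    exact mul_le_of_le_one_right hr (hu i)
  have h4 := dist_triangle4 (ω.1 v) (ω.1 (f i)) (c + r • u i) c
  rw [dist_comm (ω.1 v) (ω.1 (f i))] at h4
  have h5 : η * r ≤ r := mul_le_of_le_one_left hr hη
  linarith

/-- A face of the soft Rips complex that is contained in the pattern. -/
theorem mem_faces_of_cellEvent (hω : ω ∈ cellEvent u η r N h c f) (hr : 0 ≤ r)
    {s : Finset (Fin n)} (hs : s.Nonempty) (hsf : s ⊆ Finset.univ.map f) (hsN : s.card ≤ N)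
    (hd : ∀ i j, i ≠ j → f i ∈ s → f j ∈ s → dist (u i) (u j) ≤ 1 - 2 * η) :
    s ∈ (softRips r ω.1 ω.2).faces := by
  refine ⟨hs, ?_, fun t ht h2 => ?_⟩
  · intro a ha b hb hab
    obtain ⟨i, -, rfl⟩ := Finset.mem_map.1 (hsf ha)
    obtain ⟨j, -, rfl⟩ := Finset.mem_map.1 (hsf hb)
    have h1 := (abs_le.1 (abs_dist_sub_le_of_cellEvent hω hr i j)).2
    have h2 := mul_le_mul_of_nonneg_left (hd i j (fun h => hab (h ▸ rfl)) ha hb) hr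
    show dist (ω.1 (f i)) (ω.1 (f j)) ≤ r
    linarith
  · exact (hω.2.2 t (ht.trans hsf)).1 ⟨h2, (Finset.card_le_card ht).trans hsN⟩

variable {A : Type*} [CommRing A] [Nontrivial A]

theorem not_subsingleton_of_maximal {k : ℕ} {V : Type*} [LinearOrder V]
    {X : AbstractSimplicialComplex V} (hk : 1 ≤ k) {z : Finset V →₀ A}
    (hz : z ∈ chains A X (k + 1)) (hbd : bd A z = 0) {s : Finset V} (hs : s ∈ z.support)
    (hmax : ∀ a ∉ s, insert a s ∉ X.faces) : ¬ Subsingleton (Homology A X k) := by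
  obtain ⟨j, rfl⟩ : ∃ j, k = j + 1 := ⟨k - 1, by omega⟩
  rw [subsingleton_homology_iff]
  intro hsub
  obtain ⟨w, hw, hwz⟩ := hsub z hz hbd
  exact ne_bd_of_maximal hw hs hmax hwz

/-- An isolated hollow simplex carries homology. -/
theorem not_subsingleton_of_hollow {k : ℕ} (hk : 1 ≤ k)
    {u : Fin (k + 2) → EuclideanSpace ℝ (Fin d)} {f : Fin (k + 2) ↪ Fin n}
    (hω : ω ∈ cellEvent u η r (k + 1) true c f) (hr : 0 ≤ r) (hη : η ≤ 1) (hu : ∀ i, ‖u i‖ ≤ 1)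
    (hd : ∀ i j, i ≠ j → dist (u i) (u j) ≤ 1 - 2 * η) :
    ¬ Subsingleton (Homology A (softRips r ω.1 ω.2) k) := by
  set σ := Finset.univ.map f with hσ
  have hσc : σ.card = k + 2 := by simp [hσ]
  have hface : ∀ v ∈ σ, (σ.erase v).card = k + 1 ∧
      σ.erase v ∈ (softRips r ω.1 ω.2).faces := by
    intro v hv
    have hc : (σ.erase v).card = k + 1 := by rw [Finset.card_erase_of_mem hv, hσc]; rfl
    exact ⟨hc, mem_faces_of_cellEvent hω hr (Finset.card_pos.1 (by omega))
      (Finset.erase_subset _ _) hc.le fun i j hij _ _ => hd i j hij⟩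
  have h0 : f 0 ∈ σ := by simp [hσ]
  have hs : σ.erase (f 0) ∈ (bd A (Finsupp.single σ 1)).support := by
    rw [Finsupp.mem_support_iff, bd_single_apply_erase h0]
    exact mul_neg_one_pow_ne_zero one_ne_zero _
  -- The cycle is the boundary of `σ`, formed among all finite sets since `σ` itself is not a face.
  refine not_subsingleton_of_maximal hk ?_ (bd_bd _) hs ?_
  · rw [bd_single]
    refine sum_mem fun v hv => Finsupp.single_mem_supported A _ ⟨(hface v hv).2, (hface v hv).1⟩
  · intro a ha haX
    -- By isolation only `f 0` could extend this facet, and that would give `σ`, whose coin is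
    -- `false`.
    have h1 : f 1 ∈ σ.erase (f 0) := by simp [hσ]
    have hne : f 1 ≠ a := fun h => ha (h ▸ h1)
    have haσ : a ∈ σ := mem_of_dist_le_of_cellEvent hω hr hη hu
      (haX.2.1 (Finset.mem_insert_of_mem h1) (Finset.mem_insert_self _ _) hne)
    have ha0 : a = f 0 := by
      by_contra h
      exact ha (Finset.mem_erase.2 ⟨h, haσ⟩)
    rw [ha0, Finset.insert_erase h0] at haX
    have hf := (hω.2.2 σ subset_rfl).2 ⟨rfl, hσc⟩
    rw [haX.2.2 σ subset_rfl (by omega)] at hf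
    exact absurd hf (by simp)

/-- An isolated cross-polytope carries homology. -/
theorem not_subsingleton_of_crossPolytope {k : ℕ} (hk : 1 ≤ k)
    {u : Fin (k + 1) × Bool → EuclideanSpace ℝ (Fin d)} {f : Fin (k + 1) × Bool ↪ Fin n}
    (hω : ω ∈ cellEvent u η r (k + 1) false c f) (hr : 0 < r) (hη : η ≤ 1) (hu : ∀ i, ‖u i‖ ≤ 1)
    (hd : ∀ i j : Fin (k + 1) × Bool, i.1 ≠ j.1 → dist (u i) (u j) ≤ 1 - 2 * η)
    (hd' : ∀ i, 1 + 2 * η < dist (u (i, true)) (u (i, false))) :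
    ¬ Subsingleton (Homology A (softRips r ω.1 ω.2) k) := by
  obtain ⟨z, hbd, hsupp, htop⟩ := exists_crossPolytope_cycle (A := A) f f.injective Finset.univ
  refine not_subsingleton_of_maximal hk ((Finsupp.mem_supported A z).2 fun s hs => ?_) hbd htop ?_
  · obtain ⟨ε, rfl⟩ := hsupp s hs
    have hc : (Finset.univ.image fun i => f (i, ε i)).card = k + 1 := by
      rw [Finset.card_image_of_injective _ fun i j hij => congrArg Prod.fst (f.injective hij),
        Finset.card_univ, Fintype.card_fin]
    refine ⟨mem_faces_of_cellEvent hω hr.le (Finset.card_pos.1 (by omega)) ?_ hc.le ?_, hc⟩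
    · intro v hv
      obtain ⟨i, -, rfl⟩ := Finset.mem_image.1 hv
      simp
    · intro i j hij hi hj
      refine hd i j fun h => hij ?_
      obtain ⟨i', -, hi'⟩ := Finset.mem_image.1 hi
      obtain ⟨j', -, hj'⟩ := Finset.mem_image.1 hj
      rw [← f.injective hi', ← f.injective hj'] at h ⊢
      simp only at h
      rw [h]
  · intro a ha haX
    set s := Finset.univ.image fun i => f (i, true) with hs
    have hadj : ∀ i, dist (ω.1 (f (i, true))) (ω.1 a) ≤ r := by
      intro i
      have h1 : f (i, true) ∈ s := Finset.mem_image_of_mem _ (Finset.mem_univ i)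
      exact haX.2.1 (Finset.mem_insert_of_mem h1) (Finset.mem_insert_self _ _)
        fun h => ha (h ▸ h1)
    -- An extending vertex belongs to the pattern, so it is the antipode of a vertex of `s`, which
    -- is farther than `r` away. The coins of larger sets play no role.
    obtain ⟨⟨i, b⟩, -, rfl⟩ := Finset.mem_map.1
      (mem_of_dist_le_of_cellEvent hω hr.le hη hu (hadj 0))
    rcases b with _ | _
    · have h1 := (abs_le.1 (abs_dist_sub_le_of_cellEvent hω hr.le (i, true) (i, false))).1
      have h2 := hadj i
      have h3 := mul_lt_mul_of_pos_left (hd' i) hr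
      linarith
    · exact ha (Finset.mem_image_of_mem _ (Finset.mem_univ i))

/-- Two arrangements in the same cell coincide. -/
theorem eq_of_mem_cellEvent {f' : ι ↪ Fin n} (hω : ω ∈ cellEvent u η r N h c f)
    (hω' : ω ∈ cellEvent u η r N h c f') (hr : 0 < r) (hη : η ≤ 1 / 2) (hu : ∀ i, ‖u i‖ ≤ 1)
    (hsep : ∀ i j, i ≠ j → 2 * η < dist (u i) (u j)) : f = f' := by
  ext1 i
  have h1 := hω.1 i
  have h0 : dist (ω.1 (f' i)) (ω.1 (f i)) ≤ r := by
    have h2 := hω'.1 i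
    have h3 := dist_triangle_right (ω.1 (f' i)) (ω.1 (f i)) (c + r • u i)
    have h4 : η * r ≤ 1 / 2 * r := mul_le_mul_of_nonneg_right hη hr.le
    linarith
  obtain ⟨j, -, hj⟩ := Finset.mem_map.1
    (mem_of_dist_le_of_cellEvent hω' hr.le (by linarith) hu h0)
  by_cases hij : j = i
  · rw [← hj, hij]
  -- Otherwise one vertex would be within `η r` of the targets of both `u i` and `u j`, which are
  -- more than `2 η r` apart.
  · have h2 := hω'.1 j
    rw [hj] at h2
    have h3 : dist (c + r • u j) (c + r • u i) = r * dist (u j) (u i) := by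
      rw [dist_add_left, dist_smul₀, Real.norm_of_nonneg hr.le]
    have h4 := dist_triangle_left (c + r • u j) (c + r • u i) (ω.1 (f i))
    have h5 := mul_lt_mul_of_pos_left (hsep j i hij) hr
    linarith

end Cells

/-! ### Explicit point patterns -/

section Configurations

variable {d : ℕ}

/-- Points in general position inside a small ball. -/
theorem exists_hollow_pattern (hd : 1 ≤ d) (m : ℕ) :
    ∃ (u : Fin m → EuclideanSpace ℝ (Fin d)) (η : ℝ), 0 < η ∧ η ≤ 1 / 2 ∧ (∀ i, ‖u i‖ ≤ 1) ∧
      (∀ i j, i ≠ j → 2 * η < dist (u i) (u j)) ∧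
      ∀ i j, i ≠ j → dist (u i) (u j) ≤ 1 - 2 * η := by
  set e : EuclideanSpace ℝ (Fin d) := EuclideanSpace.single ⟨0, hd⟩ 1 with he
  have he1 : ‖e‖ = 1 := by simp [he]
  have hm : (0 : ℝ) < m + 1 := by positivity
  -- The points form a collinear row with spacing `t`, of total length below `1 / 2`.
  set t : ℝ := 1 / (2 * (m + 1)) with ht
  have ht0 : 0 < t := by positivity
  have htm : t * (m + 1) = 1 / 2 := by rw [ht]; field_simp
  have ht2 : t ≤ 1 / 2 := by
    rw [← htm]
    exact le_mul_of_one_le_right ht0.le (by linarith [(Nat.cast_nonneg m : (0 : ℝ) ≤ m)])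
  have hdist : ∀ i j : Fin m, dist ((t * (i : ℝ)) • e) ((t * (j : ℝ)) • e) =
      t * |(i : ℝ) - j| := by
    intro i j
    rw [dist_eq_norm, ← sub_smul, norm_smul, he1, mul_one, ← mul_sub, Real.norm_eq_abs, abs_mul,
      abs_of_pos ht0]
  have hlt : ∀ i : Fin m, (i : ℝ) ≤ m := fun i => by exact_mod_cast i.2.le
  refine ⟨fun i => (t * (i : ℝ)) • e, t / 4, by positivity, by linarith, fun i => ?_,
    fun i j hij => ?_, fun i j _ => ?_⟩
  · rw [norm_smul, he1, mul_one, Real.norm_of_nonneg (by positivity)]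
    have := mul_le_mul_of_nonneg_left (hlt i) ht0.le
    linarith
  · rw [hdist]
    have h1 : (1 : ℝ) ≤ |(i : ℝ) - j| := by
      have h2 : ((i : ℕ) : ℤ) - (j : ℕ) ≠ 0 := fun h => hij (Fin.ext (by omega))
      exact_mod_cast Int.one_le_abs h2
    have := mul_le_mul_of_nonneg_left h1 ht0.le
    linarith
  · rw [hdist]
    have h1 : |(i : ℝ) - j| ≤ m := by
      have h3 := hlt i
      have h4 := hlt j
      have h5 : (0 : ℝ) ≤ (i : ℕ) := Nat.cast_nonneg _
      have h6 : (0 : ℝ) ≤ (j : ℕ) := Nat.cast_nonneg _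
      rw [abs_le]
      constructor <;> linarith
    have := mul_le_mul_of_nonneg_left h1 ht0.le
    linarith

/-- Finitely many pairs of opposite unit vectors in dimension at least two. -/
theorem exists_antipodal (hd : 2 ≤ d) (κ : ℕ) :
    ∃ W : Fin κ × Bool → EuclideanSpace ℝ (Fin d), (∀ i, ‖W i‖ = 1) ∧
      (∀ i b, W (i, !b) = -W (i, b)) ∧ ∀ i j, i.1 ≠ j.1 → W i ≠ W j := by
  -- The directions `(1, i)` are pairwise non-parallel: a signed multiple of `v i` is determined up
  -- to its factor by the first coordinate, and the second then yields `i`. This needs two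
  -- dimensions.
  set v : Fin κ → EuclideanSpace ℝ (Fin d) := fun i =>
    EuclideanSpace.single ⟨0, by omega⟩ 1 + EuclideanSpace.single ⟨1, by omega⟩ (i : ℝ) with hv
  have hv0 : ∀ i, v i ⟨0, by omega⟩ = 1 := fun i => by simp [hv]
  have hv1 : ∀ i, v i ⟨1, by omega⟩ = (i : ℝ) := fun i => by simp [hv]
  have hne : ∀ i, v i ≠ 0 := fun i h => by
    have := hv0 i
    rw [h] at this
    simp at this
  set sg : Bool → ℝ := fun b => if b then 1 else -1 with hsg
  have hsg1 : ∀ b, |sg b| = 1 := by intro b; cases b <;> simp [hsg]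
  refine ⟨fun i => (sg i.2 * ‖v i.1‖⁻¹) • v i.1, fun i => ?_, fun i b => ?_, fun i j hij h => ?_⟩
  · rw [norm_smul, Real.norm_eq_abs, abs_mul, hsg1, one_mul, abs_inv, abs_norm,
      inv_mul_cancel₀ (norm_ne_zero_iff.2 (hne _))]
  · cases b <;> simp [hsg]
  · have h0 := congrArg (fun x : EuclideanSpace ℝ (Fin d) => x ⟨0, by omega⟩) h
    have h1 := congrArg (fun x : EuclideanSpace ℝ (Fin d) => x ⟨1, by omega⟩) h
    simp only [PiLp.smul_apply, hv0, hv1, smul_eq_mul, mul_one] at h0 h1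
    rw [h0] at h1
    have hnz : sg j.2 * ‖v j.1‖⁻¹ ≠ 0 := by
      refine mul_ne_zero (fun h => ?_) (inv_ne_zero (norm_ne_zero_iff.2 (hne _)))
      have := hsg1 j.2
      rw [h] at this
      simp at this
    have h2 := mul_left_cancel₀ hnz h1
    exact hij (Fin.ext (by exact_mod_cast h2))

/-- The vertices of a cross-polytope whose diagonals are longer than its edges. -/
theorem exists_crossPolytope_pattern (hd : 2 ≤ d) (κ : ℕ) :
    ∃ (u : Fin κ × Bool → EuclideanSpace ℝ (Fin d)) (η : ℝ), 0 < η ∧ η ≤ 1 / 2 ∧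
      (∀ i, ‖u i‖ ≤ 1) ∧ (∀ i j, i ≠ j → 2 * η < dist (u i) (u j)) ∧
      (∀ i j : Fin κ × Bool, i.1 ≠ j.1 → dist (u i) (u j) ≤ 1 - 2 * η) ∧
      ∀ i, 1 + 2 * η < dist (u (i, true)) (u (i, false)) := by
  obtain ⟨W, hW1, hWneg, hWne⟩ := exists_antipodal hd κ
  have hpos : ∀ i j : Fin κ × Bool, i.1 ≠ j.1 → 0 < dist (W i) (W j) :=
    fun i j hij => dist_pos.2 (hWne i j hij)
  have hlt : ∀ i j : Fin κ × Bool, i.1 ≠ j.1 → dist (W i) (W j) < 2 := by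
    rintro i ⟨j, b⟩ hij
    have h1 : W i ≠ W (j, !b) := hWne i (j, !b) hij
    -- Strict convexity: the midpoint of the distinct unit vectors `W i` and `-W j` has norm below
    -- `1`, so `W i` and `W j` are closer than `2`.
    have h2 := (norm_midpoint_lt_iff ((hW1 i).trans (hW1 (j, !b)).symm)).2 h1
    rw [hWneg, norm_smul, hW1, ← sub_eq_add_neg, ← dist_eq_norm] at h2
    norm_num at h2
    linarith
  obtain ⟨τ, hτ0, hτ1, hτ⟩ : ∃ τ : ℝ, 0 < τ ∧ τ < 1 ∧ ∀ i j : Fin κ × Bool, i.1 ≠ j.1 →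
      τ ≤ dist (W i) (W j) ∧ dist (W i) (W j) ≤ 2 - τ := by
    have h1 : ∀ᶠ τ : ℝ in 𝓝[>] 0, ∀ i j : Fin κ × Bool, i.1 ≠ j.1 →
        τ ≤ dist (W i) (W j) ∧ dist (W i) (W j) ≤ 2 - τ := by
      rw [eventually_all]
      intro i
      rw [eventually_all]
      intro j
      by_cases hij : i.1 = j.1
      · exact Eventually.of_forall fun _ h => absurd hij h
      · filter_upwards [Ioo_mem_nhdsGT (hpos i j hij),
          Ioo_mem_nhdsGT (sub_pos.2 (hlt i j hij))] with τ h2 h3 _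
        exact ⟨h2.2.le, by linarith [h3.2]⟩
    obtain ⟨τ, h2, h3⟩ := (h1.and (Ioo_mem_nhdsGT (one_pos (α := ℝ)))).exists
    exact ⟨τ, h3.1, h3.2, h2⟩
  -- Diagonals become `1 + τ / 4`, edges at most `1 - τ / 4`; both clear the margin `2η = τ / 8`.
  set ρ : ℝ := 1 / 2 + τ / 8 with hρ
  have hρ0 : 0 < ρ := by positivity
  have hdist : ∀ i j, dist (ρ • W i) (ρ • W j) = ρ * dist (W i) (W j) := fun i j => by
    rw [dist_smul₀, Real.norm_of_nonneg hρ0.le]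
  have hdiam : ∀ i b, dist (W (i, b)) (W (i, !b)) = 2 := by
    intro i b
    rw [hWneg, dist_eq_norm, sub_neg_eq_add, ← two_smul ℝ, norm_smul, hW1]
    norm_num
  refine ⟨fun i => ρ • W i, τ / 16, by positivity, by linarith, fun i => ?_, fun i j hij => ?_,
    fun i j hij => ?_, fun i => ?_⟩
  · rw [norm_smul, hW1, Real.norm_of_nonneg hρ0.le]
    linarith
  · rw [hdist]
    by_cases hij1 : i.1 = j.1
    · have : j = (i.1, !i.2) := by
        refine Prod.ext hij1.symm ?_
        by_contra h
        refine hij (Prod.ext hij1 ?_)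
        revert h
        cases i.2 <;> cases j.2 <;> simp
      rw [this, hdiam i.1 i.2]
      linarith
    · have h1 := mul_le_mul_of_nonneg_left (hτ i j hij1).1 hρ0.le
      nlinarith
  · rw [hdist]
    have h1 := mul_le_mul_of_nonneg_left (hτ i j hij).2 hρ0.le
    nlinarith
  · have h2 : dist (W (i, true)) (W (i, false)) = 2 := hdiam i true
    rw [hdist, h2]
    linarith

end Configurations

/-! ### Chebyshev's inequality for nearly independent events -/

section SecondMoment

/-- If the events `E i` are nearly pairwise independent, then the probability that none of them
occurs is small as soon as the sum of their probabilities is large. -/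
theorem measureReal_forall_notMem_le {Ω I : Type*} [MeasurableSpace Ω] [Fintype I]
    (μ : Measure Ω) [IsProbabilityMeasure μ] {E : I → Set Ω} (hE : ∀ i, MeasurableSet (E i))
    {θ : ℝ} (hθ : 0 ≤ θ)
    (hpair : ∀ i j, i ≠ j → μ.real (E i ∩ E j) ≤ θ * (μ.real (E i) * μ.real (E j)))
    (hpos : 0 < ∑ i, μ.real (E i)) :
    μ.real {ω | ∀ i, ω ∉ E i} ≤ 1 / (∑ i, μ.real (E i)) + (θ - 1) := by
  classical
  set S := ∑ i, μ.real (E i) with hS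
  set X : Ω → ℝ := fun ω => ∑ i, (E i).indicator 1 ω with hX
  have hint : ∀ s : Set Ω, MeasurableSet s → Integrable (s.indicator (1 : Ω → ℝ)) μ :=
    fun s hs => (integrable_const (1 : ℝ)).indicator hs
  have hXint : Integrable X μ := integrable_finsetSum _ fun i _ => hint _ (hE i)
  have hX2 : (fun ω => X ω ^ 2) = fun ω => ∑ i, ∑ j, (E i ∩ E j).indicator 1 ω := by
    funext ω
    rw [hX, sq, Finset.sum_mul_sum]
    refine Finset.sum_congr rfl fun i _ => Finset.sum_congr rfl fun j _ => ?_
    by_cases hi : ω ∈ E i <;> by_cases hj : ω ∈ E j <;> simp [Set.indicator, hi, hj]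
  have hX2int : Integrable (fun ω => X ω ^ 2) μ := by
    rw [hX2]
    exact integrable_finsetSum _ fun i _ => integrable_finsetSum _ fun j _ =>
      hint _ ((hE i).inter (hE j))
  have hEX : ∫ ω, X ω ∂μ = S := by
    rw [hX, integral_finsetSum _ fun i _ => hint _ (hE i)]
    exact Finset.sum_congr rfl fun i _ => integral_indicator_one (hE i)
  -- The diagonal pairs contribute `S`, the others at most `θ * S ^ 2`.
  have hEX2 : ∫ ω, X ω ^ 2 ∂μ ≤ S + θ * S ^ 2 := by
    rw [hX2, integral_finsetSum _ fun i _ => integrable_finsetSum _ fun j _ =>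
      hint _ ((hE i).inter (hE j))]
    have h1 : ∀ i, ∫ ω, ∑ j, (E i ∩ E j).indicator (1 : Ω → ℝ) ω ∂μ ≤
        μ.real (E i) + θ * (μ.real (E i) * S) := by
      intro i
      rw [integral_finsetSum _ fun j _ => hint _ ((hE i).inter (hE j)),
        Finset.sum_congr rfl fun j _ => integral_indicator_one ((hE i).inter (hE j)),
        ← Finset.add_sum_erase _ _ (Finset.mem_univ i), Set.inter_self]
      gcongr
      calc ∑ j ∈ Finset.univ.erase i, μ.real (E i ∩ E j)
          ≤ ∑ j ∈ Finset.univ.erase i, θ * (μ.real (E i) * μ.real (E j)) :=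
            Finset.sum_le_sum fun j hj => hpair i j (Finset.ne_of_mem_erase hj).symm
        _ ≤ ∑ j, θ * (μ.real (E i) * μ.real (E j)) :=
            Finset.sum_le_sum_of_subset_of_nonneg (Finset.erase_subset _ _) fun _ _ _ => by
              positivity
        _ = θ * (μ.real (E i) * S) := by rw [hS, Finset.mul_sum, Finset.mul_sum]
    refine (Finset.sum_le_sum fun i _ => h1 i).trans (le_of_eq ?_)
    rw [Finset.sum_add_distrib, ← Finset.mul_sum, ← Finset.sum_mul, ← hS]
    ring
  have hvar : ∫ ω, (X ω - S) ^ 2 ∂μ ≤ S + (θ - 1) * S ^ 2 := by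
    have h1 : (fun ω => (X ω - S) ^ 2) = fun ω => X ω ^ 2 - 2 * S * X ω + S ^ 2 := by
      funext ω; ring
    have h2 : ∫ ω, (X ω ^ 2 - 2 * S * X ω + S ^ 2) ∂μ =
        (∫ ω, X ω ^ 2 ∂μ - 2 * S * ∫ ω, X ω ∂μ) + S ^ 2 := by
      have h3 := integral_add (μ := μ) (f := fun ω => X ω ^ 2 - 2 * S * X ω)
        (g := fun _ => S ^ 2) (hX2int.sub (hXint.const_mul _)) (integrable_const _)
      rw [h3, integral_sub hX2int (hXint.const_mul _), integral_const_mul, integral_const,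
        probReal_univ, one_smul]
    rw [h1, h2, hEX]
    linarith
  have hN : MeasurableSet {ω | ∀ i, ω ∉ E i} := by
    rw [show {ω | ∀ i, ω ∉ E i} = ⋂ i, (E i)ᶜ by ext; simp]
    exact MeasurableSet.iInter fun i => (hE i).compl
  -- Where no event occurs, `(X - S) ^ 2 = S ^ 2`.
  have hle : S ^ 2 * μ.real {ω | ∀ i, ω ∉ E i} ≤ ∫ ω, (X ω - S) ^ 2 ∂μ := by
    rw [← integral_indicator_one hN, ← integral_const_mul]
    refine integral_mono ((hint _ hN).const_mul _) ?_ fun ω => ?_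
    · have h1 : (fun ω => (X ω - S) ^ 2) = fun ω => X ω ^ 2 - 2 * S * X ω + S ^ 2 := by
        funext ω; ring
      rw [h1]
      exact (hX2int.sub (hXint.const_mul _)).add (integrable_const _)
    · by_cases hω : ω ∈ {ω | ∀ i, ω ∉ E i}
      · have h2 : X ω = 0 := Finset.sum_eq_zero fun i _ => Set.indicator_of_notMem (hω i) _
        simp only [Set.indicator_of_mem hω, h2, Pi.one_apply]
        linarith
      · simp only [Set.indicator_of_notMem hω, mul_zero]
        positivity
  have h3 := hle.trans hvar
  rw [mul_comm, ← le_div_iff₀ (by positivity)] at h3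
  refine h3.trans (le_of_eq ?_)
  field_simp

end SecondMoment

/-! ### Probabilities of one and of two isolated patterns -/

section CellProbability

variable {d n : ℕ} {K : Set (EuclideanSpace ℝ (Fin d))}

/-- The constraint on the position of the vertex `v` in a cell event. -/
def cellSet {ι : Type*} [Fintype ι] (u : ι → EuclideanSpace ℝ (Fin d)) (η r : ℝ)
    (c : EuclideanSpace ℝ (Fin d)) (f : ι ↪ Fin n) (v : Fin n) : Set (EuclideanSpace ℝ (Fin d)) :=
  {y | (∀ i, f i = v → dist y (c + r • u i) ≤ η * r) ∧
    (v ∉ Finset.univ.map f → 3 * r < dist y c)}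

variable {ι : Type*} [Fintype ι] {u : ι → EuclideanSpace ℝ (Fin d)} {η r : ℝ} {N : ℕ} {h : Bool}
  {c c' : EuclideanSpace ℝ (Fin d)} {f f' : ι ↪ Fin n}

theorem cellSet_apply (i : ι) :
    cellSet u η r c f (f i) = Metric.closedBall (c + r • u i) (η * r) := by
  ext y
  simp only [cellSet, Set.mem_ofPred_eq, Metric.mem_closedBall]
  constructor
  · exact fun h => h.1 i rfl
  · intro h
    refine ⟨fun j hj => f.injective hj ▸ h, fun hn => absurd ?_ hn⟩
    exact Finset.mem_map_of_mem _ (Finset.mem_univ i)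

theorem cellSet_of_notMem {v : Fin n} (hv : v ∉ Finset.univ.map f) :
    cellSet u η r c f v = (Metric.closedBall c (3 * r))ᶜ := by
  ext y
  simp only [cellSet, Set.mem_ofPred_eq, Set.mem_compl_iff, Metric.mem_closedBall, not_le]
  constructor
  · exact fun h => h.2 hv
  · intro h
    exact ⟨fun i hi => absurd (hi ▸ Finset.mem_map_of_mem _ (Finset.mem_univ i)) hv, fun _ => h⟩

theorem measurableSet_cellSet (v : Fin n) : MeasurableSet (cellSet u η r c f v) := by
  by_cases hv : v ∈ Finset.univ.map f
  · obtain ⟨i, -, rfl⟩ := Finset.mem_map.1 hv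
    rw [cellSet_apply]
    exact Metric.isClosed_closedBall.measurableSet
  · rw [cellSet_of_notMem hv]
    exact Metric.isClosed_closedBall.measurableSet.compl

theorem cellEvent_eq_box : cellEvent u η r N h c f = box (cellSet u η r c f)
    fun s => if s ⊆ Finset.univ.map f then allowed N h s.card else Set.univ := by
  ext ω
  constructor
  · rintro ⟨h1, h2, h3⟩
    refine ⟨fun v => ⟨fun i hi => hi ▸ h1 i, h2 v⟩, fun s => ?_⟩
    dsimp only
    split_ifs with hs
    · exact h3 s hs
    · trivial
  · rintro ⟨h1, h2⟩
    refine ⟨fun i => (h1 (f i)).1 i rfl, fun v => (h1 v).2, fun s hs => ?_⟩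
    have := h2 s
    dsimp only at this
    rwa [if_pos hs] at this

theorem measurableSet_cellEvent : MeasurableSet (cellEvent u η r N h c f) := by
  rw [cellEvent_eq_box]
  have : box (cellSet u η r c f)
      (fun s => if s ⊆ Finset.univ.map f then allowed N h s.card else Set.univ) =
      (Set.univ.pi (cellSet u η r c f)) ×ˢ
      {x | ∀ s, x s ∈ if s ⊆ Finset.univ.map f then allowed N h s.card else Set.univ} := by
    ext ω
    simp [box]
  rw [this]
  exact (MeasurableSet.univ_pi fun v => measurableSet_cellSet v).prod MeasurableSet.of_discrete

theorem cond_real_closedBall {y : EuclideanSpace ℝ (Fin d)} {s : ℝ} (hs : 0 < s)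
    (hK : Metric.closedBall y s ⊆ K) : (volume[|K] : Measure _).real (Metric.closedBall y s) =
      s ^ d * (unitVol d / volume.real K) := by
  rw [cond_real_eq Metric.isClosed_closedBall.measurableSet hK, volume_real_closedBall y hs,
    mul_div_assoc]

theorem closedBall_subset_cell (hr : 0 ≤ r) (hη : η ≤ 1) {y : EuclideanSpace ℝ (Fin d)}
    (hy : ‖y‖ ≤ 1) :
    Metric.closedBall (c + r • y) (η * r) ⊆ Metric.closedBall c (3 * r) := by
  refine Metric.closedBall_subset_closedBall' ?_
  rw [dist_eq_norm, add_sub_cancel_left, norm_smul, Real.norm_of_nonneg hr]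
  have h1 := mul_le_of_le_one_right hr hy
  have h2 := mul_le_of_le_one_left hr hη
  linarith

variable [IsProbabilityMeasure (volume[|K] : Measure (EuclideanSpace ℝ (Fin d)))]

/-- All balls involved lie in `K`, so the probability is exact and the same for every cell and
labelling; the second-moment comparison relies on this. -/
theorem law_real_cellEvent (ρ : ℕ → unitInterval) (hr : 0 < r) (hη0 : 0 < η) (hη : η ≤ 1)
    (hu : ∀ i, ‖u i‖ ≤ 1) (hK : Metric.closedBall c (3 * r) ⊆ K) :
    (law K ρ n).real (cellEvent u η r N h c f) =
      ((η * r) ^ d * (unitVol d / volume.real K)) ^ Fintype.card ι *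
      (1 - (3 * r) ^ d * (unitVol d / volume.real K)) ^ (n - Fintype.card ι) *
      coinWeight ρ N h (Fintype.card ι) := by
  rw [cellEvent_eq_box, law_real_box_allowed, Finset.card_map, Finset.card_univ]
  congr 1
  rw [← Finset.prod_mul_prod_compl (Finset.univ.map f), Finset.prod_map]
  congr 1
  · refine (Finset.prod_congr rfl fun i _ => ?_).trans (Finset.prod_const _)
    rw [cellSet_apply, cond_real_closedBall (mul_pos hη0 hr)
      ((closedBall_subset_cell hr.le hη (hu i)).trans hK)]
  · have hc : (Finset.univ.map f)ᶜ.card = n - Fintype.card ι := by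
      rw [Finset.card_compl, Finset.card_map, Fintype.card_fin, Finset.card_univ]
    rw [← hc]
    refine (Finset.prod_congr rfl fun v hv => ?_).trans (Finset.prod_const _)
    rw [cellSet_of_notMem (Finset.mem_compl.1 hv),
      probReal_compl_eq_one_sub Metric.isClosed_closedBall.measurableSet,
      cond_real_closedBall (by positivity) hK]

/-- A shared vertex would be within `3r` of both centres. -/
theorem law_real_cellEvent_inter_eq_zero (ρ : ℕ → unitInterval) (hr : 0 ≤ r) (hη : η ≤ 1)
    (hu : ∀ i, ‖u i‖ ≤ 1) (hcc' : 6 * r < dist c c')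
    (hff' : ¬ Disjoint (Finset.univ.map f) (Finset.univ.map f')) :
    (law K ρ n).real (cellEvent u η r N h c f ∩ cellEvent u η r N h c' f') = 0 := by
  rw [Finset.not_disjoint_iff] at hff'
  obtain ⟨v, hv, hv'⟩ := hff'
  obtain ⟨i, -, rfl⟩ := Finset.mem_map.1 hv
  obtain ⟨j, -, hj⟩ := Finset.mem_map.1 hv'
  have : cellEvent u η r N h c f ∩ cellEvent u η r N h c' f' = ∅ := by
    refine Set.eq_empty_of_forall_notMem fun ω hω => ?_
    have h1 := closedBall_subset_cell (c := c) hr hη (hu i) (hω.1.1 i)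
    have h2 := closedBall_subset_cell (c := c') hr hη (hu j) (hω.2.1 j)
    rw [hj] at h2
    rw [Metric.mem_closedBall] at h1 h2
    have := dist_triangle_left c c' (ω.1 (f i))
    linarith
  rw [this, measureReal_empty]

/-- The unused vertices avoid two disjoint balls of mass `b`, giving `1 - 2b` each. For a pattern
vertex, avoiding the other cell is simply dropped. -/
theorem law_real_cellEvent_inter_le (ρ : ℕ → unitInterval) (hr : 0 < r) (hη0 : 0 < η) (hη : η ≤ 1)
    (hu : ∀ i, ‖u i‖ ≤ 1) (hK : Metric.closedBall c (3 * r) ⊆ K)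
    (hK' : Metric.closedBall c' (3 * r) ⊆ K) (hcc' : 6 * r < dist c c')
    (hff' : Disjoint (Finset.univ.map f) (Finset.univ.map f')) :
    (law K ρ n).real (cellEvent u η r N h c f ∩ cellEvent u η r N h c' f') ≤
      ((η * r) ^ d * (unitVol d / volume.real K)) ^ (2 * Fintype.card ι) *
      (1 - 2 * ((3 * r) ^ d * (unitVol d / volume.real K))) ^ (n - 2 * Fintype.card ι) *
      coinWeight ρ N h (Fintype.card ι) ^ 2 := by
  set α := (η * r) ^ d * (unitVol d / volume.real K) with hα
  set b := (3 * r) ^ d * (unitVol d / volume.real K) with hb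
  set R := Finset.univ.map f with hR
  set R' := Finset.univ.map f' with hR'
  have hRc : R.card = Fintype.card ι := by rw [hR, Finset.card_map, Finset.card_univ]
  have hRc' : R'.card = Fintype.card ι := by rw [hR', Finset.card_map, Finset.card_univ]
  have hsub : cellEvent u η r N h c f ∩ cellEvent u η r N h c' f' ⊆
      box (fun v => cellSet u η r c f v ∩ cellSet u η r c' f' v)
        fun s => if s ⊆ R ∨ s ⊆ R' then allowed N h s.card else Set.univ := by
    rw [cellEvent_eq_box, cellEvent_eq_box]
    rintro ω ⟨h1, h2⟩
    refine ⟨fun v => ⟨h1.1 v, h2.1 v⟩, fun s => ?_⟩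
    have h3 := h1.2 s
    have h4 := h2.2 s
    dsimp only at h3 h4 ⊢
    split_ifs with hs
    · rcases hs with hs | hs
      · rwa [if_pos hs] at h3
      · rwa [if_pos hs] at h4
    · trivial
  refine (measureReal_mono hsub (measure_ne_top _ _)).trans ?_
  rw [law_real_box_allowed_two _ _ _ _ hff', hRc, hRc', ← sq]
  refine mul_le_mul_of_nonneg_right ?_ (sq_nonneg _)
  rw [← Finset.prod_mul_prod_compl (R ∪ R')]
  have hball : ∀ c₀ : EuclideanSpace ℝ (Fin d), Metric.closedBall c₀ (3 * r) ⊆ K → ∀ i,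
      (volume[|K] : Measure _).real (Metric.closedBall (c₀ + r • u i) (η * r)) = α :=
    fun c₀ hc₀ i => cond_real_closedBall (mul_pos hη0 hr)
      ((closedBall_subset_cell hr.le hη (hu i)).trans hc₀)
  have h1 : ∏ v ∈ R ∪ R', (volume[|K] : Measure _).real
      (cellSet u η r c f v ∩ cellSet u η r c' f' v) ≤ α ^ (2 * Fintype.card ι) := by
    rw [two_mul, ← hRc, show R.card + R.card = (R ∪ R').card by
      rw [Finset.card_union_of_disjoint hff', hRc, hRc']]
    refine (Finset.prod_le_prod (fun _ _ => measureReal_nonneg) fun v hv => ?_).trans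
      (Finset.prod_const _).le
    rcases Finset.mem_union.1 hv with hv | hv
    · obtain ⟨i, -, rfl⟩ := Finset.mem_map.1 hv
      rw [cellSet_apply, ← hball c hK i]
      exact measureReal_mono Set.inter_subset_left
    · obtain ⟨i, -, rfl⟩ := Finset.mem_map.1 hv
      rw [cellSet_apply, ← hball c' hK' i]
      exact measureReal_mono Set.inter_subset_right
  have h2 : ∏ v ∈ (R ∪ R')ᶜ, (volume[|K] : Measure _).real
      (cellSet u η r c f v ∩ cellSet u η r c' f' v) = (1 - 2 * b) ^ (n - 2 * Fintype.card ι) := by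
    have hc : (R ∪ R')ᶜ.card = n - 2 * Fintype.card ι := by
      rw [Finset.card_compl, Fintype.card_fin, Finset.card_union_of_disjoint hff', hRc, hRc',
        two_mul]
    rw [← hc]
    refine (Finset.prod_congr rfl fun v hv => ?_).trans (Finset.prod_const _)
    rw [Finset.mem_compl, Finset.mem_union, not_or] at hv
    rw [cellSet_of_notMem hv.1, cellSet_of_notMem hv.2, ← Set.compl_union,
      probReal_compl_eq_one_sub (Metric.isClosed_closedBall.measurableSet.union
        Metric.isClosed_closedBall.measurableSet), measureReal_union
        (Metric.closedBall_disjoint_closedBall (by linarith))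
        Metric.isClosed_closedBall.measurableSet, cond_real_closedBall (by positivity) hK,
      cond_real_closedBall (by positivity) hK', ← hb, two_mul]
  rw [h2]
  have hb2 : 0 ≤ (1 - 2 * b) ^ (n - 2 * Fintype.card ι) := by
    rw [← h2]
    exact Finset.prod_nonneg fun _ _ => measureReal_nonneg
  exact mul_le_mul_of_nonneg_right h1 hb2

/-- The probability that none of the cells contains an isolated pattern. -/
theorem law_real_forall_notMem_cellEvent_le (ρ : ℕ → unitInterval) (hr : 0 < r) (hη0 : 0 < η)
    (hη : η ≤ 1 / 2) (hu : ∀ i, ‖u i‖ ≤ 1) (hsep : ∀ i j, i ≠ j → 2 * η < dist (u i) (u j))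
    (hn : 2 * Fintype.card ι ≤ n) {T : Finset (EuclideanSpace ℝ (Fin d))}
    (hT : ∀ c ∈ T, Metric.closedBall c (3 * r) ⊆ K)
    (hTsep : (T : Set (EuclideanSpace ℝ (Fin d))).Pairwise fun x y => 6 * r < dist x y)
    (hb : (3 * r) ^ d * (unitVol d / volume.real K) ≤ 1 / 2) {S : ℝ} (hS0 : 0 < S)
    (hS : S ≤ T.card * (n / 2 : ℝ) ^ Fintype.card ι *
      (((η * r) ^ d * (unitVol d / volume.real K)) ^ Fintype.card ι *
      (1 - (3 * r) ^ d * (unitVol d / volume.real K)) ^ (n - Fintype.card ι) *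
      coinWeight ρ N h (Fintype.card ι))) :
    (law K ρ n).real {ω | ∀ c ∈ T, ∀ f : ι ↪ Fin n, ω ∉ cellEvent u η r N h c f} ≤ 1 / S +
      (((1 - (3 * r) ^ d * (unitVol d / volume.real K)) ^ (2 * Fintype.card ι))⁻¹ - 1) := by
  classical
  set m := Fintype.card ι with hm
  set α := (η * r) ^ d * (unitVol d / volume.real K) with hα
  set b := (3 * r) ^ d * (unitVol d / volume.real K) with hbdef
  set w := coinWeight ρ N h m with hw
  have hη1 : η ≤ 1 := by linarith
  have hb1 : 0 < 1 - b := by linarith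
  set E : T × (ι ↪ Fin n) → Set ((Fin n → EuclideanSpace ℝ (Fin d)) × (Finset (Fin n) → Bool)) :=
    fun i => cellEvent u η r N h i.1.1 i.2 with hE
  have hP : ∀ i, (law K ρ n).real (E i) = α ^ m * (1 - b) ^ (n - m) * w := fun i =>
    law_real_cellEvent ρ hr hη0 hη1 hu (hT _ i.1.2)
  have hα0 : 0 ≤ α := by
    have : 0 ≤ unitVol d / volume.real K := div_nonneg unitVol_pos.le measureReal_nonneg
    positivity
  have hw0 : 0 ≤ w := coinWeight_nonneg _ _ _ _
  have hsum : S ≤ ∑ i, (law K ρ n).real (E i) := by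
    rw [Finset.sum_congr rfl fun i _ => hP i, Finset.sum_const, nsmul_eq_mul, Finset.card_univ,
      Fintype.card_prod, Fintype.card_coe, Fintype.card_embedding_eq, Fintype.card_fin]
    refine hS.trans (mul_le_mul_of_nonneg_right ?_ (by positivity))
    push_cast
    refine mul_le_mul_of_nonneg_left ?_ (Nat.cast_nonneg _)
    -- The number of labellings is at least `(n / 2) ^ m`, because `n ≥ 2m`.
    have h1 : ((n + 1 - m : ℕ) : ℝ) ^ m ≤ (n.descFactorial m : ℝ) := by
      exact_mod_cast Nat.pow_sub_le_descFactorial n m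
    refine le_trans (pow_le_pow_left₀ (by positivity) ?_ _) h1
    rw [Nat.cast_sub (by omega)]
    have : (2 * m : ℝ) ≤ n := by exact_mod_cast hn
    push_cast
    linarith
  have hpair : ∀ i j, i ≠ j → (law K ρ n).real (E i ∩ E j) ≤
      ((1 - b) ^ (2 * m))⁻¹ * ((law K ρ n).real (E i) * (law K ρ n).real (E j)) := by
    rintro ⟨c, f⟩ ⟨c', f'⟩ hij
    have hnn : 0 ≤ ((1 - b) ^ (2 * m))⁻¹ * ((law K ρ n).real (E (c, f)) *
      (law K ρ n).real (E (c', f'))) := by positivity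
    by_cases hcc' : c = c'
    · subst hcc'
      have : E (c, f) ∩ E (c, f') = ∅ := by
        refine Set.eq_empty_of_forall_notMem fun ω hω => hij ?_
        have hff : f = f' := eq_of_mem_cellEvent hω.1 hω.2 hr hη hu hsep
        rw [hff]
      rw [this, measureReal_empty]
      exact hnn
    · have hdist : 6 * r < dist c.1 c'.1 := hTsep c.2 c'.2 fun h => hcc' (Subtype.ext h)
      by_cases hff' : Disjoint (Finset.univ.map f) (Finset.univ.map f')
      · refine (law_real_cellEvent_inter_le ρ hr hη0 hη1 hu (hT _ c.2) (hT _ c'.2) hdist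
          hff').trans ?_
        rw [hP, hP, ← hm, ← hα, ← hbdef, ← hw]
        -- Since `1 - 2b ≤ (1 - b) ^ 2`, correlation costs only the `2m` missing factors `1 - b`,
        -- which make up the constant `θ`.
        have h2 : (1 - 2 * b) ^ (n - 2 * m) ≤ ((1 - b) ^ (2 * m))⁻¹ *
            ((1 - b) ^ (n - m) * (1 - b) ^ (n - m)) := by
          have h3 : (1 - b) ^ (n - m) * (1 - b) ^ (n - m) =
              (1 - b) ^ (2 * m) * ((1 - b) ^ 2) ^ (n - 2 * m) := by
            rw [← pow_add, ← pow_mul, ← pow_add]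
            congr 1
            omega
          rw [h3, inv_mul_cancel_left₀ (pow_pos hb1 _).ne']
          refine pow_le_pow_left₀ (by linarith) ?_ _
          nlinarith [sq_nonneg b]
        calc α ^ (2 * m) * (1 - 2 * b) ^ (n - 2 * m) * w ^ 2
            ≤ α ^ (2 * m) * (((1 - b) ^ (2 * m))⁻¹ *
              ((1 - b) ^ (n - m) * (1 - b) ^ (n - m))) * w ^ 2 := by gcongr
          _ = _ := by ring
      · rw [show E (c, f) ∩ E (c', f') =
          cellEvent u η r N h c.1 f ∩ cellEvent u η r N h c'.1 f' from rfl,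
          law_real_cellEvent_inter_eq_zero ρ hr.le hη1 hu hdist hff']
        exact hnn
  have key := measureReal_forall_notMem_le (law K ρ n) (E := E)
    (fun i => measurableSet_cellEvent) (by positivity) hpair (hS0.trans_le hsum)
  refine le_trans ?_ (key.trans (add_le_add_left (one_div_le_one_div_of_le hS0 hsum) _))
  refine measureReal_mono fun ω hω i => hω _ i.1.2 i.2

end CellProbability

/-! ### Occurrence of patterns and nonvanishing homology -/

section NonvanishingLimit

variable {d : ℕ} {K : Set (EuclideanSpace ℝ (Fin d))}

theorem exp_neg_two_mul_le {b : ℝ} (hb0 : 0 ≤ b) (hb : b ≤ 1 / 2) :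
    Real.exp (-(2 * b)) ≤ 1 - b := by
  rw [Real.exp_neg]
  refine inv_le_of_inv_le₀ (by linarith) ?_
  have h1 : (1 - b)⁻¹ ≤ 2 * b + 1 := by
    rw [inv_le_iff_one_le_mul₀ (by linarith)]
    nlinarith
  exact h1.trans (Real.add_one_le_exp _)

theorem exp_le_one_sub_pow {b : ℝ} (hb0 : 0 ≤ b) (hb : b ≤ 1 / 2) (n m : ℕ) :
    Real.exp (-(2 * b * n)) ≤ (1 - b) ^ (n - m) :=
  calc Real.exp (-(2 * b * n)) = Real.exp (-(2 * b)) ^ n := by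
        rw [← Real.exp_nat_mul]
        ring_nf
    _ ≤ (1 - b) ^ n := pow_le_pow_left₀ (Real.exp_pos _).le (exp_neg_two_mul_le hb0 hb) _
    _ ≤ (1 - b) ^ (n - m) := pow_le_pow_of_le_one (by linarith) (by linarith) (Nat.sub_le _ _)

/-- A pattern occurs in some cell with high probability once the expected number of its isolated
copies is large. -/
theorem exists_law_forall_notMem_cellEvent_le (hd : 1 ≤ d) (hbdd : Bornology.IsBounded K)
    (hint : (interior K).Nonempty) {ι : Type*} [Fintype ι] {m : ℕ} (hm : Fintype.card ι = m + 1)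
    {u : ι → EuclideanSpace ℝ (Fin d)} {η : ℝ} (hη0 : 0 < η) (hη : η ≤ 1 / 2)
    (hu : ∀ i, ‖u i‖ ≤ 1) (hsep : ∀ i j, i ≠ j → 2 * η < dist (u i) (u j)) :
    ∃ γ C r₀ : ℝ, 0 < γ ∧ 0 < C ∧ 0 < r₀ ∧ ∀ (ρ : ℕ → unitInterval) (n : ℕ) (r : ℝ) (N : ℕ)
      (h : Bool), 0 < r → r ≤ r₀ → 2 * (m + 1) ≤ n → 0 < coinWeight ρ N h (m + 1) →
      ∃ T : Finset (EuclideanSpace ℝ (Fin d)),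
        (law K ρ n).real {ω | ∀ c ∈ T, ∀ f : ι ↪ Fin n, ω ∉ cellEvent u η r N h c f} ≤
          1 / (γ * (n * (n * r ^ d) ^ m) * Real.exp (-(C * (n * r ^ d))) *
            coinWeight ρ N h (m + 1)) +
          (((1 - (3 * r) ^ d * (unitVol d / volume.real K)) ^ (2 * (m + 1)))⁻¹ - 1) := by
  have := isProbabilityMeasure_cond hbdd hint
  obtain ⟨c₀, hc₀⟩ := hint
  obtain ⟨ε, hε0, hε⟩ := Metric.nhds_basis_closedBall.mem_iff.1 (mem_interior_iff_mem_nhds.1 hc₀)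
  obtain ⟨_, _, hnet⟩ := exists_net (Metric.isBounded_closedBall (x := c₀) (r := ε / 2))
  set v := unitVol d / volume.real K with hv
  have hv0 : 0 < v := div_pos unitVol_pos (volume_real_pos hbdd ⟨c₀, hc₀⟩)
  set γ₁ := volume.real (Metric.closedBall c₀ (ε / 2)) / (6 ^ d * unitVol d) with hγ₁
  have hγ₁0 : 0 < γ₁ := by
    rw [hγ₁, volume_real_closedBall _ (by positivity)]
    have := unitVol_pos (d := d)
    positivity
  -- With `b = (3r)^d v`, the estimate `(1 - b)^n ≥ exp (-2bn)` yields `C`. The three bounds in `r₀`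
  -- ensure net scale `6r ≤ 1`, cells inside `K`, and `b ≤ 1 / 2`.
  refine ⟨γ₁ * (η ^ d * v / 2) ^ (m + 1), 2 * 3 ^ d * v, min (1 / 6) (min (ε / 6) (1 / (6 * v))),
    by positivity, by positivity, by positivity, fun ρ n r N h hr hr₀ hn hw => ?_⟩
  have hr1 : r ≤ 1 / 6 := hr₀.trans (min_le_left _ _)
  have hr2 : r ≤ ε / 6 := hr₀.trans ((min_le_right _ _).trans (min_le_left _ _))
  have hr3 : r ≤ 1 / (6 * v) := hr₀.trans ((min_le_right _ _).trans (min_le_right _ _))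
  have hb0 : 0 ≤ (3 * r) ^ d * v := by positivity
  have hb : (3 * r) ^ d * v ≤ 1 / 2 := by
    calc (3 * r) ^ d * v ≤ 3 * r * v := by
          gcongr
          exact pow_le_of_le_one (by positivity) (by linarith) (by omega)
      _ ≤ 3 * (1 / (6 * v)) * v := by gcongr
      _ = 1 / 2 := by field_simp; norm_num
  obtain ⟨T, hTsub, hTsep, hTcov, -⟩ := hnet (6 * r) (by positivity) (by linarith)
  refine ⟨T, ?_⟩
  have hn0 : (0 : ℝ) < n := by
    have : 0 < n := by omega
    exact_mod_cast this
  have hTK : ∀ c ∈ T, Metric.closedBall c (3 * r) ⊆ K := fun c hc =>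
    (Metric.closedBall_subset_closedBall' (by
      have := Metric.mem_closedBall.1 (hTsub hc)
      linarith)).trans hε
  -- At least `γ₁ r ^ (-d)` cells, by covering; this removes one power of `r ^ d` from the expected
  -- count.
  have hcard : γ₁ ≤ T.card * r ^ d := by
    have := le_card_of_net (by positivity) hTcov
    rw [hγ₁, div_le_iff₀ (mul_pos (by positivity) unitVol_pos)]
    refine this.trans (le_of_eq ?_)
    rw [mul_pow]
    ring
  have key := law_real_forall_notMem_cellEvent_le (n := n) (N := N) (h := h) ρ hr hη0 hη hu hsep
    (by rwa [hm]) hTK hTsep hb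
    (S := γ₁ * (η ^ d * v / 2) ^ (m + 1) * (n * (n * r ^ d) ^ m) *
      Real.exp (-(2 * 3 ^ d * v * (n * r ^ d))) * coinWeight ρ N h (m + 1))
    (by positivity) ?_
  · rwa [hm] at key
  · rw [hm]
    refine (mul_le_mul_of_nonneg_right (a := coinWeight ρ N h (m + 1))
      (c := T.card * (n / 2) ^ (m + 1) * ((η * r) ^ d * v) ^ (m + 1) *
        (1 - (3 * r) ^ d * v) ^ (n - (m + 1))) ?_ hw.le).trans (le_of_eq (by ring))
    have hexp := exp_le_one_sub_pow hb0 hb n (m + 1)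
    rw [show 2 * ((3 * r) ^ d * v) * n = 2 * 3 ^ d * v * (n * r ^ d) by rw [mul_pow]; ring] at hexp
    refine mul_le_mul ?_ hexp (Real.exp_pos _).le (by positivity)
    calc γ₁ * (η ^ d * v / 2) ^ (m + 1) * (n * (n * r ^ d) ^ m)
        ≤ T.card * r ^ d * (η ^ d * v / 2) ^ (m + 1) * (n * (n * r ^ d) ^ m) := by gcongr
      _ = T.card * (n / 2) ^ (m + 1) * ((η * r) ^ d * v) ^ (m + 1) := by
          rw [mul_pow η r]
          generalize r ^ d = y
          generalize η ^ d = z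
          ring

theorem tendsto_inv_one_sub_pow (hd : 1 ≤ d) {r : ℕ → ℝ} (hr : Tendsto r atTop (𝓝 0)) (v : ℝ)
    (m : ℕ) : Tendsto (fun n => ((1 - (3 * r n) ^ d * v) ^ m)⁻¹ - 1) atTop (𝓝 0) := by
  have h1 : Tendsto (fun n => (1 - (3 * r n) ^ d * v) ^ m) atTop (𝓝 1) := by
    have := (((((hr.const_mul 3).pow d).mul_const v).const_sub 1).pow m)
    rwa [mul_zero, zero_pow (by omega), zero_mul, sub_zero, one_pow] at this
  have h2 := (h1.inv₀ one_ne_zero).sub_const 1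
  rwa [inv_one, sub_self] at h2

theorem tendsto_zero_of_isLittleO_log (hd : 1 ≤ d) {r : ℕ → ℝ}
    (h : r =o[atTop] (fun n : ℕ => (Real.log n / n) ^ (1 / (d : ℝ)))) : Tendsto r atTop (𝓝 0) := by
  refine h.isBigO.trans_tendsto ?_
  have hd0 : (0 : ℝ) < 1 / d := by positivity
  have := tendsto_log_div_nat.rpow_const (p := 1 / (d : ℝ)) (Or.inr hd0.le)
  rwa [Real.zero_rpow hd0.ne'] at this

theorem mul_pow_le_of_isLittleO_log (hd : 1 ≤ d) {r : ℕ → ℝ} (hr : ∀ n, 0 ≤ r n)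
    (h : r =o[atTop] (fun n : ℕ => (Real.log n / n) ^ (1 / (d : ℝ)))) {a : ℝ} (ha0 : 0 < a) :
    ∀ᶠ n : ℕ in atTop, n * r n ^ d ≤ a * Real.log n := by
  -- Capping at `1` gives `a' ^ d ≤ a`.
  set a' := min a 1 with ha'
  have ha'0 : 0 < a' := lt_min ha0 one_pos
  filter_upwards [h.bound ha'0, eventually_ge_atTop 1] with n hn hn1
  have hlog0 : 0 ≤ Real.log n := Real.log_nonneg (by exact_mod_cast hn1)
  have hlog : 0 ≤ Real.log n / n := div_nonneg hlog0 (Nat.cast_nonneg _)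
  rw [Real.norm_of_nonneg (Real.rpow_nonneg hlog _), Real.norm_of_nonneg (hr n)] at hn
  have h1 := pow_le_pow_left₀ (hr n) hn d
  rw [mul_pow, ← Real.rpow_natCast ((_ : ℝ) ^ (1 / (d : ℝ))), ← Real.rpow_mul hlog, one_div,
    inv_mul_cancel₀ (by positivity), Real.rpow_one] at h1
  have h2 : a' ^ d ≤ a := (pow_le_of_le_one ha'0.le (min_le_right _ _) (by omega)).trans
    (min_le_left _ _)
  have hn0 : (0 : ℝ) < n := by positivity
  calc n * r n ^ d ≤ n * (a' ^ d * (Real.log n / n)) := by gcongr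
    _ = a' ^ d * Real.log n := by field_simp
    _ ≤ a * Real.log n := by gcongr

/-- Below the connectivity threshold, and with many hollow simplices, the homology is nonzero
asymptotically almost surely. -/
theorem aas_not_subsingleton {A : Type*} [CommRing A] [Nontrivial A] (hd : 2 ≤ d)
    (hbdd : Bornology.IsBounded K) (hint : (interior K).Nonempty) {k : ℕ} (hk : 1 ≤ k)
    {p : ℕ → ℕ → unitInterval} {r : ℕ → ℝ} (hr : ∀ n, 0 ≤ r n)
    (h1 : Tendsto (fun n : ℕ => (1 - (p n (k + 1) : ℝ)) *
      (∏ i ∈ Finset.Icc 1 k, (p n i : ℝ) ^ (k + 2).choose (i + 1)) *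
      (n : ℝ) ^ (k + 2) * r n ^ (d * (k + 1))) atTop atTop)
    (h2 : r =o[atTop] (fun n : ℕ => (Real.log n / n) ^ (1 / (d : ℝ))))
    (h3 : ∀ i ∈ Finset.Icc 1 k, Tendsto (fun n => (p n i : ℝ)) atTop (𝓝 1)) :
    AAS K r p (fun _ X => ¬ Subsingleton (Homology A X k)) := by
  have := isProbabilityMeasure_cond hbdd hint
  have hd1 : 1 ≤ d := by omega
  have hr0 := tendsto_zero_of_isLittleO_log hd1 h2
  obtain ⟨u₁, η₁, hη₁, hη₁', hu₁, hsep₁, hd₁⟩ := exists_hollow_pattern hd1 (k + 2)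
  obtain ⟨u₂, η₂, hη₂, hη₂', hu₂, hsep₂, hd₂, hd₂'⟩ := exists_crossPolytope_pattern hd (k + 1)
  obtain ⟨γ₁, C₁, r₁, hγ₁, hC₁, hr₁, hocc₁⟩ := exists_law_forall_notMem_cellEvent_le hd1 hbdd hint
    (m := k + 1) (by simp) hη₁ hη₁' hu₁ hsep₁
  obtain ⟨γ₂, C₂, r₂, hγ₂, hC₂, hr₂, hocc₂⟩ := exists_law_forall_notMem_cellEvent_le hd1 hbdd hint
    (m := 2 * k + 1) (by simp; ring) hη₂ hη₂' hu₂ hsep₂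
  set q : ℕ → ℝ := fun n => (1 - (p n (k + 1) : ℝ)) *
      (∏ i ∈ Finset.Icc 1 k, (p n i : ℝ) ^ (k + 2).choose (i + 1)) *
      (n : ℝ) ^ (k + 2) * r n ^ (d * (k + 1)) with hq
  set W : ℕ → ℝ := fun n => ∏ i ∈ Finset.Icc 1 k, (p n i : ℝ) ^ (2 * k + 2).choose (i + 1) with hW
  have hWlim : Tendsto W atTop (𝓝 1) := by
    have := tendsto_finsetProd (Finset.Icc 1 k) fun i hi =>
      (h3 i hi).pow ((2 * k + 2).choose (i + 1))
    simpa using this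
  set v := unitVol d / volume.real K with hv
  set g₁ : ℕ → ℝ := fun n => ((1 - (3 * r n) ^ d * v) ^ (2 * (k + 1 + 1)))⁻¹ - 1 with hg₁
  set g₂ : ℕ → ℝ := fun n => ((1 - (3 * r n) ^ d * v) ^ (2 * (2 * k + 1 + 1)))⁻¹ - 1 with hg₂
  set s₁ : ℕ → ℝ := fun n => 1 / (γ₁ * Real.exp (-C₁) * q n) with hs₁
  set s₂ : ℕ → ℝ := fun n => 1 / (γ₂ / 2 * Real.exp (Real.log n / 2)) with hs₂
  -- Which pattern is used may change with `n`, so the error is the maximum of both bounds.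
  have hlim : Tendsto (fun n => max (s₁ n + g₁ n) (s₂ n + g₂ n)) atTop (𝓝 0) := by
    have hs₁0 : Tendsto s₁ atTop (𝓝 0) :=
      (h1.const_mul_atTop (by positivity)).const_div_atTop 1
    have hs₂0 : Tendsto s₂ atTop (𝓝 0) := by
      refine Tendsto.const_div_atTop (Tendsto.const_mul_atTop (by positivity) ?_) 1
      exact Real.tendsto_exp_atTop.comp
        ((Real.tendsto_log_atTop.comp tendsto_natCast_atTop_atTop).atTop_div_const two_pos)
    have := (hs₁0.add (tendsto_inv_one_sub_pow hd1 hr0 v (2 * (k + 1 + 1)))).max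
      (hs₂0.add (tendsto_inv_one_sub_pow hd1 hr0 v (2 * (2 * k + 1 + 1))))
    rwa [add_zero, max_self] at this
  refine aas_of_tendsto hlim ?_
  filter_upwards [h1.eventually_gt_atTop 0, hr0.eventually (ge_mem_nhds hr₁),
    hr0.eventually (ge_mem_nhds hr₂), hWlim.eventually (le_mem_nhds (one_half_lt_one (α := ℝ))),
    mul_pow_le_of_isLittleO_log hd1 hr h2 (a := 1 / (2 * C₂)) (by positivity),
    eventually_ge_atTop (2 * (2 * k + 1 + 1))] with n hqn hn₁ hn₂ hWn hlogn hn
  have hn0 : (0 : ℝ) < n := by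
    have : 0 < n := by omega
    exact_mod_cast this
  have hrn : 0 < r n := by
    refine (hr n).lt_of_ne fun h => hqn.ne' ?_
    simp only [hq]
    rw [← h, zero_pow (Nat.mul_ne_zero (by omega) (by omega)), mul_zero]
  set x := n * r n ^ d with hx
  have hx0 : 0 < x := by positivity
  simp only [not_not]
  rcases le_total x 1 with hx1 | hx1
  -- For `x ≤ 1` the isolation factor is at least `exp (-C₁)`, and weight times `n * x ^ (k + 1)` is
  -- exactly `q n`.
  · have hw : coinWeight (p n) (k + 1) true (k + 1 + 1) =
        (∏ i ∈ Finset.Icc 1 k, (p n i : ℝ) ^ (k + 2).choose (i + 1)) *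
        (1 - (p n (k + 1) : ℝ)) := by
      rw [coinWeight_eq _ _ _ _ (by omega) (fun _ => le_rfl)]
      simp
    have hqw : q n = coinWeight (p n) (k + 1) true (k + 1 + 1) * (n * x ^ (k + 1)) := by
      rw [hw, hx, mul_pow, ← pow_mul]
      simp only [hq]
      ring
    have hw0 : 0 < coinWeight (p n) (k + 1) true (k + 1 + 1) := by
      change 0 < q n at hqn
      rw [hqw] at hqn
      exact pos_of_mul_pos_left hqn (by positivity)
    obtain ⟨T, hT⟩ := hocc₁ (p n) n (r n) (k + 1) true hrn hn₁ (by omega) hw0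
    refine le_trans ?_ (le_max_left _ _)
    refine (measureReal_mono fun ω hω c _ f hc => ?_).trans (hT.trans ?_)
    · exact not_subsingleton_of_hollow hk hc hrn.le (by linarith) hu₁ hd₁ hω
    · refine add_le_add_left (one_div_le_one_div_of_le (by positivity) ?_) _
      rw [hqw]
      calc γ₁ * Real.exp (-C₁) * (coinWeight (p n) (k + 1) true (k + 1 + 1) * (n * x ^ (k + 1)))
          = γ₁ * (n * x ^ (k + 1)) * Real.exp (-C₁) *
            coinWeight (p n) (k + 1) true (k + 1 + 1) := by ring
        _ ≤ _ := by
            gcongr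
            exact mul_le_of_le_one_right hC₁.le hx1
  · have hw : coinWeight (p n) (k + 1) false (2 * k + 1 + 1) = W n := by
      rw [coinWeight_eq _ _ _ _ (by omega) (by simp)]
      simp [hW]
    have hw0 : 0 < coinWeight (p n) (k + 1) false (2 * k + 1 + 1) := by
      rw [hw]
      linarith
    obtain ⟨T, hT⟩ := hocc₂ (p n) n (r n) (k + 1) false hrn hn₂ hn hw0
    refine le_trans ?_ (le_max_right _ _)
    refine (measureReal_mono fun ω hω c _ f hc => ?_).trans (hT.trans ?_)
    · exact not_subsingleton_of_crossPolytope hk hc hrn (by linarith) hu₂ hd₂ hd₂' hω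
    · refine add_le_add_left (one_div_le_one_div_of_le (by positivity) ?_) _
      rw [hw]
      -- The constant `1 / (2 * C₂)` in the bound on `x` makes isolation cost at most a factor `√n`,
      -- while `x ≥ 1` and `W n ≥ 1 / 2` handle the rest.
      have hexp : Real.exp (Real.log n / 2) ≤ n * Real.exp (-(C₂ * x)) := by
        rw [← Real.exp_log hn0, ← Real.exp_add, Real.exp_le_exp, Real.exp_log hn0]
        have := mul_le_mul_of_nonneg_left hlogn hC₂.le
        rw [show C₂ * (1 / (2 * C₂) * Real.log n) = Real.log n / 2 by field_simp] at this
        linarith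
      calc γ₂ / 2 * Real.exp (Real.log n / 2) ≤ γ₂ / 2 * (n * Real.exp (-(C₂ * x))) := by gcongr
        _ = γ₂ * (n * 1) * Real.exp (-(C₂ * x)) * (1 / 2) := by ring
        _ ≤ γ₂ * (n * x ^ (2 * k + 1)) * Real.exp (-(C₂ * x)) * W n := by
            gcongr
            exact one_le_pow₀ hx1

end NonvanishingLimit

end SoftRips

theorem mainTheorem10 {A : Type*} [CommRing A] [Nontrivial A] {d : ℕ} (hd : 1 ≤ d)
    (K : Set (EuclideanSpace ℝ (Fin d))) (hconv : Convex ℝ K) (hbdd : Bornology.IsBounded K)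
    (hint : (interior K).Nonempty) (k : ℕ) (hk : 1 ≤ k)
    (p : ℕ → ℕ → unitInterval) (r : ℕ → ℝ) (hr : ∀ n, 0 ≤ r n) :
    ((((fun n : ℕ => (n : ℝ) * r n ^ d) =o[atTop] (fun n : ℕ =>
            (1 - (p n (k + 1) : ℝ)) *
              ∏ i ∈ Finset.Icc 1 k, (p n i : ℝ) ^ (k + 1).choose i) ∧
          Tendsto (fun n : ℕ =>
            (1 - (p n (k + 1) : ℝ)) *
              (∏ i ∈ Finset.Icc 1 k, (p n i : ℝ) ^ (k + 2).choose (i + 1)) *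
              (n : ℝ) ^ (k + 2) * r n ^ (d * (k + 1))) atTop (𝓝 0)) ∨
        ((fun n : ℕ => (Real.log n / n) ^ (1 / (d : ℝ))) =o[atTop] r ∧
          ∀ i ∈ Finset.Icc 1 (k + 1), ∃ c : ℝ, 0 < c ∧ ∀ᶠ n in atTop, c ≤ (p n i : ℝ))) →
      SoftRips.AAS K r p (fun _ X => Subsingleton (SoftRips.Homology A X k))) ∧
    (2 ≤ d →
      Tendsto (fun n : ℕ =>
          (1 - (p n (k + 1) : ℝ)) *
            (∏ i ∈ Finset.Icc 1 k, (p n i : ℝ) ^ (k + 2).choose (i + 1)) *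
            (n : ℝ) ^ (k + 2) * r n ^ (d * (k + 1))) atTop atTop →
      r =o[atTop] (fun n : ℕ => (Real.log n / n) ^ (1 / (d : ℝ))) →
      (∀ i ∈ Finset.Icc 1 k, Tendsto (fun n => (p n i : ℝ)) atTop (𝓝 1)) →
      SoftRips.AAS K r p (fun _ X => ¬ Subsingleton (SoftRips.Homology A X k))) := by
  refine ⟨fun h => h.elim ?_ ?_, fun hd2 h1 h2 h3 => ?_⟩
  · exact fun h => SoftRips.aas_subsingleton_of_sparse hconv hbdd hint hk hr h.1 h.2
  · exact fun h => SoftRips.aas_subsingleton_of_dense hd hconv hbdd hint hk hr h.1 h.2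
  · exact SoftRips.aas_not_subsingleton hd2 hbdd hint hk hr h1 h2 h3
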